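/- Let $S^1=\mathbb{R}/\mathbb{Z}$ and let $\mathrm{Homeo}(S^1)$ be the group of homeomorphisms of $S^1$, with the $C^0$-topology; all measures on it are Borel. For a probability measure $\mu$ on $\mathrm{Homeo}(S^1)$, let $\langle\langle \operatorname{supp}\mu\rangle\rangle$ denote the subsemigroup of $\mathrm{Homeo}(S^1)$ generated by the support of $\mu$. Two homeomorphisms $f_1,f_2\in\mathrm{Homeo}(S^1)$ comprise a ping-pong pair (Schottky pair) if there are pairwise disjoint open sets $U_1,U_2,V_1,V_2\subseteq S^1$ with $$f_i(S^1\setminus U_i)\subseteq V_i,\qquad f_i^{-1}(S^1\setminus V_i)\subseteq U_i\qquad(i=1,2).$$ A random walk driven by $\mu$ is a process $Z_n=g_1g_2\cdots g_n$ (right random walk) or $Z_n=g_n\cdots g_2g_1$ (left random walk), where $g_1,g_2,\dots$ are independent random variables with law $\mu$; either convention is allowed below. **Theorem.** Let $\mu_1$ and $\mu_2$ be probability measures on $\mathrm{Homeo}(S^1)$ such that neither of the semigroups $\langle\langle \operatorname{supp}\mu_1\rangle\rangle$ and $\langle\langle \operatorname{supp}\mu_2\rangle\rangle$ admits an invariant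 Borel probability measure on $S^1$. Let $(Z_n)_{n>0}$ and $(Z'_n)_{n>0}$ be independent random walks driven by $\mu_1$ and $\mu_2$, respectively. Then there exists $\kappa>0$ such that $$\mathbb{P}\bigl(Z_n\text{ and }Z'_n\text{ comprise a ping-pong pair}\bigr)\ \ge\ 1-\frac1\kappa e^{-\kappa n}\qquad\text{for all integers } n>0. \tag{$*$}$$ Furthermore, there exist neighborhoods $\mathcal{U}_1$ of $\mu_1$ and $\mathcal{U}_2$ of $\mu_2$ in the space of probability measures on $\mathrm{Homeo}(S^1)$ with the weak-$*$ topology (convergence of integrals of bounded continuous functions), and a single constant $\kappa>0$, such that $(*)$ holds whenever $(Z_n)_{n>0}$ and $(Z'_n)_{n>0}$ are independent random walks driven by measures $\nu_1\in\mathcal{U}_1$ and $\nu_2\in\mathcal{U}_2$, respectively. -/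

import Mathlib

open MeasureTheory ProbabilityTheory
open scoped Topology

universe u

/-- The group `Homeo(S¹)` of all homeomorphisms of the circle `S¹ = ℝ / ℤ`; the product is the
composition, `(f * g) x = f (g x)`. -/
abbrev HomeoCircle : Type := UnitAddCircle ≃ₜ UnitAddCircle

/-- The `C⁰`-topology (topology of uniform convergence) on `Homeo(S¹)`: the one induced from the
space of continuous maps `S¹ → S¹` with the compact-open topology. -/
instance HomeoCircle.instTopologicalSpace : TopologicalSpace HomeoCircle :=
  TopologicalSpace.induced
    (fun f : HomeoCircle => (⟨f, f.continuous⟩ : C(UnitAddCircle, UnitAddCircle))) inferInstance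

/-- The Borel `σ`-algebra on `Homeo(S¹)`. -/
instance HomeoCircle.instMeasurableSpace : MeasurableSpace HomeoCircle := borel HomeoCircle

instance HomeoCircle.instBorelSpace : BorelSpace HomeoCircle := ⟨rfl⟩

/-- The subsemigroup of `Homeo(S¹)` generated by the support of `μ`. -/
def suppSemigroup (μ : ProbabilityMeasure HomeoCircle) : Subsemigroup HomeoCircle :=
  Subsemigroup.closure (μ : Measure HomeoCircle).support

/-- The semigroup `G` admits an invariant Borel probability measure on the circle. -/
def AdmitsInvariantProbability (G : Subsemigroup HomeoCircle) : Prop :=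
  ∃ ν : Measure UnitAddCircle, IsProbabilityMeasure ν ∧ ∀ g ∈ G, ν.map g = ν

/-- `(f₁, f₂)` is a ping-pong (Schottky) pair: there are pairwise disjoint open sets
`U₁, U₂, V₁, V₂` of the circle with `fᵢ (S¹ \ Uᵢ) ⊆ Vᵢ` and `fᵢ⁻¹ (S¹ \ Vᵢ) ⊆ Uᵢ`, `i = 1, 2`. -/
def IsPingPongPair (f₁ f₂ : HomeoCircle) : Prop :=
  ∃ U₁ U₂ V₁ V₂ : Set UnitAddCircle,
    IsOpen U₁ ∧ IsOpen U₂ ∧ IsOpen V₁ ∧ IsOpen V₂ ∧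
    Disjoint U₁ U₂ ∧ Disjoint U₁ V₁ ∧ Disjoint U₁ V₂ ∧
    Disjoint U₂ V₁ ∧ Disjoint U₂ V₂ ∧ Disjoint V₁ V₂ ∧
    f₁ '' U₁ᶜ ⊆ V₁ ∧ f₁.symm '' V₁ᶜ ⊆ U₁ ∧
    f₂ '' U₂ᶜ ⊆ V₂ ∧ f₂.symm '' V₂ᶜ ⊆ U₂

/-- `Z` is a random walk on `Homeo(S¹)` driven by `μ`, defined on the probability space `(Ω, P)`:
there are independent steps `g 0, g 1, …` of law `μ` such that either `Zₙ = g 0 * ⋯ * g (n - 1)`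
for all `n` (right random walk) or `Zₙ = g (n - 1) * ⋯ * g 0` for all `n` (left random walk). -/
def IsRandomWalk {Ω : Type*} [MeasurableSpace Ω] (P : Measure Ω)
    (μ : ProbabilityMeasure HomeoCircle) (Z : ℕ → Ω → HomeoCircle) : Prop :=
  ∃ g : ℕ → Ω → HomeoCircle,
    (∀ i, Measurable (g i)) ∧ (∀ i, P.map (g i) = (μ : Measure HomeoCircle)) ∧ iIndepFun g P ∧
    (∀ ω, Z 0 ω = 1) ∧
    ((∀ n ω, Z (n + 1) ω = Z n ω * g n ω) ∨ (∀ n ω, Z (n + 1) ω = g n ω * Z n ω))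

/-- For all independent random walks `(Zₙ)` and `(Z'ₙ)` driven by `μ₁` and `μ₂`, on any
probability space, and all `n > 0`, the probability that `Zₙ` and `Z'ₙ` comprise a ping-pong pair
is at least `1 - (1 / κ) * exp (- κ * n)`. -/
def PingPongEstimate (κ : ℝ) (μ₁ μ₂ : ProbabilityMeasure HomeoCircle) : Prop :=
  ∀ (Ω : Type u) [MeasurableSpace Ω] (P : Measure Ω) [IsProbabilityMeasure P]
    (Z Z' : ℕ → Ω → HomeoCircle),
    IsRandomWalk P μ₁ Z → IsRandomWalk P μ₂ Z' →
    IndepFun (fun ω n => Z n ω) (fun ω n => Z' n ω) P →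
    ∀ n : ℕ, 0 < n →
      1 - 1 / κ * Real.exp (-κ * n) ≤ P.real {ω | IsPingPongPair (Z n ω) (Z' n ω)}

/-!
The proof is elementary: it uses neither stationary measures nor boundary theory, and it makes all
constants depend only on lower bounds for the masses that convolution powers of the driving
measures give to finitely many open sets. Such bounds persist near the measures, so the uniform
statement comes with the same proof.

*Contractions.* Let `Γ` be a monoid of homeomorphisms of the circle without invariant probability
measure. If there were arbitrarily many disjoint arcs whose images under `Γ` all have length
bounded below, uniform distributions on maximal families of such arcs would be almost invariant
(`hasInvariantProbability_of_packings`). Hence every point has a neighbourhood that `Γ` contracts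
to arbitrarily small length (`exists_contracted_ball`). A measure that maximises the sum of the
squares of its atoms, among the limits of images of the length, therefore has at most one atom in
each of these neighbourhoods and no other mass, so it is finitely supported
(`exists_finite_support_limit`). This gives finite sets `R` and `A` such that elements of `Γ` map
the complement of any neighbourhood of `R` into any neighbourhood of `A` (`exists_contraction`).
Finite sets can be moved off each other (`exists_disjoint_image`), so there are `K` and, for each
`r`, words `s e`, `e < r`, of a common length `N` and pairwise disjoint open sets `U e`, `V e`,
each of them a union of arcs marked by at most `K` points, with `s e` mapping the complement of `U
e` into `V e` (`exists_schottkySets_words`).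

*Pivots.* The law of `N` steps is a mixture that has, with weight `b` for each label `e`, a
component carried by the homeomorphisms mapping the complement of `U e` into `V e`
(`exists_mixture`). It is enough to consider fixed values of the steps for each label, so that
only the labels are random (`walkSum_lintegral_convPow_le`). The walk is then recorded by a stack
of labelled contractions in which each contraction has its `U` disjoint from the image of the
preceding `V`. A new contraction is pushed if this remains true; otherwise the top of the stack is
popped. For a given stack without its labels, the labels remain independent of each other up to
the disjointness conditions, and because sets that meet contain a marked point of one another, few
pairs of labels are incompatible. A bound that improves geometrically with the height of the stack
thus improves geometrically with the number of steps (`chainSum_stackSum_le`). The bound is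
applied to the event that a given point lies in the repelling set of the lower half of the stack
or in the attracting set of its upper half, and to the event that these two sets meet. If the
product of one stack and that of another do not form a ping-pong pair, then one of finitely many
such events occurs (`ind_not_isPingPongPair_le`), whence the exponential estimate.
-/

section

open Metric Set Filter
open scoped ENNReal

/-! ### Arcs of the circle -/

/-- Every point of the circle has a representative of minimal absolute value. -/
lemma exists_coe_abs_eq_norm (z : UnitAddCircle) :
    ∃ t : ℝ, (t : UnitAddCircle) = z ∧ |t| = ‖z‖ := by
  obtain ⟨x, rfl⟩ := QuotientAddGroup.mk_surjective z
  refine ⟨x - round x, ?_, ?_⟩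
  · have : ((round x : ℝ) : UnitAddCircle) = 0 := by
      have := AddCircle.coe_period (1:ℝ)
      rw [show ((round x : ℤ):ℝ) = (round x : ℤ) • (1:ℝ) by simp]
      rw [AddCircle.coe_zsmul, this, smul_zero]
    rw [AddCircle.coe_sub, this, sub_zero]
  · exact (UnitAddCircle.norm_eq (x := x)).symm

lemma ball_coe_eq_image (a r : ℝ) :
    ball (a : UnitAddCircle) r = (fun t : ℝ => (t : UnitAddCircle)) '' ball a r := by
  ext y
  constructor
  · intro hy
    obtain ⟨t, ht, ht'⟩ := exists_coe_abs_eq_norm (y - a)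
    refine ⟨a + t, ?_, ?_⟩
    · rw [mem_ball, dist_eq_norm] at hy
      rw [mem_ball, Real.dist_eq, add_sub_cancel_left, ht']
      exact hy
    · simp [ht]
  · rintro ⟨t, ht, rfl⟩
    rw [mem_ball, dist_eq_norm]
    rw [mem_ball, Real.dist_eq] at ht
    refine lt_of_le_of_lt ?_ ht
    rw [← AddCircle.coe_sub]
    rw [UnitAddCircle.norm_eq]
    simpa using round_le (t - a) 0

lemma isPreconnected_ball_circle (x : UnitAddCircle) (r : ℝ) : IsPreconnected (ball x r) := by
  obtain ⟨a, rfl⟩ := QuotientAddGroup.mk_surjective x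
  change IsPreconnected (ball (a : UnitAddCircle) r)
  rw [ball_coe_eq_image]
  exact (convex_ball a r).isPreconnected.image _ (AddCircle.continuous_mk' 1).continuousOn

lemma lt_volume_ball_circle (x : UnitAddCircle) {ε : ℝ} (h0 : 0 < ε) (h1 : ε < 1) :
    ENNReal.ofReal ε < volume (ball x ε) := by
  have h : closedBall x (3 / 4 * ε) ⊆ ball x ε := closedBall_subset_ball (by linarith)
  refine lt_of_lt_of_le ?_ (measure_mono h)
  rw [AddCircle.volume_closedBall]
  rw [ENNReal.ofReal_lt_ofReal_iff_of_nonneg h0.le]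
  exact lt_min h1 (by linarith)

lemma sphere_circle_subset (a : UnitAddCircle) (r : ℝ) :
    sphere a r ⊆ {a + (r : UnitAddCircle), a - (r : UnitAddCircle)} := by
  intro y hy
  obtain ⟨t, ht, ht'⟩ := exists_coe_abs_eq_norm (y - a)
  rw [mem_sphere, dist_eq_norm] at hy
  rw [hy] at ht'
  have hy' : y = a + (t : UnitAddCircle) := by rw [ht]; abel
  rcases abs_choice t with h | h <;> rw [h] at ht'
  · left; rw [hy', ht']
  · right; rw [mem_singleton_iff, hy', ← ht']; simp

lemma frontier_ball_circle_subset (a : UnitAddCircle) (r : ℝ) :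
    frontier (ball a r) ⊆ {a + (r : UnitAddCircle), a - (r : UnitAddCircle)} :=
  frontier_ball_subset_sphere.trans (sphere_circle_subset a r)

lemma le_volume_image_Ioo {a b : ℝ} (h1 : b - a ≤ 1) :
    ENNReal.ofReal (b - a) ≤ volume ((fun t : ℝ => (t : UnitAddCircle)) '' Ioo a b) := by
  have h : Ioo a b = ball ((a + b) / 2) ((b - a) / 2) := by
    rw [Real.ball_eq_Ioo]; congr 1 <;> ring
  rw [h, ← ball_coe_eq_image]
  refine le_of_forall_lt fun c hc => ?_
  have hcf : c ≠ ⊤ := ne_top_of_lt hc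
  lift c to NNReal using hcf
  have hc' : (c:ℝ) < b - a := by
    rw [← ENNReal.ofReal_coe_nnreal] at hc
    exact (ENNReal.ofReal_lt_ofReal_iff_of_nonneg c.coe_nonneg).1 hc
  have hsub : closedBall (((a + b) / 2 : ℝ) : UnitAddCircle) (((c:ℝ) + (b - a)) / 4) ⊆
      ball (((a + b) / 2 : ℝ) : UnitAddCircle) ((b - a) / 2) :=
    closedBall_subset_ball (by linarith)
  refine lt_of_lt_of_le ?_ (measure_mono hsub)
  rw [AddCircle.volume_closedBall, ← ENNReal.ofReal_coe_nnreal]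
  exact (ENNReal.ofReal_lt_ofReal_iff_of_nonneg c.coe_nonneg).2 (lt_min (by linarith) (by linarith))

lemma isOpen_image_Ioo (a b : ℝ) : IsOpen ((fun t : ℝ => (t : UnitAddCircle)) '' Ioo a b) :=
  QuotientAddGroup.isOpenMap_coe _ isOpen_Ioo

lemma coe_circle_eq_iff {s t : ℝ} : (s : UnitAddCircle) = t ↔ ∃ n : ℤ, t = s + n := by
  rw [eq_comm, ← sub_eq_zero, ← AddCircle.coe_sub, AddCircle.coe_eq_zero_iff]
  constructor
  · rintro ⟨n, hn⟩; exact ⟨n, by simp at hn; linarith⟩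
  · rintro ⟨n, hn⟩; exact ⟨n, by simp; linarith⟩

/-- A preconnected subset of the circle contains one of the two open arcs between any two of its
points. -/
lemma arc_subset_of_isPreconnected {C : Set UnitAddCircle} (hC : IsPreconnected C) {a b : ℝ}
    (ha' : (a : UnitAddCircle) ∈ C) (hb' : (b : UnitAddCircle) ∈ C) :
    (fun t : ℝ => (t : UnitAddCircle)) '' Ioo a b ⊆ C ∨
      (fun t : ℝ => (t : UnitAddCircle)) '' Ioo b (a + 1) ⊆ C := by
  by_contra hcon
  push Not at hcon
  simp only [image_subset_iff, not_subset] at hcon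
  obtain ⟨⟨u, hu, hu'⟩, ⟨v, hv, hv'⟩⟩ := hcon
  simp only [mem_preimage] at hu' hv'
  rw [isPreconnected_iff_subset_of_disjoint] at hC
  have hdisj : Disjoint ((fun t : ℝ => (t : UnitAddCircle)) '' Ioo u v)
      ((fun t : ℝ => (t : UnitAddCircle)) '' Ioo v (u + 1)) := by
    rw [Set.disjoint_left]
    rintro _ ⟨s, hs, rfl⟩ ⟨t, ht, hst⟩
    obtain ⟨n, hn⟩ := coe_circle_eq_iff.1 hst
    have h1 : (-1:ℝ) < n := by linarith [hs.1, ht.2]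
    have h2 : (n:ℝ) < 0 := by linarith [hs.2, ht.1]
    have h1' : (-1:ℤ) < n := by exact_mod_cast h1
    have h2' : n < (0:ℤ) := by exact_mod_cast h2
    omega
  have hcov : C ⊆ (fun t : ℝ => (t : UnitAddCircle)) '' Ioo u v ∪
      (fun t : ℝ => (t : UnitAddCircle)) '' Ioo v (u + 1) := by
    intro y hy
    obtain ⟨t, ht, rfl⟩ : ∃ t ∈ Ico u (u + 1), (t : UnitAddCircle) = y := by
      have := AddCircle.coe_image_Ico_eq (1:ℝ) u
      have hy' : y ∈ (QuotientAddGroup.mk : ℝ → UnitAddCircle) '' Ico u (u + 1) := by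
        rw [this]; trivial
      exact hy'
    rcases eq_or_lt_of_le ht.1 with h | h
    · exact absurd (h ▸ hy) hu'
    · rcases lt_trichotomy t v with h' | h' | h'
      · exact Or.inl ⟨t, ⟨h, h'⟩, rfl⟩
      · exact absurd (h' ▸ hy) hv'
      · exact Or.inr ⟨t, ⟨h', ht.2⟩, rfl⟩
  rcases hC _ _ (isOpen_image_Ioo u v) (isOpen_image_Ioo v (u + 1)) hcov
    (by rw [hdisj.inter_eq, inter_empty]) with h | h
  · refine Set.disjoint_left.1 hdisj (h ha') ⟨a + 1, ⟨by linarith [hv.2], by linarith [hu.1]⟩, ?_⟩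
    exact (coe_circle_eq_iff.2 ⟨1, by simp⟩).symm
  · exact Set.disjoint_left.1 hdisj ⟨b, ⟨hu.2, hv.1⟩, rfl⟩ (h hb')

/-- The distance of two points is the length of the shorter of the two arcs between them. -/
lemma dist_le_volume_of_isPreconnected {C : Set UnitAddCircle} (hC : IsPreconnected C)
    {x y : UnitAddCircle} (hx : x ∈ C) (hy : y ∈ C) : ENNReal.ofReal (dist x y) ≤ volume C := by
  obtain ⟨a, rfl⟩ := QuotientAddGroup.mk_surjective x
  obtain ⟨t, ht, ht'⟩ := exists_coe_abs_eq_norm (y - (a : UnitAddCircle))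
  have hy' : y = ((a + t : ℝ) : UnitAddCircle) := by simp [ht]
  have hd : dist (a : UnitAddCircle) y = |t| := by rw [ht', dist_comm, dist_eq_norm]
  have ht2 : |t| ≤ 1 / 2 := by
    rw [ht']; simpa using AddCircle.norm_le_half_period (1:ℝ) one_ne_zero (x := y - a)
  change ENNReal.ofReal (dist (a : UnitAddCircle) y) ≤ _
  change (a : UnitAddCircle) ∈ C at hx
  rw [hd]
  rw [hy'] at hy
  have key : ∀ a b : ℝ, a < b → b - a ≤ 1 / 2 → (a : UnitAddCircle) ∈ C → (b : UnitAddCircle) ∈ C →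
      ENNReal.ofReal (b - a) ≤ volume C := by
    intro a b hab hab' ha hb
    rcases arc_subset_of_isPreconnected hC ha hb with h | h
    · exact (le_volume_image_Ioo (by linarith)).trans (measure_mono h)
    · refine le_trans ?_ (measure_mono h)
      refine le_trans ?_ (le_volume_image_Ioo (by linarith))
      exact ENNReal.ofReal_le_ofReal (by linarith)
  rcases lt_trichotomy t 0 with h | h | h
  · rw [abs_of_neg h] at ht2 ⊢
    have := key (a + t) a (by linarith) (by linarith) hy hx
    simpa using this
  · simp [h]
  · rw [abs_of_pos h] at ht2 ⊢
    have := key a (a + t) (by linarith) (by linarith) hx hy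
    simpa using this

/-! ### The topology of `Homeo(S¹)` and invariant measures -/

section Topology

/-- A connected set that meets `s` but not its boundary is contained in `s`. -/
lemma IsPreconnected.subset_of_disjoint_frontier {X : Type*} [TopologicalSpace X] {C s : Set X}
    (hC : IsPreconnected C) (h : (C ∩ s).Nonempty) (hf : Disjoint C (frontier s)) : C ⊆ s := by
  have hcov : C ⊆ interior s ∪ (closure s)ᶜ := by
    intro x hx
    by_contra hcon
    simp only [mem_union, mem_compl_iff, not_or, not_not] at hcon
    exact Set.disjoint_left.1 hf hx ⟨hcon.2, hcon.1⟩
  have hd : Disjoint (interior s) (closure s)ᶜ :=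
    disjoint_compl_right.mono_left (interior_subset.trans subset_closure)
  rcases isPreconnected_iff_subset_of_disjoint.1 hC _ _ isOpen_interior
    isClosed_closure.isOpen_compl hcov (by rw [hd.inter_eq, inter_empty]) with h' | h'
  · exact h'.trans interior_subset
  · obtain ⟨x, hx, hxs⟩ := h
    exact absurd (subset_closure hxs) (h' hx)

end Topology

namespace HomeoCircle

/-- The inclusion of `Homeo(S¹)` into the space of continuous self-maps of the circle. -/
def toCM (f : HomeoCircle) : C(UnitAddCircle, UnitAddCircle) := ⟨f, f.continuous⟩

lemma isInducing_toCM : Topology.IsInducing toCM := ⟨rfl⟩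

instance : SecondCountableTopology HomeoCircle := isInducing_toCM.secondCountableTopology

instance : TopologicalSpace.PseudoMetrizableSpace HomeoCircle :=
  isInducing_toCM.pseudoMetrizableSpace

instance : ContinuousMul HomeoCircle where
  continuous_mul := by
    rw [isInducing_toCM.continuous_iff]
    exact ContinuousMap.continuous_comp'.comp
      ((isInducing_toCM.continuous.comp continuous_snd).prodMk
        (isInducing_toCM.continuous.comp continuous_fst))

lemma isOpen_setOf_mapsTo {K U : Set UnitAddCircle} (hK : IsCompact K) (hU : IsOpen U) :
    IsOpen {f : HomeoCircle | MapsTo f K U} :=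
  (ContinuousMap.isOpen_setOfPred_mapsTo hK hU).preimage isInducing_toCM.continuous

end HomeoCircle

section InvariantMeasures

/-- Some Borel probability measure on the circle is invariant under all elements of `Γ`. -/
def HasInvariantProbability (Γ : Set HomeoCircle) : Prop :=
  ∃ ν : Measure UnitAddCircle, IsProbabilityMeasure ν ∧ ∀ g ∈ Γ, ν.map g = ν

lemma eq_of_forall_isClosed_le {X : Type*} [TopologicalSpace X] [MeasurableSpace X] [BorelSpace X]
    {μ ν : Measure X} [IsProbabilityMeasure μ] [IsProbabilityMeasure ν] [μ.WeaklyRegular]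
    (h : ∀ K, IsClosed K → μ K ≤ ν K) : μ = ν := by
  refine Measure.eq_of_le_of_isProbabilityMeasure (Measure.le_iff.2 fun A hA => ?_)
  rw [hA.measure_eq_iSup_isClosed_of_ne_top (measure_ne_top μ A)]
  refine iSup_le fun K => iSup_le fun hKA => iSup_le fun hK => ?_
  exact (h K hK).trans (measure_mono hKA)

lemma frontier_biUnion_finset_subset {X ι : Type*} [TopologicalSpace X] (s : Finset ι)
    (f : ι → Set X) : frontier (⋃ i ∈ s, f i) ⊆ ⋃ i ∈ s, frontier (f i) := by
  classical
  induction s using Finset.induction_on with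
  | empty => simp
  | insert a s ha ih =>
    simp only [Finset.set_biUnion_insert]
    refine (frontier_union_subset _ _).trans ?_
    refine union_subset_union inter_subset_left ?_
    exact inter_subset_right.trans ih

/-- A probability measure that is invariant up to an arbitrarily small error on the open sets with
few boundary points can be turned, by a weak limit, into an invariant one. -/
lemma hasInvariantProbability_of_approx {Γ : Set HomeoCircle}
    (h : ∀ n : ℕ, ∃ ρ : ProbabilityMeasure UnitAddCircle, ∀ g ∈ Γ, ∀ I : Set UnitAddCircle,
      IsOpen I → ∀ F : Finset UnitAddCircle, frontier I ⊆ F →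
      (ρ : Measure UnitAddCircle) (g ⁻¹' I) ≤
        (ρ : Measure UnitAddCircle) I + F.card * ((n : ℝ≥0∞) + 1)⁻¹) :
    HasInvariantProbability Γ := by
  choose ρ hρ using h
  let 𝒰 : Ultrafilter ℕ := hyperfilter ℕ
  obtain ⟨m, -, hm⟩ := isCompact_univ.ultrafilter_le_nhds (𝒰.map ρ) (by simp)
  have hm : Tendsto ρ 𝒰 (𝓝 m) := hm
  have hU : (𝒰 : Filter ℕ) ≤ atTop := by
    rw [← Nat.cofinite_eq_atTop]; exact hyperfilter_le_cofinite
  refine ⟨m, inferInstance, fun g hg => ?_⟩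
  have hgm : IsProbabilityMeasure ((m : Measure UnitAddCircle).map g) :=
    Measure.isProbabilityMeasure_map g.continuous.measurable.aemeasurable
  have key : ∀ I : Set UnitAddCircle, IsOpen I → (frontier I).Finite →
      (m : Measure UnitAddCircle).map g I ≤ (m : Measure UnitAddCircle) (closure I) := by
    intro I hI hF
    obtain ⟨F, hF⟩ := hF.exists_finset_coe
    rw [Measure.map_apply g.continuous.measurable hI.measurableSet]
    have h1 := ProbabilityMeasure.le_liminf_measure_open_of_tendsto hm (hI.preimage g.continuous)
    have h2 := ProbabilityMeasure.limsup_measure_closed_le_of_tendsto hm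
      (isClosed_closure (s := I))
    have h3 : Tendsto (fun n : ℕ => (F.card : ℝ≥0∞) * ((n : ℝ≥0∞) + 1)⁻¹) 𝒰 (𝓝 0) := by
      have : Tendsto (fun n : ℕ => (F.card : ℝ≥0∞) * ((n : ℝ≥0∞) + 1)⁻¹) atTop
          (𝓝 (F.card * 0)) := by
        refine ENNReal.Tendsto.const_mul ?_ (Or.inr (by simp))
        have := (ENNReal.tendsto_inv_nat_nhds_zero).comp (tendsto_add_atTop_nat 1)
        refine this.congr fun n => by simp
      rw [mul_zero] at this
      exact this.mono_left hU
    refine h1.trans (ENNReal.le_of_forall_pos_le_add fun η hη _ => ?_)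
    have hη' : (0 : ℝ≥0∞) < (η / 2 : NNReal) := by exact_mod_cast half_pos hη
    have h4 := eventually_lt_of_limsup_lt
      (h2.trans_lt (ENNReal.lt_add_right (measure_ne_top _ _) hη'.ne'))
    refine liminf_le_of_frequently_le' (Eventually.frequently ?_)
    filter_upwards [h4, h3.eventually_lt_const hη'] with n hn hn'
    refine (hρ n g hg I hI F hF.ge).trans ?_
    have : (η : ℝ≥0∞) = (η / 2 : NNReal) + (η / 2 : NNReal) := by
      rw [← ENNReal.coe_add, add_halves]
    rw [this, ← add_assoc]
    exact add_le_add ((measure_mono subset_closure).trans hn.le) hn'.le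
  refine eq_of_forall_isClosed_le fun K hK => ?_
  -- `K` is approximated by finite unions of small balls, whose boundary is finite.
  have hball : ∀ δ : ℝ, 0 < δ → (m : Measure UnitAddCircle).map g K ≤
      (m : Measure UnitAddCircle) (cthickening δ K) := by
    intro δ hδ
    obtain ⟨t, htK, htK'⟩ := hK.isCompact.elim_nhds_subcover (fun x => ball x δ)
      (fun x _ => ball_mem_nhds x hδ)
    refine (measure_mono htK').trans ((key _ ?_ ?_).trans (measure_mono ?_))
    · exact isOpen_biUnion fun _ _ => isOpen_ball
    · refine Set.Finite.subset ?_ (frontier_biUnion_finset_subset t _)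
      refine t.finite_toSet.biUnion fun a _ => ?_
      exact (Set.toFinite {a + (δ : UnitAddCircle), a - (δ : UnitAddCircle)}).subset
        (frontier_ball_circle_subset a δ)
    · refine closure_minimal (iUnion₂_subset fun x hx => ?_) isClosed_cthickening
      exact (ball_subset_thickening (htK x hx) δ).trans (thickening_subset_cthickening δ K)
  have hlim := tendsto_measure_cthickening_of_isClosed (μ := (m : Measure UnitAddCircle)) (s := K)
    ⟨1, one_pos, measure_ne_top _ _⟩ hK
  have hlim' : Tendsto (fun r => (m : Measure UnitAddCircle) (cthickening r K)) (𝓝[>] 0)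
      (𝓝 ((m : Measure UnitAddCircle) K)) := hlim.mono_left nhdsWithin_le_nhds
  exact ge_of_tendsto hlim' (eventually_nhdsWithin_of_forall hball)

/-- The uniform distribution on a finite set mapped into itself is invariant. -/
lemma hasInvariantProbability_of_finite {Γ : Set HomeoCircle} (Z : Finset UnitAddCircle)
    (hZ : Z.Nonempty) (h : ∀ g ∈ Γ, ∀ z ∈ Z, g z ∈ Z) : HasInvariantProbability Γ := by
  classical
  have hc : (Z.card : ℝ≥0∞) ≠ 0 := by simpa using hZ.ne_empty
  refine ⟨(Z.card : ℝ≥0∞)⁻¹ • ∑ z ∈ Z, Measure.dirac z, ⟨?_⟩, fun g hg => ?_⟩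
  · simp [ENNReal.inv_mul_cancel hc]
  · have him : Z.image g = Z := by
      refine Finset.eq_of_subset_of_card_le (Finset.image_subset_iff.2 (h g hg)) ?_
      rw [Finset.card_image_of_injective _ g.injective]
    have hgm : Measurable g := g.continuous.measurable
    rw [Measure.map_smul, ← Measure.mapₗ_apply_of_measurable hgm, map_sum]
    congr 1
    conv_rhs => rw [← him, Finset.sum_image g.injective.injOn]
    refine Finset.sum_congr rfl fun z _ => ?_
    rw [Measure.mapₗ_apply_of_measurable hgm, Measure.map_dirac' hgm]

end InvariantMeasures

/-! ### Packings by arcs of large images -/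

section Packing

/-- A set that cannot be contracted by `Γ`: the length of its images stays bounded below. -/
def Uncontracted (Γ : Submonoid HomeoCircle) (J : Set UnitAddCircle) : Prop :=
  ∃ ε : ℝ≥0∞, 0 < ε ∧ ∀ g ∈ Γ, ε ≤ volume (g '' J)

/-- A finite family of pairwise disjoint connected open sets all of whose images under `Γ` have
length at least `ε`. -/
structure IsPacking (Γ : Submonoid HomeoCircle) (ε : ℝ≥0∞) (𝒥 : Finset (Set UnitAddCircle)) :
    Prop where
  isOpen : ∀ J ∈ 𝒥, IsOpen J
  isPreconnected : ∀ J ∈ 𝒥, IsPreconnected J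
  le_volume : ∀ J ∈ 𝒥, ∀ g ∈ Γ, ε ≤ volume (g '' J)
  disjoint : ∀ J ∈ 𝒥, ∀ J' ∈ 𝒥, J ≠ J' → Disjoint J J'

variable {Γ : Submonoid HomeoCircle} {ε : ℝ≥0∞} {𝒥 : Finset (Set UnitAddCircle)}

lemma IsPacking.card_mul_le (h : IsPacking Γ ε 𝒥) : 𝒥.card * ε ≤ 1 := by
  have h1 : volume (⋃ J ∈ 𝒥, J) = ∑ J ∈ 𝒥, volume J :=
    measure_biUnion_finset (fun J hJ J' hJ' hne => h.disjoint J hJ J' hJ' hne)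
      fun J hJ => (h.isOpen J hJ).measurableSet
  have h2 : ∑ J ∈ 𝒥, ε ≤ ∑ J ∈ 𝒥, volume J := by
    refine Finset.sum_le_sum fun J hJ => ?_
    have := h.le_volume J hJ 1 Γ.one_mem
    rwa [show ((1 : HomeoCircle) '' J) = J from image_id J] at this
  rw [Finset.sum_const, nsmul_eq_mul, ← h1] at h2
  exact h2.trans ((measure_mono (subset_univ _)).trans_eq UnitAddCircle.measure_univ)

lemma IsPacking.nonempty (h : IsPacking Γ ε 𝒥) (hε : 0 < ε) {J : Set UnitAddCircle} (hJ : J ∈ 𝒥) :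
    J.Nonempty := by
  by_contra hcon
  rw [not_nonempty_iff_eq_empty] at hcon
  have := h.le_volume J hJ 1 Γ.one_mem
  rw [hcon, image_empty, measure_empty] at this
  exact hε.not_ge this

/-- Pairwise disjoint sets meeting a finite set are at most as many as its points. -/
lemma card_filter_inter_nonempty_le {X : Type*} (𝒥 : Finset (Set X)) (F : Finset X)
    (hd : ∀ J ∈ 𝒥, ∀ J' ∈ 𝒥, J ≠ J' → Disjoint J J') (P : Set X → Prop) [DecidablePred P]
    (hP : ∀ J ∈ 𝒥, P J → (J ∩ F).Nonempty) : (𝒥.filter P).card ≤ F.card := by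
  refine Finset.card_le_card_of_forall_subsingleton (fun J x => x ∈ J) (fun J hJ => ?_)
    fun x _ J hJ J' hJ' => ?_
  · obtain ⟨x, hx, hxF⟩ := hP J (Finset.mem_filter.1 hJ).1 (Finset.mem_filter.1 hJ).2
    exact ⟨x, hxF, hx⟩
  · by_contra hne
    exact Set.disjoint_left.1 (hd J (Finset.mem_filter.1 hJ.1).1 J' (Finset.mem_filter.1 hJ'.1).1
      hne) hJ.2 hJ'.2

/-- In a packing of maximal cardinality, replacing the members contained in `g⁻¹ I` by their images
under `g` and keeping those in the complement of `I` yields a packing again. So the number of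
members located in `g⁻¹ I` exceeds the number of those in `I` by a boundary term only. -/
lemma IsPacking.card_preimage_le (h : IsPacking Γ ε 𝒥) (hε : 0 < ε)
    (hmax : ∀ 𝒥', IsPacking Γ ε 𝒥' → 𝒥'.card ≤ 𝒥.card) {x : Set UnitAddCircle → UnitAddCircle}
    (hx : ∀ J ∈ 𝒥, x J ∈ J) {g : HomeoCircle} (hg : g ∈ Γ) {I : Set UnitAddCircle}
    {F : Finset UnitAddCircle} (hF : frontier I ⊆ F)
    [DecidablePred fun J => x J ∈ g ⁻¹' I] [DecidablePred fun J => x J ∈ I] :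
    (𝒥.filter fun J => x J ∈ g ⁻¹' I).card ≤ (𝒥.filter fun J => x J ∈ I).card + 2 * F.card := by
  classical
  set A := 𝒥.filter fun J => J ⊆ g ⁻¹' I with hA
  set B := 𝒥.filter fun J => J ⊆ Iᶜ with hB
  have hpack : IsPacking Γ ε (A.image (fun J => g '' J) ∪ B) := by
    refine ⟨fun J hJ => ?_, fun J hJ => ?_, fun J hJ k hk => ?_, fun J hJ J' hJ' hne => ?_⟩
    · rcases Finset.mem_union.1 hJ with hJ | hJ
      · obtain ⟨J, hJA, rfl⟩ := Finset.mem_image.1 hJ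
        exact g.isOpenMap _ (h.isOpen J (Finset.mem_filter.1 hJA).1)
      · exact h.isOpen J (Finset.mem_filter.1 hJ).1
    · rcases Finset.mem_union.1 hJ with hJ | hJ
      · obtain ⟨J, hJA, rfl⟩ := Finset.mem_image.1 hJ
        exact (h.isPreconnected J (Finset.mem_filter.1 hJA).1).image _ g.continuous.continuousOn
      · exact h.isPreconnected J (Finset.mem_filter.1 hJ).1
    · rcases Finset.mem_union.1 hJ with hJ | hJ
      · obtain ⟨J, hJA, rfl⟩ := Finset.mem_image.1 hJ
        rw [← image_comp]
        exact h.le_volume J (Finset.mem_filter.1 hJA).1 (k * g) (Γ.mul_mem hk hg)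
      · exact h.le_volume J (Finset.mem_filter.1 hJ).1 k hk
    · have hAB : ∀ J ∈ A, ∀ J' ∈ B, Disjoint (g '' J) J' := by
        intro J hJ J' hJ'
        exact (disjoint_compl_right (a := I)).mono
          (image_subset_iff.2 (Finset.mem_filter.1 hJ).2) (Finset.mem_filter.1 hJ').2
      rcases Finset.mem_union.1 hJ with hJ | hJ <;> rcases Finset.mem_union.1 hJ' with hJ' | hJ'
      · obtain ⟨J, hJA, rfl⟩ := Finset.mem_image.1 hJ
        obtain ⟨J', hJA', rfl⟩ := Finset.mem_image.1 hJ'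
        refine disjoint_image_of_injective g.injective (h.disjoint _ (Finset.mem_filter.1 hJA).1 _
          (Finset.mem_filter.1 hJA').1 fun hJJ => hne (by rw [hJJ]))
      · obtain ⟨J, hJA, rfl⟩ := Finset.mem_image.1 hJ
        exact hAB J hJA J' hJ'
      · obtain ⟨J', hJA', rfl⟩ := Finset.mem_image.1 hJ'
        exact (hAB J' hJA' J hJ).symm
      · exact h.disjoint J (Finset.mem_filter.1 hJ).1 J' (Finset.mem_filter.1 hJ').1 hne
  have hcard : A.card + B.card ≤ 𝒥.card := by
    refine le_trans (le_of_eq ?_) (hmax _ hpack)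
    rw [Finset.card_union_of_disjoint, Finset.card_image_of_injective _ g.injective.image_injective]
    rw [Finset.disjoint_left]
    intro J hJ hJ'
    obtain ⟨J, hJA, rfl⟩ := Finset.mem_image.1 hJ
    obtain ⟨y, hy⟩ := h.nonempty hε (Finset.mem_filter.1 hJA).1
    exact (Finset.mem_filter.1 hJ').2 (mem_image_of_mem g hy) ((Finset.mem_filter.1 hJA).2 hy)
  have h1 : (𝒥.filter fun J => x J ∈ g ⁻¹' I).card ≤ A.card + F.card := by
    have hsub : (𝒥.filter fun J => x J ∈ g ⁻¹' I) ⊆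
        A ∪ 𝒥.filter fun J => x J ∈ g ⁻¹' I ∧ ¬ J ⊆ g ⁻¹' I := by
      intro J hJ
      simp only [hA, Finset.mem_union, Finset.mem_filter] at hJ ⊢
      tauto
    refine (Finset.card_le_card hsub).trans ((Finset.card_union_le _ _).trans ?_)
    gcongr
    refine (card_filter_inter_nonempty_le 𝒥 (F.image g.symm) h.disjoint _ ?_).trans
      Finset.card_image_le
    rintro J hJ ⟨hxJ, hJI⟩
    by_contra hcon
    refine hJI ((h.isPreconnected J hJ).subset_of_disjoint_frontier ⟨x J, hx J hJ, hxJ⟩ ?_)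
    rw [← g.preimage_frontier, Set.disjoint_left]
    intro y hy hyF
    refine hcon ⟨y, hy, ?_⟩
    simp only [Finset.coe_image]
    exact ⟨g y, hF hyF, g.symm_apply_apply y⟩
  have h2 : (𝒥.filter fun J => ¬ x J ∈ I).card ≤ B.card + F.card := by
    have hsub : (𝒥.filter fun J => ¬ x J ∈ I) ⊆
        B ∪ 𝒥.filter fun J => x J ∈ Iᶜ ∧ ¬ J ⊆ Iᶜ := by
      intro J hJ
      simp only [hB, Finset.mem_union, Finset.mem_filter, mem_compl_iff] at hJ ⊢
      tauto
    refine (Finset.card_le_card hsub).trans ((Finset.card_union_le _ _).trans ?_)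
    gcongr
    refine card_filter_inter_nonempty_le 𝒥 F h.disjoint _ ?_
    rintro J hJ ⟨hxJ, hJI⟩
    by_contra hcon
    refine hJI ((h.isPreconnected J hJ).subset_of_disjoint_frontier ⟨x J, hx J hJ, hxJ⟩ ?_)
    rw [frontier_compl, Set.disjoint_left]
    exact fun y hy hyF => hcon ⟨y, hy, hF hyF⟩
  have h3 := Finset.card_filter_add_card_filter_not (s := 𝒥) (fun J => x J ∈ I)
  omega

/-- If there are arbitrarily large packings, then uniform distributions on the members of maximal
packings are almost invariant. -/
lemma hasInvariantProbability_of_packings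
    (h : ∀ L : ℕ, ∃ ε : ℝ≥0∞, 0 < ε ∧ ∃ 𝒥, IsPacking Γ ε 𝒥 ∧ L ≤ 𝒥.card) :
    HasInvariantProbability (Γ : Set HomeoCircle) := by
  classical
  refine hasInvariantProbability_of_approx fun n => ?_
  -- Replacing a maximal packing costs `2` members per boundary point, out of `2 * (n + 1)`.
  obtain ⟨ε, hε, 𝒥₀, h₀, hL⟩ := h (2 * (n + 1))
  obtain ⟨𝒥, hJ, hmax⟩ : ∃ 𝒥, IsPacking Γ ε 𝒥 ∧ ∀ 𝒥', IsPacking Γ ε 𝒥' → 𝒥'.card ≤ 𝒥.card := by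
    have hbdd : BddAbove {k : ℕ | ∃ 𝒥, IsPacking Γ ε 𝒥 ∧ 𝒥.card = k} := by
      obtain ⟨B, hB⟩ := ENNReal.exists_nat_gt (ENNReal.inv_ne_top.2 hε.ne')
      refine ⟨B, ?_⟩
      rintro k ⟨𝒥, hJ, rfl⟩
      have h1 : (𝒥.card : ℝ≥0∞) ≤ ε⁻¹ := by
        rw [← one_div]
        exact ENNReal.le_div_iff_mul_le (Or.inl hε.ne') (Or.inr ENNReal.one_ne_top) |>.2
          hJ.card_mul_le
      exact_mod_cast h1.trans hB.le
    have hne : {k : ℕ | ∃ 𝒥, IsPacking Γ ε 𝒥 ∧ 𝒥.card = k}.Nonempty := ⟨_, 𝒥₀, h₀, rfl⟩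
    obtain ⟨𝒥, hJ, hk⟩ := Nat.sSup_mem hne hbdd
    exact ⟨𝒥, hJ, fun 𝒥' hJ' => hk ▸ le_csSup hbdd ⟨𝒥', hJ', rfl⟩⟩
  have hcard : 2 * (n + 1) ≤ 𝒥.card := hL.trans (hmax _ h₀)
  have hx : ∀ J : Set UnitAddCircle, ∃ x, J ∈ 𝒥 → x ∈ J := by
    intro J
    by_cases hJ' : J ∈ 𝒥
    · obtain ⟨x, hx⟩ := hJ.nonempty hε hJ'
      exact ⟨x, fun _ => hx⟩
    · exact ⟨0, fun h => absurd h hJ'⟩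
  choose x hx using hx
  have hc : (𝒥.card : ℝ≥0∞) ≠ 0 := by
    rw [Nat.cast_ne_zero]; omega
  have hP : IsProbabilityMeasure ((𝒥.card : ℝ≥0∞)⁻¹ • ∑ J ∈ 𝒥, Measure.dirac (x J)) := by
    constructor
    simp [ENNReal.inv_mul_cancel hc]
  have happly : ∀ A : Set UnitAddCircle, MeasurableSet A →
      ((𝒥.card : ℝ≥0∞)⁻¹ • ∑ J ∈ 𝒥, Measure.dirac (x J)) A =
        (𝒥.card : ℝ≥0∞)⁻¹ * (𝒥.filter fun J => x J ∈ A).card := by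
    intro A hA
    rw [Measure.smul_apply, Measure.finsetSum_apply, smul_eq_mul]
    congr 1
    simp [Measure.dirac_apply' _ hA, Set.indicator_apply]
  refine ⟨⟨_, hP⟩, fun g hg I hI F hF => ?_⟩
  rw [ProbabilityMeasure.coe_mk, happly _ hI.measurableSet,
    happly _ (hI.preimage g.continuous).measurableSet]
  have h1 := hJ.card_preimage_le hε hmax hx hg hF
  have h2 : ((𝒥.filter fun J => x J ∈ g ⁻¹' I).card : ℝ≥0∞) ≤
      (𝒥.filter fun J => x J ∈ I).card + 2 * F.card := by exact_mod_cast h1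
  calc (𝒥.card : ℝ≥0∞)⁻¹ * (𝒥.filter fun J => x J ∈ g ⁻¹' I).card
      ≤ (𝒥.card : ℝ≥0∞)⁻¹ * ((𝒥.filter fun J => x J ∈ I).card + 2 * F.card) := by gcongr
    _ = (𝒥.card : ℝ≥0∞)⁻¹ * (𝒥.filter fun J => x J ∈ I).card +
        F.card * ((𝒥.card : ℝ≥0∞)⁻¹ * 2) := by ring
    _ ≤ _ := by
      gcongr
      have h3 : (2 * ((n : ℝ≥0∞) + 1)) ≤ 𝒥.card := by exact_mod_cast hcard
      calc (𝒥.card : ℝ≥0∞)⁻¹ * 2 ≤ (2 * ((n : ℝ≥0∞) + 1))⁻¹ * 2 := by gcongr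
        _ = ((n : ℝ≥0∞) + 1)⁻¹ := by
          rw [ENNReal.mul_inv (by simp) (by simp), mul_comm, ← mul_assoc,
            ENNReal.mul_inv_cancel (by simp) (by simp), one_mul]

/-- Without an invariant probability measure, every point of the circle has a neighbourhood that
`Γ` contracts. -/
lemma exists_contracted_ball (hΓ : ¬ HasInvariantProbability (Γ : Set HomeoCircle))
    (y : UnitAddCircle) : ∃ r > 0, ¬ Uncontracted Γ (ball y r) := by
  classical
  by_contra hy
  push Not at hy
  -- The points without such a neighbourhood form a finite set that `Γ` maps into itself.
  set Z : Set UnitAddCircle := {y | ∀ r > 0, Uncontracted Γ (ball y r)} with hZ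
  have hinv : ∀ g ∈ Γ, ∀ z ∈ Z, g z ∈ Z := by
    intro g hg z hz r hr
    obtain ⟨s, hs, hs'⟩ := Metric.mem_nhds_iff.1
      (g.continuous.continuousAt.preimage_mem_nhds (ball_mem_nhds (g z) hr))
    obtain ⟨ε, hε, h⟩ := hz s hs
    refine ⟨ε, hε, fun k hk => (h (k * g) (Γ.mul_mem hk hg)).trans (measure_mono ?_)⟩
    rintro _ ⟨w, hw, rfl⟩
    exact ⟨g w, hs' hw, rfl⟩
  have hfin : Z.Finite := by
    by_contra hinf
    refine hΓ (hasInvariantProbability_of_packings fun L => ?_)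
    obtain ⟨t, htZ, htL⟩ := Set.Infinite.exists_subset_card_eq hinf (L + 1)
    obtain ⟨r, hr, hsep⟩ : ∃ r > 0, ∀ a ∈ t, ∀ b ∈ t, a ≠ b → Disjoint (ball a r) (ball b r) := by
      have : ∀ᶠ r in 𝓝[>] (0:ℝ), ∀ a ∈ t, ∀ b ∈ t, a ≠ b → Disjoint (ball a r) (ball b r) := by
        simp only [Finset.eventually_all]
        intro a _ b _
        by_cases hab : a = b
        · simp [hab]
        · have hd : 0 < dist a b / 2 := half_pos (dist_pos.2 hab)
          filter_upwards [Ioo_mem_nhdsGT hd] with r hr _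
          exact ball_disjoint_ball (by linarith [hr.2])
      obtain ⟨r, hr, hr'⟩ := (this.and self_mem_nhdsWithin).exists
      exact ⟨r, hr', hr⟩
    have hε : ∀ a : UnitAddCircle, ∃ ε : ℝ≥0∞, 0 < ε ∧
        (a ∈ t → ∀ g ∈ Γ, ε ≤ volume (g '' ball a r)) := by
      intro a
      by_cases ha : a ∈ t
      · obtain ⟨ε, h0, h1⟩ := htZ ha r hr
        exact ⟨ε, h0, fun _ => h1⟩
      · exact ⟨1, one_pos, fun h => absurd h ha⟩
    choose ε hε0 hε using hε
    have ht : t.Nonempty := by rw [← Finset.card_pos]; omega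
    refine ⟨t.inf' ht ε, (Finset.lt_inf'_iff ht).2 fun a _ => hε0 a, t.image fun a => ball a r,
      ⟨?_, ?_, ?_, ?_⟩, ?_⟩
    · simp [isOpen_ball]
    · simp only [Finset.mem_image]
      rintro _ ⟨a, -, rfl⟩
      exact isPreconnected_ball_circle a r
    · simp only [Finset.mem_image]
      rintro _ ⟨a, ha, rfl⟩ g hg
      exact (Finset.inf'_le ε ha).trans (hε a ha g hg)
    · simp only [Finset.mem_image]
      rintro _ ⟨a, ha, rfl⟩ _ ⟨b, hb, rfl⟩ hne
      exact hsep a ha b hb fun hab => hne (by rw [hab])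
    · rw [Finset.card_image_of_injOn, htL]
      · omega
      · intro a ha b hb hab
        by_contra hne
        have hab' : ball a r = ball b r := hab
        have := hsep a ha b hb hne
        rw [hab', disjoint_self] at this
        exact (nonempty_ball.2 hr).ne_empty this
  refine hΓ (hasInvariantProbability_of_finite hfin.toFinset ⟨y, hfin.mem_toFinset.2 hy⟩ ?_)
  simpa using hinv

end Packing

/-! ### Limits of images of the volume -/

section FiniteLimit

lemma upperSemicontinuous_measure_of_isClosed {X : Type*} [TopologicalSpace X] [MeasurableSpace X]
    [OpensMeasurableSpace X] [HasOuterApproxClosed X] {F : Set X} (hF : IsClosed F) :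
    UpperSemicontinuous fun ρ : ProbabilityMeasure X => (ρ : Measure X) F := by
  intro ρ c hc
  exact eventually_lt_of_limsup_lt
    ((ProbabilityMeasure.limsup_measure_closed_le_of_tendsto (tendsto_id (x := 𝓝 ρ)) hF).trans_lt
      hc)

lemma lowerSemicontinuous_measure_of_isOpen {X : Type*} [TopologicalSpace X] [MeasurableSpace X]
    [OpensMeasurableSpace X] [HasOuterApproxClosed X] {U : Set X} (hU : IsOpen U) :
    LowerSemicontinuous fun ρ : ProbabilityMeasure X => (ρ : Measure X) U := by
  intro ρ c hc
  exact eventually_lt_of_lt_liminf (hc.trans_le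
    (ProbabilityMeasure.le_liminf_measure_open_of_tendsto (tendsto_id (x := 𝓝 ρ)) hU))

/-- The push-forward of a probability measure on the circle by a homeomorphism. -/
noncomputable def pushforward (g : HomeoCircle) (ρ : ProbabilityMeasure UnitAddCircle) :
    ProbabilityMeasure UnitAddCircle :=
  ρ.map g.continuous.measurable.aemeasurable

lemma continuous_pushforward (g : HomeoCircle) : Continuous (pushforward g) :=
  ProbabilityMeasure.continuous_map g.continuous

lemma pushforward_apply (g : HomeoCircle) (ρ : ProbabilityMeasure UnitAddCircle)
    {A : Set UnitAddCircle} (hA : MeasurableSet A) :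
    (pushforward g ρ : Measure UnitAddCircle) A = (ρ : Measure UnitAddCircle) (g ⁻¹' A) :=
  Measure.map_apply g.continuous.measurable hA

lemma pushforward_mul (g h : HomeoCircle) (ρ : ProbabilityMeasure UnitAddCircle) :
    pushforward (g * h) ρ = pushforward g (pushforward h ρ) := by
  apply Subtype.ext
  exact (Measure.map_map g.continuous.measurable h.continuous.measurable).symm

/-- The length, as a probability measure on the circle. -/
noncomputable def circleVolume : ProbabilityMeasure UnitAddCircle :=
  ⟨volume, ⟨UnitAddCircle.measure_univ⟩⟩

/-- The sum of the squares of the masses of the atoms of `ρ`. -/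
noncomputable def atomEnergy (ρ : ProbabilityMeasure UnitAddCircle) : ℝ≥0∞ :=
  ((ρ.prod ρ : ProbabilityMeasure (UnitAddCircle × UnitAddCircle)) :
    Measure (UnitAddCircle × UnitAddCircle)) (diagonal UnitAddCircle)

lemma upperSemicontinuous_atomEnergy : UpperSemicontinuous atomEnergy := by
  intro ρ c hc
  have hcont : Continuous fun ρ : ProbabilityMeasure UnitAddCircle => ρ.prod ρ :=
    ProbabilityMeasure.continuous_prod.comp (continuous_id.prodMk continuous_id)
  exact (hcont.tendsto ρ).eventually
    (upperSemicontinuous_measure_of_isClosed isClosed_diagonal (ρ.prod ρ) c hc)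

variable {Γ : Submonoid HomeoCircle}

/-- If a measure of maximal atom energy charges a contracted set `I`, then it has a single atom in
`I` and no other mass there: contracting `I` to a point would otherwise increase the energy. -/
lemma offDiagonal_null_of_isMax {𝒬 : Set (ProbabilityMeasure UnitAddCircle)} (hcl : IsClosed 𝒬)
    (hinv : ∀ g ∈ Γ, ∀ ρ ∈ 𝒬, pushforward g ρ ∈ 𝒬) {ρ : ProbabilityMeasure UnitAddCircle}
    (hρ : ρ ∈ 𝒬) (hmax : ∀ ρ' ∈ 𝒬, atomEnergy ρ' ≤ atomEnergy ρ) {I : Set UnitAddCircle}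
    (hI : IsOpen I) (hIc : IsPreconnected I) (hcon : ¬ Uncontracted Γ I) :
    ((ρ : Measure UnitAddCircle).prod (ρ : Measure UnitAddCircle))
      ((I ×ˢ I) \ diagonal UnitAddCircle) = 0 := by
  have hg : ∀ n : ℕ, ∃ g ∈ Γ, volume (g '' I) < ENNReal.ofReal (1 / ((n : ℝ) + 1)) := by
    intro n
    by_contra h
    push Not at h
    exact hcon ⟨_, ENNReal.ofReal_pos.2 (by positivity), h⟩
  choose g hgΓ hg using hg
  let 𝒰 : Ultrafilter ℕ := hyperfilter ℕ
  have hU : (𝒰 : Filter ℕ) ≤ atTop := by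
    rw [← Nat.cofinite_eq_atTop]; exact hyperfilter_le_cofinite
  obtain ⟨m, -, hm⟩ := isCompact_univ.ultrafilter_le_nhds (𝒰.map fun n => pushforward (g n) ρ)
    (by simp)
  have hm : Tendsto (fun n => pushforward (g n) ρ) 𝒰 (𝓝 m) := hm
  have hm𝒬 : m ∈ 𝒬 := hcl.mem_of_tendsto hm (Eventually.of_forall fun n => hinv _ (hgΓ n) _ hρ)
  have hmm : Tendsto (fun n => (pushforward (g n) ρ).prod (pushforward (g n) ρ)) 𝒰
      (𝓝 (m.prod m)) := by
    have hcont : Continuous fun ρ : ProbabilityMeasure UnitAddCircle => ρ.prod ρ :=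
      ProbabilityMeasure.continuous_prod.comp (continuous_id.prodMk continuous_id)
    exact (hcont.tendsto m).comp hm
  set P : Measure (UnitAddCircle × UnitAddCircle) :=
    (ρ : Measure UnitAddCircle).prod (ρ : Measure UnitAddCircle) with hP
  set D : ℕ → Set (UnitAddCircle × UnitAddCircle) := fun k => {p | dist p.1 p.2 ≤ 1 / ((k : ℝ) + 1)}
    with hD
  have hDcl : ∀ k, IsClosed (D k) := fun k => isClosed_le (by fun_prop) continuous_const
  have hlow : ∀ k, P (I ×ˢ I ∪ diagonal UnitAddCircle) ≤
      ((m.prod m : ProbabilityMeasure _) : Measure (UnitAddCircle × UnitAddCircle)) (D k) := by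
    intro k
    refine le_trans ?_ (ProbabilityMeasure.limsup_measure_closed_le_of_tendsto hmm (hDcl k))
    refine le_limsup_of_frequently_le' (Eventually.frequently ?_)
    filter_upwards [hU (eventually_ge_atTop k)] with n hn
    have h1 : (((pushforward (g n) ρ).prod (pushforward (g n) ρ) : ProbabilityMeasure _) :
        Measure (UnitAddCircle × UnitAddCircle)) = P.map (Prod.map (g n) (g n)) :=
      Measure.map_prod_map _ _ (g n).continuous.measurable (g n).continuous.measurable
    rw [h1, Measure.map_apply
      ((g n).continuous.prodMap (g n).continuous).measurable (hDcl k).measurableSet]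
    refine measure_mono ?_
    rintro ⟨x, y⟩ (⟨hx, hy⟩ | hxy)
    · have h2 := (dist_le_volume_of_isPreconnected (hIc.image (g n) (g n).continuous.continuousOn)
        (mem_image_of_mem _ hx) (mem_image_of_mem _ hy)).trans (hg n).le
      rw [ENNReal.ofReal_le_ofReal_iff (by positivity)] at h2
      refine h2.trans ?_
      have : (k : ℝ) ≤ n := by exact_mod_cast hn
      exact one_div_le_one_div_of_le (by positivity) (by linarith)
    · have hxy : x = y := hxy
      subst hxy
      simp only [hD, mem_preimage, Prod.map_apply, mem_ofPred_eq, dist_self]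
      positivity
  have hinter : (⋂ k, D k) = diagonal UnitAddCircle := by
    ext ⟨x, y⟩
    simp only [hD, mem_iInter, mem_ofPred_eq, mem_diagonal_iff]
    refine ⟨fun h => ?_, fun h k => ?_⟩
    · refine dist_le_zero.1 (ge_of_tendsto' tendsto_one_div_add_atTop_nhds_zero_nat h)
    · subst h
      simp only [dist_self]
      positivity
  have hanti : Antitone D := by
    intro k l hkl p (hp : dist p.1 p.2 ≤ 1 / ((l : ℝ) + 1))
    refine hp.trans (one_div_le_one_div_of_le (by positivity) ?_)
    have : (k : ℝ) ≤ l := by exact_mod_cast hkl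
    linarith
  have hlim := tendsto_measure_iInter_atTop
    (μ := ((m.prod m : ProbabilityMeasure _) : Measure (UnitAddCircle × UnitAddCircle)))
    (fun k => (hDcl k).measurableSet.nullMeasurableSet) hanti ⟨0, measure_ne_top _ _⟩
  rw [hinter] at hlim
  have h3 : P (I ×ˢ I ∪ diagonal UnitAddCircle) ≤ atomEnergy m := ge_of_tendsto' hlim hlow
  have h4 : P (I ×ˢ I ∪ diagonal UnitAddCircle) ≤ P (diagonal UnitAddCircle) :=
    h3.trans (hmax m hm𝒬)
  have h5 : P (I ×ˢ I ∪ diagonal UnitAddCircle) =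
      P (diagonal UnitAddCircle) + P ((I ×ˢ I) \ diagonal UnitAddCircle) := by
    rw [← measure_union disjoint_sdiff_right
      ((hI.prod hI).measurableSet.diff measurableSet_diagonal), union_sdiff_self, union_comm]
  rw [h5] at h4
  have h6 : P (diagonal UnitAddCircle) + P ((I ×ˢ I) \ diagonal UnitAddCircle) ≤
      P (diagonal UnitAddCircle) + 0 := by simpa using h4
  exact le_zero_iff.1 ((ENNReal.add_le_add_iff_left (measure_ne_top _ _)).1 h6)

/-- A measure whose square is carried by the diagonal, on the square of `I`, has at most one atom in
`I` and no other mass there, by Fubini's theorem. -/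
lemma exists_atom_of_offDiagonal_null {ρ : Measure UnitAddCircle} [IsProbabilityMeasure ρ]
    {I : Set UnitAddCircle} (hI : IsOpen I)
    (h : (ρ.prod ρ) ((I ×ˢ I) \ diagonal UnitAddCircle) = 0) : ∃ a, ρ (I \ {a}) = 0 := by
  by_cases h0 : ρ I = 0
  · exact ⟨0, measure_mono_null sdiff_subset h0⟩
  · rw [Measure.measure_prod_null ((hI.prod hI).measurableSet.diff measurableSet_diagonal)] at h
    obtain ⟨x, hxI, hx⟩ : ∃ x ∈ I, ρ (Prod.mk x ⁻¹' ((I ×ˢ I) \ diagonal UnitAddCircle)) = 0 := by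
      by_contra hcon
      push Not at hcon
      refine h0 (measure_mono_null (fun x hx => ?_) (ae_iff.1 h))
      exact hcon x hx
    refine ⟨x, measure_mono_null (fun y hy => ?_) hx⟩
    exact ⟨⟨hxI, hy.1⟩, fun hxy => hy.2 (Eq.symm hxy)⟩

/-- The orbit of the length accumulates at a finitely supported measure, if there is no invariant
probability measure: a measure of maximal atom energy in the closure of the orbit is one. -/
lemma exists_finite_support_limit (hΓ : ¬ HasInvariantProbability (Γ : Set HomeoCircle)) :
    ∃ A : Finset UnitAddCircle,
      ∃ ρ ∈ closure ((fun g => pushforward g circleVolume) '' (Γ : Set HomeoCircle)),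
        (ρ : Measure UnitAddCircle) (A : Set UnitAddCircle)ᶜ = 0 := by
  classical
  set 𝒬 := closure ((fun g => pushforward g circleVolume) '' (Γ : Set HomeoCircle)) with h𝒬
  have hinv : ∀ g ∈ Γ, ∀ ρ ∈ 𝒬, pushforward g ρ ∈ 𝒬 := by
    intro g hg ρ hρ
    refine map_mem_closure (continuous_pushforward g) hρ ?_
    rintro _ ⟨h, hh, rfl⟩
    exact ⟨g * h, Γ.mul_mem hg hh, pushforward_mul g h _⟩
  have hne : 𝒬.Nonempty := ⟨_, subset_closure ⟨1, Γ.one_mem, rfl⟩⟩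
  obtain ⟨ρ, hρ, hmax⟩ := UpperSemicontinuousOn.exists_isMaxOn hne isClosed_closure.isCompact
    (upperSemicontinuous_atomEnergy.upperSemicontinuousOn 𝒬)
  choose r hr hrc using exists_contracted_ball hΓ
  have hatom : ∀ y, ∃ a, (ρ : Measure UnitAddCircle) (ball y (r y) \ {a}) = 0 := fun y =>
    exists_atom_of_offDiagonal_null isOpen_ball (offDiagonal_null_of_isMax isClosed_closure hinv hρ
      (fun ρ' hρ' => hmax hρ') isOpen_ball (isPreconnected_ball_circle y (r y)) (hrc y))
  choose a ha using hatom
  obtain ⟨t, ht⟩ := isCompact_univ.elim_nhds_subcover (fun y : UnitAddCircle => ball y (r y))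
    fun y _ => ball_mem_nhds y (hr y)
  refine ⟨t.image a, ρ, hρ, ?_⟩
  refine measure_mono_null (t := ⋃ y ∈ t, ball y (r y) \ {a y}) ?_
    ((measure_biUnion_null_iff t.countable_toSet).2 fun y _ => ha y)
  intro x hx
  obtain ⟨y, hy, hxy⟩ := mem_iUnion₂.1 (ht.2 (mem_univ x))
  refine mem_iUnion₂.2 ⟨y, hy, hxy, fun hxa => hx ?_⟩
  rw [mem_singleton_iff] at hxa
  simp only [Finset.coe_image]
  exact ⟨y, hy, hxa.symm⟩

end FiniteLimit

/-! ### Contractions towards finite sets -/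

section Contraction

variable {Γ : Submonoid HomeoCircle}

/-- The points within distance less than `ε` of a finite set. -/
def nbhd (A : Finset UnitAddCircle) (ε : ℝ) : Set UnitAddCircle := ⋃ a ∈ A, ball a ε

lemma isOpen_nbhd (A : Finset UnitAddCircle) (ε : ℝ) : IsOpen (nbhd A ε) :=
  isOpen_biUnion fun _ _ => isOpen_ball

lemma mem_nbhd {A : Finset UnitAddCircle} {ε : ℝ} {x : UnitAddCircle} :
    x ∈ nbhd A ε ↔ ∃ a ∈ A, dist x a < ε := by simp [nbhd]

lemma nbhd_mono {A : Finset UnitAddCircle} {ε δ : ℝ} (h : ε ≤ δ) : nbhd A ε ⊆ nbhd A δ :=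
  iUnion₂_mono fun _ _ => ball_subset_ball h

lemma exists_finset_frontier_nbhd (A : Finset UnitAddCircle) (ε : ℝ) :
    ∃ F : Finset UnitAddCircle, frontier (nbhd A ε) ⊆ F ∧ F.card ≤ 2 * A.card := by
  classical
  refine ⟨A.biUnion fun a => {a + (ε : UnitAddCircle), a - (ε : UnitAddCircle)}, ?_, ?_⟩
  · refine (frontier_biUnion_finset_subset A _).trans ?_
    simp only [Finset.coe_biUnion, Finset.coe_insert, Finset.coe_singleton]
    exact iUnion₂_mono fun a _ => frontier_ball_circle_subset a ε
  · refine Finset.card_biUnion_le.trans ?_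
    rw [mul_comm]
    exact Finset.sum_le_card_nsmul _ _ _ fun a _ => Finset.card_le_two

/-- If `g` maps all but a small length into a neighbourhood of `A`, then it maps into it the
complement of a neighbourhood of the preimage of its boundary. -/
lemma mapsTo_nbhd_of_lt_volume {A : Finset UnitAddCircle} {ε : ℝ} (h0 : 0 < ε) (h1 : ε < 1)
    {g : HomeoCircle} (hg : 1 - ENNReal.ofReal ε < volume (g ⁻¹' nbhd A ε)) :
    ∃ E : Finset UnitAddCircle, E.card ≤ 2 * A.card ∧ MapsTo g (nbhd E ε)ᶜ (nbhd A ε) := by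
  classical
  obtain ⟨F, hF, hFc⟩ := exists_finset_frontier_nbhd A ε
  refine ⟨F.image g.symm, Finset.card_image_le.trans hFc, fun x hx => ?_⟩
  by_contra hgx
  have hsub : ball x ε ⊆ (g ⁻¹' nbhd A ε)ᶜ := by
    refine (isPreconnected_ball_circle x ε).subset_of_disjoint_frontier
      ⟨x, mem_ball_self h0, hgx⟩ ?_
    rw [frontier_compl, ← g.preimage_frontier, Set.disjoint_left]
    intro y hy hyF
    refine hx (mem_nbhd.2 ⟨y, ?_, by rwa [dist_comm]⟩)
    exact Finset.mem_image.2 ⟨g y, hF hyF, g.symm_apply_apply y⟩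
  have hopen : IsOpen (g ⁻¹' nbhd A ε) := (isOpen_nbhd A ε).preimage g.continuous
  have h2 := (lt_volume_ball_circle x h0 h1).trans_le (measure_mono hsub)
  have h3 : volume (g ⁻¹' nbhd A ε) + volume (g ⁻¹' nbhd A ε)ᶜ = 1 := by
    rw [measure_add_measure_compl hopen.measurableSet, UnitAddCircle.measure_univ]
  have h4 : (1 : ℝ≥0∞) < volume (g ⁻¹' nbhd A ε) + ENNReal.ofReal ε := by
    exact (ENNReal.sub_lt_iff_lt_right ENNReal.ofReal_ne_top (by simpa using h1.le)).1 hg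
  have h5 : volume (g ⁻¹' nbhd A ε) + ENNReal.ofReal ε < 1 := by
    rw [← h3]
    exact ENNReal.add_lt_add_left (measure_ne_top _ _) h2
  exact lt_asymm h4 h5

/-- Without an invariant probability measure, elements of `Γ` map the complement of any small
neighbourhood of a finite set `R` into any small neighbourhood of a finite set `A`. -/
lemma exists_contraction (hΓ : ¬ HasInvariantProbability (Γ : Set HomeoCircle)) :
    ∃ R A : Finset UnitAddCircle, ∀ ε > 0, ∃ g ∈ Γ, MapsTo g (nbhd R ε)ᶜ (nbhd A ε) := by
  classical
  obtain ⟨A, ρ, hρ, hA⟩ := exists_finite_support_limit hΓ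
  have hstep : ∀ n : ℕ, ∃ g ∈ Γ, ∃ f : Fin (2 * A.card + 1) → UnitAddCircle,
      MapsTo g (nbhd (Finset.univ.image f) (1 / ((n : ℝ) + 2)))ᶜ (nbhd A (1 / ((n : ℝ) + 2))) := by
    intro n
    set ε : ℝ := 1 / ((n : ℝ) + 2) with hε
    have h0 : 0 < ε := by positivity
    have h1 : ε < 1 := by
      rw [hε, div_lt_one (by positivity)]
      have : (0 : ℝ) ≤ n := n.cast_nonneg
      linarith
    have hρA : (ρ : Measure UnitAddCircle) (nbhd A ε) = 1 := by
      rw [prob_compl_eq_zero_iff A.measurableSet] at hA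
      refine le_antisymm prob_le_one (hA.ge.trans (measure_mono fun a ha => ?_))
      exact mem_nbhd.2 ⟨a, ha, by simpa using h0⟩
    have hlt : 1 - ENNReal.ofReal ε < (ρ : Measure UnitAddCircle) (nbhd A ε) := by
      rw [hρA]
      exact ENNReal.sub_lt_self ENNReal.one_ne_top one_ne_zero (ENNReal.ofReal_pos.2 h0).ne'
    have hev := lowerSemicontinuous_measure_of_isOpen (isOpen_nbhd A ε) ρ _ hlt
    obtain ⟨_, hgε, ⟨g, hg, rfl⟩⟩ := mem_closure_iff_nhds.1 hρ _ hev
    have hgε : 1 - ENNReal.ofReal ε <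
      (pushforward g circleVolume : Measure UnitAddCircle) (nbhd A ε) := hgε
    rw [pushforward_apply g _ (isOpen_nbhd A ε).measurableSet] at hgε
    obtain ⟨E, hE, hgE⟩ := mapsTo_nbhd_of_lt_volume h0 h1 hgε
    obtain ⟨f, hf⟩ : ∃ f : Fin (2 * A.card + 1) → UnitAddCircle,
        (E : Set UnitAddCircle) ⊆ range f := by
      refine ⟨fun i => if h : (i : ℕ) < E.card then E.equivFin.symm ⟨i, h⟩ else 0, fun x hx => ?_⟩
      refine ⟨⟨E.equivFin ⟨x, hx⟩, ?_⟩, ?_⟩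
      · have := (E.equivFin ⟨x, hx⟩).2
        omega
      · simp
    refine ⟨g, hg, f, fun x hx => hgE fun hxE => hx ?_⟩
    obtain ⟨e, he, hxe⟩ := mem_nbhd.1 hxE
    obtain ⟨i, rfl⟩ := hf he
    exact mem_nbhd.2 ⟨f i, Finset.mem_image_of_mem f (Finset.mem_univ i), hxe⟩
  choose g hg f hgf using hstep
  -- The sets to be removed have boundedly many points, so they converge along a subsequence.
  obtain ⟨F, -, φ, hφ, hF⟩ :=
    (isCompact_univ (X := Fin (2 * A.card + 1) → UnitAddCircle)).tendsto_subseq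
      (x := f) fun n => mem_univ _
  refine ⟨Finset.univ.image F, A, fun ε hε => ?_⟩
  have h1 : ∀ᶠ n in atTop, dist (f (φ n)) F < ε / 2 :=
    hF.eventually (ball_mem_nhds F (half_pos hε))
  have h2 : ∀ᶠ n : ℕ in atTop, 1 / ((n : ℝ) + 1) < ε / 2 :=
    tendsto_one_div_add_atTop_nhds_zero_nat.eventually_lt_const (half_pos hε)
  obtain ⟨n, hn1, hn2⟩ := (h1.and h2).exists
  have hn3 : 1 / ((φ n : ℝ) + 2) < ε / 2 := by
    refine lt_of_le_of_lt (one_div_le_one_div_of_le (by positivity) ?_) hn2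
    have : (n : ℝ) ≤ φ n := by exact_mod_cast hφ.le_apply
    linarith
  refine ⟨g (φ n), hg _, fun x hx => nbhd_mono (by linarith) (hgf (φ n) fun hxf => hx ?_)⟩
  obtain ⟨_, he, hxe⟩ := mem_nbhd.1 hxf
  obtain ⟨i, -, rfl⟩ := Finset.mem_image.1 he
  refine mem_nbhd.2 ⟨F i, Finset.mem_image_of_mem F (Finset.mem_univ i), ?_⟩
  have h3 := (dist_le_pi_dist (f (φ n)) F i).trans_lt hn1
  have h4 := dist_triangle x (f (φ n) i) (F i)
  linarith

end Contraction

/-! ### Schottky sets -/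

section Transversals

/-- A family of finite sets has only finitely many transversals of minimal cardinality: such a
transversal is found by adding points one at a time, always from a member not yet met. -/
lemma finite_setOf_min_transversal {X : Type*} [DecidableEq X] (𝒜 : Set (Finset X)) (l : ℕ)
    (hmin : ∀ E : Finset X, (∀ A ∈ 𝒜, ¬ Disjoint A E) → l ≤ E.card) :
    {E : Finset X | E.card = l ∧ ∀ A ∈ 𝒜, ¬ Disjoint A E}.Finite := by
  have key : ∀ k : ℕ, ∀ D : Finset X, D.card + k = l →
      {E : Finset X | D ⊆ E ∧ E.card = l ∧ ∀ A ∈ 𝒜, ¬ Disjoint A E}.Finite := by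
    intro k
    induction k with
    | zero =>
      intro D hD
      refine (Set.finite_singleton D).subset ?_
      rintro E ⟨hDE, hE, -⟩
      exact (Finset.eq_of_subset_of_card_le hDE (by omega)).symm
    | succ k ih =>
      intro D hD
      have hnot : ¬ ∀ A ∈ 𝒜, ¬ Disjoint A D := by
        intro h
        have := hmin D h
        omega
      push Not at hnot
      obtain ⟨A, hA, hAD⟩ := hnot
      have hfin : (⋃ a ∈ A, {E : Finset X | insert a D ⊆ E ∧ E.card = l ∧
          ∀ A ∈ 𝒜, ¬ Disjoint A E}).Finite := by
        refine A.finite_toSet.biUnion fun a ha => ih (insert a D) ?_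
        rw [Finset.card_insert_of_notMem (Finset.disjoint_left.1 hAD ha)]
        omega
      refine hfin.subset ?_
      rintro E ⟨hDE, hE, hE'⟩
      obtain ⟨a, ha, haE⟩ := Finset.not_disjoint_iff.1 (hE' A hA)
      exact mem_iUnion₂.2 ⟨a, ha, Finset.insert_subset haE hDE, hE, hE'⟩
  refine (key l ∅ (by simp)).subset ?_
  rintro E ⟨hE, hE'⟩
  exact ⟨Finset.empty_subset _, hE, hE'⟩

/-- Without an invariant probability measure, any finite set can be moved off any other one: else
the finitely many minimal transversals of the translates would make up a finite invariant set. -/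
lemma exists_disjoint_image [DecidableEq UnitAddCircle] {G : Subsemigroup HomeoCircle}
    (hG : ¬ HasInvariantProbability (G : Set HomeoCircle)) (A E : Finset UnitAddCircle) :
    ∃ h ∈ G, Disjoint (A.image h) E := by
  by_contra hcon
  push Not at hcon
  set 𝒜 : Set (Finset UnitAddCircle) := {B | ∃ h ∈ G, B = A.image h} with h𝒜
  have hex : ∃ l, ∃ E : Finset UnitAddCircle, E.card = l ∧ ∀ B ∈ 𝒜, ¬ Disjoint B E := by
    refine ⟨E.card, E, rfl, ?_⟩
    rintro _ ⟨h, hh, rfl⟩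
    exact hcon h hh
  classical
  set l := Nat.find hex with hl
  have hfin := finite_setOf_min_transversal 𝒜 l fun E' hE' => Nat.find_min' hex ⟨E', rfl, hE'⟩
  obtain ⟨E₀, hE₀, hE₀'⟩ := Nat.find_spec hex
  have hne : ∃ g, g ∈ G := by
    by_contra hne
    push Not at hne
    exact hG ⟨volume, ⟨UnitAddCircle.measure_univ⟩, fun g hg => absurd hg (hne g)⟩
  set Y : Finset UnitAddCircle := hfin.toFinset.biUnion id with hY
  have hmemY : ∀ y, y ∈ Y ↔ ∃ E : Finset UnitAddCircle,
      (E.card = l ∧ ∀ B ∈ 𝒜, ¬ Disjoint B E) ∧ y ∈ E := by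
    intro y
    simp only [hY, Finset.mem_biUnion, Set.Finite.mem_toFinset, mem_ofPred_eq, id]
  refine hG (hasInvariantProbability_of_finite Y ?_ ?_)
  · obtain ⟨g, hg⟩ := hne
    obtain ⟨a, -, ha⟩ := Finset.not_disjoint_iff.1 (hE₀' _ ⟨g, hg, rfl⟩)
    exact ⟨a, (hmemY a).2 ⟨E₀, ⟨hE₀, hE₀'⟩, ha⟩⟩
  · intro g hg z hz
    have hsub : Y.image g.symm ⊆ Y := by
      intro y hy
      obtain ⟨x, hx, rfl⟩ := Finset.mem_image.1 hy
      obtain ⟨E', ⟨hE', hE''⟩, hxE⟩ := (hmemY x).1 hx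
      refine (hmemY _).2 ⟨E'.image g.symm, ⟨?_, ?_⟩, Finset.mem_image_of_mem _ hxE⟩
      · rw [Finset.card_image_of_injective _ g.symm.injective, hE']
      · rintro _ ⟨h, hh, rfl⟩ hd
        refine hE'' _ ⟨g * h, G.mul_mem hg hh, rfl⟩ ?_
        rw [Finset.disjoint_left] at hd ⊢
        intro w hw hwE
        obtain ⟨a, ha, rfl⟩ := Finset.mem_image.1 hw
        refine hd (Finset.mem_image_of_mem h ha) (Finset.mem_image.2 ⟨_, hwE, ?_⟩)
        exact g.symm_apply_apply (h a)
    have heq := Finset.eq_of_subset_of_card_le hsub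
      (by rw [Finset.card_image_of_injective _ g.symm.injective])
    rw [← heq] at hz
    obtain ⟨y, hy, rfl⟩ := Finset.mem_image.1 hz
    rwa [g.apply_symm_apply]

end Transversals

section Marked

/-- `X` is a union of connected sets each of which has its boundary in the finite set `F` and
contains a point of `F`. -/
def IsMarked (X : Set UnitAddCircle) (F : Finset UnitAddCircle) : Prop :=
  ∃ 𝒞 : Set (Set UnitAddCircle), X = ⋃₀ 𝒞 ∧
    ∀ C ∈ 𝒞, IsPreconnected C ∧ frontier C ⊆ F ∧ (C ∩ F).Nonempty

lemma IsMarked.image [DecidableEq UnitAddCircle] {X : Set UnitAddCircle} {F : Finset UnitAddCircle}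
    (h : IsMarked X F) (w : HomeoCircle) : IsMarked (w '' X) (F.image w) := by
  obtain ⟨𝒞, rfl, h𝒞⟩ := h
  refine ⟨(fun C => w '' C) '' 𝒞, image_sUnion, ?_⟩
  rintro _ ⟨C, hC, rfl⟩
  obtain ⟨h1, h2, y, hyC, hyF⟩ := h𝒞 C hC
  refine ⟨h1.image w w.continuous.continuousOn, ?_, w y, mem_image_of_mem w hyC, ?_⟩
  · rw [← w.image_frontier, Finset.coe_image]
    exact image_mono h2
  · rw [Finset.coe_image]
    exact mem_image_of_mem w hyF

/-- If two marked sets meet, then one of them contains a marked point of the other. -/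
lemma IsMarked.exists_mem_of_inter_nonempty {X X' : Set UnitAddCircle}
    {F F' : Finset UnitAddCircle} (h : IsMarked X F) (h' : IsMarked X' F')
    (hne : (X ∩ X').Nonempty) : (∃ p ∈ F, p ∈ X') ∨ ∃ p ∈ F', p ∈ X := by
  obtain ⟨𝒞, rfl, h𝒞⟩ := h
  obtain ⟨𝒞', rfl, h𝒞'⟩ := h'
  obtain ⟨x, ⟨C, hC, hxC⟩, C', hC', hxC'⟩ := hne
  obtain ⟨h1, h2, y, hyC, hyF⟩ := h𝒞 C hC
  obtain ⟨h1', h2', -⟩ := h𝒞' C' hC'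
  by_cases hd : Disjoint C (frontier C')
  · exact Or.inl ⟨y, hyF, C', hC', h1.subset_of_disjoint_frontier ⟨x, hxC, hxC'⟩ hd hyC⟩
  · obtain ⟨p, hpC, hp⟩ := Set.not_disjoint_iff.1 hd
    exact Or.inr ⟨p, h2' hp, C, hC, hpC⟩

/-- A union of arcs is marked by the centres and the endpoints of the arcs. -/
lemma exists_isMarked_nbhd (A : Finset UnitAddCircle) {ε : ℝ} (hε : 0 < ε) :
    ∃ F : Finset UnitAddCircle, IsMarked (nbhd A ε) F ∧ F.card ≤ 3 * A.card := by
  classical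
  refine ⟨A ∪ A.biUnion fun a => {a + (ε : UnitAddCircle), a - (ε : UnitAddCircle)},
    ⟨(fun a => ball a ε) '' A, by simp [nbhd, sUnion_image], ?_⟩, ?_⟩
  · rintro _ ⟨a, ha, rfl⟩
    refine ⟨isPreconnected_ball_circle a ε, ?_, a, mem_ball_self hε, by simp [Finset.mem_coe.1 ha]⟩
    refine (frontier_ball_circle_subset a ε).trans fun x hx => ?_
    rw [Finset.mem_coe, Finset.mem_union, Finset.mem_biUnion]
    exact Or.inr ⟨a, ha, by simpa using hx⟩
  · refine (Finset.card_union_le _ _).trans ?_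
    have : (A.biUnion fun a => ({a + (ε : UnitAddCircle), a - (ε : UnitAddCircle)} :
        Finset UnitAddCircle)).card ≤ A.card * 2 :=
      Finset.card_biUnion_le_card_mul _ _ _ fun a _ => Finset.card_le_two
    omega

end Marked

section Schottky

lemma eventually_nbhd_subset (A : Finset UnitAddCircle) {O : Set UnitAddCircle} (hO : IsOpen O)
    (hA : (A : Set UnitAddCircle) ⊆ O) : ∀ᶠ ε in 𝓝[>] (0 : ℝ), nbhd A ε ⊆ O := by
  have : ∀ᶠ ε in 𝓝[>] (0 : ℝ), ∀ a ∈ A, ball a ε ⊆ O := by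
    rw [Finset.eventually_all]
    intro a ha
    obtain ⟨δ, hδ, hδO⟩ := Metric.isOpen_iff.1 hO a (hA ha)
    filter_upwards [Ioo_mem_nhdsGT hδ] with ε hε
    exact (ball_subset_ball hε.2.le).trans hδO
  filter_upwards [this] with ε hε
  exact iUnion₂_subset hε

lemma eventually_disjoint_image_nbhd [DecidableEq UnitAddCircle] {A B : Finset UnitAddCircle}
    {h k : HomeoCircle} (hd : Disjoint (A.image h) (B.image k)) :
    ∀ᶠ ε in 𝓝[>] (0 : ℝ), Disjoint (h '' nbhd A ε) (k '' nbhd B ε) := by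
  obtain ⟨O₁, O₂, hO₁, hO₂, h1, h2, h12⟩ := SeparatedNhds.of_finset_finset _ _ hd
  have hA : (A : Set UnitAddCircle) ⊆ h ⁻¹' O₁ := fun a ha =>
    h1 (Finset.mem_coe.2 (Finset.mem_image_of_mem h ha))
  have hB : (B : Set UnitAddCircle) ⊆ k ⁻¹' O₂ := fun a ha =>
    h2 (Finset.mem_coe.2 (Finset.mem_image_of_mem k ha))
  filter_upwards [eventually_nbhd_subset A (hO₁.preimage h.continuous) hA,
    eventually_nbhd_subset B (hO₂.preimage k.continuous) hB] with ε hε1 hε2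
  exact h12.mono (image_subset_iff.2 hε1) (image_subset_iff.2 hε2)

/-- A finite family of pairwise disjoint open sets `U e`, `V e` on the circle, which are unions of
boundedly many arcs: each of them is marked by at most `K` points. -/
structure SchottkySets (r K : ℕ) where
  U : Fin r → Set UnitAddCircle
  V : Fin r → Set UnitAddCircle
  isOpen_U : ∀ e, IsOpen (U e)
  isOpen_V : ∀ e, IsOpen (V e)
  disjoint_U : ∀ e e', e ≠ e' → Disjoint (U e) (U e')
  disjoint_V : ∀ e e', e ≠ e' → Disjoint (V e) (V e')
  disjoint_UV : ∀ e e', Disjoint (U e) (V e')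
  exists_isMarked_U : ∀ e, ∃ F : Finset UnitAddCircle, IsMarked (U e) F ∧ F.card ≤ K
  exists_isMarked_V : ∀ e, ∃ F : Finset UnitAddCircle, IsMarked (V e) F ∧ F.card ≤ K

/-- Multiplying a contraction on both sides by elements of `G` moves its repelling and attracting
sets independently of each other, in particular into disjoint positions for different labels. The
number of marked points does not change with that, so it does not depend on the number `r` of
labels. -/
lemma exists_schottkySets {G : Subsemigroup HomeoCircle}
    (hG : ¬ HasInvariantProbability (G : Set HomeoCircle)) :
    ∃ K, ∀ r, ∃ S : SchottkySets r K, ∀ e, ∃ s ∈ G, MapsTo s (S.U e)ᶜ (S.V e) := by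
  classical
  let Γ : Submonoid HomeoCircle :=
    { carrier := {g | g = 1 ∨ g ∈ G}
      one_mem' := Or.inl rfl
      mul_mem' := by
        rintro a b (rfl | ha) (rfl | hb)
        · exact Or.inl rfl
        · exact Or.inr (by simpa using hb)
        · exact Or.inr (by simpa using ha)
        · exact Or.inr (G.mul_mem ha hb) }
  have hΓ : ¬ HasInvariantProbability (Γ : Set HomeoCircle) := by
    rintro ⟨ν, hν, h⟩
    exact hG ⟨ν, hν, fun g hg => h g (Or.inr hg)⟩
  obtain ⟨R, A, hRA⟩ := exists_contraction hΓ
  refine ⟨3 * max R.card A.card, fun r => ?_⟩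
  -- Translates of `A` and inverse translates of `R`, all pairwise disjoint.
  obtain ⟨p, hp, hpd⟩ := exists_seq_of_forall_finset_exists
    (α := HomeoCircle × HomeoCircle)
    (fun x => x.1 ∈ G ∧ x.2 ∈ G ∧ Disjoint (A.image x.1) (R.image x.2.symm))
    (fun x y => Disjoint (A.image x.1 ∪ R.image x.2.symm) (A.image y.1 ∪ R.image y.2.symm))
    (by
      intro s _
      set E : Finset UnitAddCircle := s.biUnion fun x => A.image x.1 ∪ R.image x.2.symm with hE
      obtain ⟨h, hh, hhE⟩ := exists_disjoint_image hG A E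
      obtain ⟨k, hk, hkE⟩ := exists_disjoint_image hG (E ∪ A.image h) R
      have hkE' : Disjoint (E ∪ A.image h) (R.image k.symm) := by
        rw [Finset.disjoint_left] at hkE ⊢
        intro x hx hxR
        obtain ⟨y, hy, rfl⟩ := Finset.mem_image.1 hxR
        exact hkE (Finset.mem_image_of_mem k hx) (by simpa using hy)
      rw [Finset.disjoint_union_left] at hkE'
      refine ⟨(h, k), ⟨hh, hk, hkE'.2⟩, fun x hx => ?_⟩
      have hxE : A.image x.1 ∪ R.image x.2.symm ⊆ E :=
        Finset.subset_biUnion_of_mem (fun x => A.image x.1 ∪ R.image x.2.symm) hx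
      rw [Finset.disjoint_union_right]
      exact ⟨(hhE.symm.mono_left hxE), hkE'.1.mono_left hxE⟩)
  have hpd' : ∀ m n, m ≠ n → Disjoint (A.image (p m).1 ∪ R.image (p m).2.symm)
      (A.image (p n).1 ∪ R.image (p n).2.symm) := by
    intro m n hmn
    rcases lt_or_gt_of_ne hmn with h | h
    · exact hpd m n h
    · exact (hpd n m h).symm
  have hev : ∀ᶠ ε in 𝓝[>] (0 : ℝ), ∀ e e' : Fin r,
      (e ≠ e' → Disjoint ((p e).2.symm '' nbhd R ε) ((p e').2.symm '' nbhd R ε)) ∧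
      (e ≠ e' → Disjoint ((p e).1 '' nbhd A ε) ((p e').1 '' nbhd A ε)) ∧
      Disjoint ((p e).2.symm '' nbhd R ε) ((p e').1 '' nbhd A ε) := by
    simp only [eventually_all]
    intro e e'
    refine Eventually.and ?_ (Eventually.and ?_ ?_)
    · by_cases h : e = e'
      · simp [h]
      · have := (Finset.disjoint_union_left.1 (hpd' e e' fun hee => h (Fin.ext hee))).2
        filter_upwards [eventually_disjoint_image_nbhd (Finset.disjoint_union_right.1 this).2] with
          ε hε _ using hε
    · by_cases h : e = e'
      · simp [h]
      · have := (Finset.disjoint_union_left.1 (hpd' e e' fun hee => h (Fin.ext hee))).1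
        filter_upwards [eventually_disjoint_image_nbhd (Finset.disjoint_union_right.1 this).1] with
          ε hε _ using hε
    · by_cases h : e = e'
      · subst h
        exact eventually_disjoint_image_nbhd (hp e).2.2.symm
      · have := (Finset.disjoint_union_left.1 (hpd' e e' fun hee => h (Fin.ext hee))).2
        exact eventually_disjoint_image_nbhd (Finset.disjoint_union_right.1 this).1
  obtain ⟨ε, hε, hε0⟩ := (hev.and self_mem_nhdsWithin).exists
  have hε0 : 0 < ε := hε0
  obtain ⟨g, hg, hgRA⟩ := hRA ε hε0
  obtain ⟨FR, hFR, hFRc⟩ := exists_isMarked_nbhd R hε0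
  obtain ⟨FA, hFA, hFAc⟩ := exists_isMarked_nbhd A hε0
  refine ⟨⟨fun e => (p e).2.symm '' nbhd R ε, fun e => (p e).1 '' nbhd A ε,
    fun e => (p e).2.symm.isOpenMap _ (isOpen_nbhd R ε),
    fun e => (p e).1.isOpenMap _ (isOpen_nbhd A ε),
    fun e e' => (hε e e').1, fun e e' => (hε e e').2.1, fun e e' => (hε e e').2.2,
    fun e => ⟨_, hFR.image _, Finset.card_image_le.trans (hFRc.trans ?_)⟩,
    fun e => ⟨_, hFA.image _, Finset.card_image_le.trans (hFAc.trans ?_)⟩⟩, fun e => ?_⟩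
  · exact Nat.mul_le_mul_left 3 (le_max_left _ _)
  · exact Nat.mul_le_mul_left 3 (le_max_right _ _)
  · refine ⟨(p e).1 * g * (p e).2, ?_, fun x hx => ?_⟩
    · rcases hg with rfl | hg
      · rw [mul_one]; exact G.mul_mem (hp e).1 (hp e).2.1
      · exact G.mul_mem (G.mul_mem (hp e).1 hg) (hp e).2.1
    · refine mem_image_of_mem (p e).1 (hgRA fun hx' => hx ?_)
      exact ⟨_, hx', (p e).2.symm_apply_apply x⟩

lemma exists_list_of_mem_closure {M : Type*} [Monoid M] {S : Set M} {s : M}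
    (hs : s ∈ Subsemigroup.closure S) : ∃ l : List M, l ≠ [] ∧ (∀ x ∈ l, x ∈ S) ∧ l.prod = s := by
  induction hs using Subsemigroup.closure_induction with
  | mem x hx => exact ⟨[x], by simp, by simpa using hx, by simp⟩
  | mul x y _ _ ihx ihy =>
    obtain ⟨l, h1, h2, rfl⟩ := ihx
    obtain ⟨l', h1', h2', rfl⟩ := ihy
    refine ⟨l ++ l', by simp [h1], fun x hx => ?_, by simp⟩
    rcases List.mem_append.1 hx with h | h
    · exact h2 x h
    · exact h2' x h

/-- The contractions of Schottky sets may be chosen to be products of the same number of elements of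
a generating set, because the powers of a contraction are contractions with the same sets. -/
lemma exists_schottkySets_words {S : Set HomeoCircle}
    (hS : ¬ HasInvariantProbability (Subsemigroup.closure S : Set HomeoCircle)) :
    ∃ K, ∀ r, ∃ N > 0, ∃ 𝒮 : SchottkySets r K, ∀ e, ∃ l : List HomeoCircle,
      l.length = N ∧ (∀ x ∈ l, x ∈ S) ∧ MapsTo l.prod (𝒮.U e)ᶜ (𝒮.V e) := by
  obtain ⟨K, hK⟩ := exists_schottkySets hS
  refine ⟨K, fun r => ?_⟩
  obtain ⟨𝒮, h𝒮⟩ := hK r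
  choose s hs hmaps using h𝒮
  choose l hl hlS hprod using fun e => exists_list_of_mem_closure (hs e)
  have hpos : ∀ e, 0 < (l e).length := fun e => List.length_pos_iff.2 (hl e)
  refine ⟨∏ e, (l e).length, Finset.prod_pos fun e _ => hpos e, 𝒮, fun e => ?_⟩
  obtain ⟨n, hn⟩ := Finset.dvd_prod_of_mem (fun e => (l e).length) (Finset.mem_univ e)
  have hn0 : n ≠ 0 := by
    rintro rfl
    rw [mul_zero] at hn
    exact (Finset.prod_pos fun e _ => hpos e).ne' hn
  refine ⟨(List.replicate n (l e)).flatten, ?_, ?_, ?_⟩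
  · simp [hn, mul_comm]
  · intro x hx
    obtain ⟨l', hl', hx⟩ := List.mem_flatten.1 hx
    rw [List.eq_of_mem_replicate hl'] at hx
    exact hlS e x hx
  · have h1 : (List.replicate n (l e)).flatten.prod = s e ^ n := by
      rw [List.prod_flatten, List.map_replicate, List.prod_replicate, hprod e]
    rw [h1]
    have h2 : ∀ m : ℕ, MapsTo (s e ^ (m + 1) : HomeoCircle) (𝒮.U e)ᶜ (𝒮.V e) := by
      intro m
      induction m with
      | zero => simpa using hmaps e
      | succ m ih =>
        intro x hx
        rw [pow_succ']
        exact hmaps e fun hxU => Set.disjoint_left.1 (𝒮.disjoint_UV e e) hxU (ih hx)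
    obtain ⟨m, rfl⟩ := Nat.exists_eq_succ_of_ne_zero hn0
    exact h2 m

end Schottky

/-! ### Stacks of contractions -/

section Indicator

open scoped Classical in
/-- The value `1` if `p` holds and `0` otherwise. -/
noncomputable def ind (p : Prop) : ℝ≥0∞ := if p then 1 else 0

lemma ind_of {p : Prop} (h : p) : ind p = 1 := if_pos h

lemma ind_of_not {p : Prop} (h : ¬ p) : ind p = 0 := if_neg h

lemma ind_le_one (p : Prop) : ind p ≤ 1 := by
  by_cases h : p
  · rw [ind_of h]
  · rw [ind_of_not h]; exact zero_le

lemma ind_le {p : Prop} {a : ℝ≥0∞} (h : p → 1 ≤ a) : ind p ≤ a := by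
  by_cases hp : p
  · rw [ind_of hp]; exact h hp
  · rw [ind_of_not hp]; exact zero_le

lemma ind_mono {p q : Prop} (h : p → q) : ind p ≤ ind q := ind_le fun hp => (ind_of (h hp)).ge

/-- At most one of the members of a family of mutually exclusive propositions holds. -/
lemma sum_ind_le {ι : Type*} [Fintype ι] {p : ι → Prop} {q : Prop} (h : ∀ i, p i → q)
    (hu : ∀ i j, p i → p j → i = j) : ∑ i, ind (p i) ≤ ind q := by
  classical
  by_cases hex : ∃ i, p i
  · obtain ⟨i, hi⟩ := hex
    rw [Finset.sum_eq_single i (fun j _ hj => ind_of_not fun hpj => hj (hu j i hpj hi))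
      (fun hn => absurd (Finset.mem_univ i) hn)]
    exact ind_mono (h i)
  · push Not at hex
    rw [Finset.sum_eq_zero fun i _ => ind_of_not (hex i)]
    exact zero_le

lemma one_le_sum_ind {ι : Type*} [Fintype ι] {p : ι → Prop} (h : ∃ i, p i) :
    1 ≤ ∑ i, ind (p i) := by
  obtain ⟨i, hi⟩ := h
  rw [← ind_of hi]
  exact Finset.single_le_sum (f := fun i => ind (p i)) (fun _ _ => zero_le) (Finset.mem_univ i)

end Indicator

section Stack

variable {r K : ℕ}

/-- A step kept on the stack: the label `e` of the step, its value `s`, and the product `h` of the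
steps that came after it and before the next step kept. -/
structure Frame (r : ℕ) where
  e : Fin r
  s : HomeoCircle
  h : HomeoCircle

/-- The product of the steps recorded by a stack with last frame on top, where `w` is the product of
those preceding the frames. -/
def evalStack (w : HomeoCircle) : List (Frame r) → HomeoCircle
  | [] => w
  | f :: l => f.h * f.s * evalStack w l

/-- Multiplication by `y` of the product following the top frame. -/
def absorb (y : HomeoCircle) : HomeoCircle × List (Frame r) → HomeoCircle × List (Frame r)
  | (w, []) => (y * w, [])
  | (w, f :: l) => (w, { f with h := y * f.h } :: l)

/-- A step with label `e` is compatible with a stack if the attracting set of the top frame, moved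
by the product that follows it, avoids the repelling set of `e`. -/
def Compatible (𝒮 : SchottkySets r K) : List (Frame r) → Fin r → Prop
  | [], _ => True
  | f :: _, e => Disjoint (f.h '' 𝒮.V f.e) (𝒮.U e)

open scoped Classical in
/-- One step of the walk, as an operation on stacks. The values of the step with the various labels
are given by `A`. A step without label is absorbed. A step with a label is pushed if it is
compatible with the top frame; otherwise, the top frame and the step are both absorbed into the
product that follows the frame below. -/
noncomputable def stackStep (𝒮 : SchottkySets r K) (A : Option (Fin r) → HomeoCircle) :
    HomeoCircle × List (Frame r) → Option (Fin r) → HomeoCircle × List (Frame r)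
  | st, none => absorb (A none) st
  | (w, []), some e => (w, [⟨e, A (some e), 1⟩])
  | (w, f :: l), some e =>
      if Compatible 𝒮 (f :: l) e then (w, ⟨e, A (some e), 1⟩ :: f :: l)
      else absorb (A (some e) * f.h * f.s) (w, l)

lemma evalStack_absorb (y : HomeoCircle) (st : HomeoCircle × List (Frame r)) :
    evalStack (absorb y st).1 (absorb y st).2 = y * evalStack st.1 st.2 := by
  obtain ⟨w, _ | ⟨f, l⟩⟩ := st
  · rfl
  · simp only [absorb, evalStack, mul_assoc]

lemma evalStack_stackStep (𝒮 : SchottkySets r K) (A : Option (Fin r) → HomeoCircle)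
    (st : HomeoCircle × List (Frame r)) (ξ : Option (Fin r)) :
    evalStack (stackStep 𝒮 A st ξ).1 (stackStep 𝒮 A st ξ).2 = A ξ * evalStack st.1 st.2 := by
  obtain ⟨w, _ | ⟨f, l⟩⟩ := st <;> obtain _ | e := ξ
  · exact evalStack_absorb _ _
  · simp only [stackStep, evalStack, one_mul]
  · exact evalStack_absorb _ _
  · simp only [stackStep]
    split_ifs
    · simp only [evalStack, one_mul]
    · rw [evalStack_absorb]
      simp only [evalStack, mul_assoc]

/-- The frames of the stack are contractions, and each of them is compatible with the ones below. -/
def WellFormed (𝒮 : SchottkySets r K) : List (Frame r) → Prop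
  | [] => True
  | f :: l => MapsTo f.s (𝒮.U f.e)ᶜ (𝒮.V f.e) ∧ Compatible 𝒮 l f.e ∧ WellFormed 𝒮 l

/-- The values of the steps with a label are contractions for the sets with that label. -/
def IsLegal (𝒮 : SchottkySets r K) (σ : Fin r → HomeoCircle) : Prop :=
  ∀ e, MapsTo (σ e) (𝒮.U e)ᶜ (𝒮.V e)

variable {𝒮 : SchottkySets r K}

lemma WellFormed.absorb {st : HomeoCircle × List (Frame r)} (h : WellFormed 𝒮 st.2)
    (y : HomeoCircle) : WellFormed 𝒮 (absorb y st).2 := by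
  obtain ⟨w, _ | ⟨f, l⟩⟩ := st
  · exact h
  · exact ⟨h.1, h.2⟩

lemma WellFormed.stackStep {A : Option (Fin r) → HomeoCircle} (hA : IsLegal 𝒮 fun e => A (some e))
    {st : HomeoCircle × List (Frame r)} (h : WellFormed 𝒮 st.2) (ξ : Option (Fin r)) :
    WellFormed 𝒮 (stackStep 𝒮 A st ξ).2 := by
  obtain ⟨w, _ | ⟨f, l⟩⟩ := st <;> obtain _ | e := ξ
  · exact h.absorb _
  · exact ⟨hA e, trivial, trivial⟩
  · exact h.absorb _
  · simp only [_root_.stackStep]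
    split_ifs with hc
    · exact ⟨hA e, hc, h⟩
    · exact WellFormed.absorb (st := (w, l)) h.2.2 _

lemma WellFormed.of_append {l l' : List (Frame r)} (h : WellFormed 𝒮 (l ++ l')) :
    WellFormed 𝒮 l := by
  induction l with
  | nil => trivial
  | cons f l ih =>
    refine ⟨h.1, ?_, ih h.2.2⟩
    cases l with
    | nil => trivial
    | cons f' l => exact h.2.1

/-- The repelling set of the product recorded by a stack, as seen from its top frame. It is the
whole circle if there are no frames. -/
def repelSet (𝒮 : SchottkySets r K) (w : HomeoCircle) : List (Frame r) → Set UnitAddCircle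
  | [] => univ
  | f :: l => evalStack w l ⁻¹' 𝒮.U f.e

/-- The attracting set of the product recorded by a list of frames, as seen from the lowest one. It
is the whole circle if there are no frames. -/
def attractSet (𝒮 : SchottkySets r K) : List (Frame r) → Set UnitAddCircle
  | [] => univ
  | [f] => f.h '' 𝒮.V f.e
  | f :: f' :: l => (f.h * f.s) '' attractSet 𝒮 (f' :: l)

lemma isOpen_repelSet (w : HomeoCircle) (l : List (Frame r)) : IsOpen (repelSet 𝒮 w l) := by
  cases l with
  | nil => exact isOpen_univ
  | cons f l => exact (𝒮.isOpen_U f.e).preimage (evalStack w l).continuous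

lemma isOpen_attractSet (l : List (Frame r)) : IsOpen (attractSet 𝒮 l) := by
  induction l with
  | nil => exact isOpen_univ
  | cons f l ih =>
    cases l with
    | nil => exact f.h.isOpenMap _ (𝒮.isOpen_V f.e)
    | cons f' l => exact (f.h * f.s).isOpenMap _ ih

lemma evalStack_mem_image_V {w : HomeoCircle} {f : Frame r} {l : List (Frame r)}
    (h : WellFormed 𝒮 (f :: l)) {x : UnitAddCircle} (hx : x ∉ repelSet 𝒮 w (f :: l)) :
    evalStack w (f :: l) x ∈ f.h '' 𝒮.V f.e :=
  ⟨f.s (evalStack w l x), h.1 hx, rfl⟩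

/-- The repelling sets decrease as frames are added to the stack. -/
lemma repelSet_cons_subset {w : HomeoCircle} {f : Frame r} {l : List (Frame r)}
    (h : WellFormed 𝒮 l) (hc : Compatible 𝒮 l f.e) : repelSet 𝒮 w (f :: l) ⊆ repelSet 𝒮 w l := by
  intro x hx
  cases l with
  | nil => trivial
  | cons f' l =>
    by_contra hx'
    exact Set.disjoint_left.1 hc (evalStack_mem_image_V h hx') hx

/-- The attracting sets decrease as frames are added at the bottom. -/
lemma attractSet_cons_subset {f : Frame r} {l : List (Frame r)} (h : WellFormed 𝒮 (f :: l)) :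
    attractSet 𝒮 (f :: l) ⊆ f.h '' 𝒮.V f.e := by
  induction l generalizing f with
  | nil => exact subset_rfl
  | cons f' l ih =>
    rintro _ ⟨y, hy, rfl⟩
    have hy' := ih h.2.2 hy
    exact ⟨f.s y, h.1 (Set.disjoint_left.1 h.2.1 hy'), rfl⟩

lemma mem_attractSet_cons {f : Frame r} {l : List (Frame r)} {x : UnitAddCircle}
    (hx : x ∈ attractSet 𝒮 (f :: l)) : (f.h * f.s)⁻¹ x ∈ attractSet 𝒮 l := by
  cases l with
  | nil => trivial
  | cons f' l =>
    obtain ⟨y, hy, rfl⟩ := hx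
    have : (f.h * f.s)⁻¹ ((f.h * f.s) y) = y := (f.h * f.s).symm_apply_apply y
    rwa [this]

/-- If a stack is cut in two, then its product maps the complement of the repelling set of the lower
part into the attracting set of the upper part. -/
lemma mapsTo_attractSet {w : HomeoCircle} {l l' : List (Frame r)} (hl : l ≠ []) (hl' : l' ≠ [])
    (h : WellFormed 𝒮 (l ++ l')) :
    MapsTo (evalStack w (l ++ l')) (repelSet 𝒮 w l')ᶜ (attractSet 𝒮 l) := by
  intro x hx
  induction l with
  | nil => exact absurd rfl hl
  | cons f l ih =>
    cases l with
    | nil =>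
      obtain ⟨f', l', rfl⟩ := List.exists_cons_of_ne_nil hl'
      exact ⟨f.s (evalStack w (f' :: l') x),
        h.1 (Set.disjoint_left.1 h.2.1 (evalStack_mem_image_V h.2.2 hx)), rfl⟩
    | cons f' l => exact mem_image_of_mem _ (ih (by simp) h.2.2)

/-- `X` is marked by at most `K` points. -/
def IsMarkedBy (K : ℕ) (X : Set UnitAddCircle) : Prop :=
  ∃ F : Finset UnitAddCircle, IsMarked X F ∧ F.card ≤ K

lemma IsMarkedBy.image {X : Set UnitAddCircle} (h : IsMarkedBy K X) (w : HomeoCircle) :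
    IsMarkedBy K (w '' X) := by
  classical
  obtain ⟨F, hF, hFK⟩ := h
  exact ⟨_, hF.image w, Finset.card_image_le.trans hFK⟩

lemma IsMarkedBy.union {X Y : Set UnitAddCircle} (hX : IsMarkedBy K X) (hY : IsMarkedBy K Y) :
    IsMarkedBy (2 * K) (X ∪ Y) := by
  classical
  obtain ⟨F, ⟨𝒞, rfl, h𝒞⟩, hFK⟩ := hX
  obtain ⟨F', ⟨𝒞', rfl, h𝒞'⟩, hFK'⟩ := hY
  refine ⟨F ∪ F', ⟨𝒞 ∪ 𝒞', (sUnion_union _ _).symm, ?_⟩,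
    (Finset.card_union_le _ _).trans (by omega)⟩
  rintro C (hC | hC)
  · obtain ⟨h1, h2, h3⟩ := h𝒞 C hC
    refine ⟨h1, h2.trans (by simp), h3.mono (inter_subset_inter_right _ (by simp))⟩
  · obtain ⟨h1, h2, h3⟩ := h𝒞' C hC
    refine ⟨h1, h2.trans (by simp), h3.mono (inter_subset_inter_right _ (by simp))⟩

lemma isMarkedBy_repelSet (w : HomeoCircle) {l : List (Frame r)} (hl : l ≠ []) :
    IsMarkedBy K (repelSet 𝒮 w l) := by
  obtain ⟨f, l, rfl⟩ := List.exists_cons_of_ne_nil hl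
  have : repelSet 𝒮 w (f :: l) = (evalStack w l).symm '' 𝒮.U f.e :=
    ((evalStack w l).toEquiv.image_symm_eq_preimage _).symm
  rw [this]
  exact IsMarkedBy.image (𝒮.exists_isMarked_U f.e) _

lemma isMarkedBy_attractSet {l : List (Frame r)} (hl : l ≠ []) :
    IsMarkedBy K (attractSet 𝒮 l) := by
  induction l with
  | nil => exact absurd rfl hl
  | cons f l ih =>
    cases l with
    | nil => exact IsMarkedBy.image (𝒮.exists_isMarked_V f.e) _
    | cons f' l => exact (ih (by simp)).image _

open scoped Classical in
/-- An enumeration of the points that mark a set, continued by `0`; it is `0` throughout if the set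
is not marked by `K` points. -/
noncomputable def markPoint (K : ℕ) (X : Set UnitAddCircle) (i : Fin K) : UnitAddCircle :=
  if h : IsMarkedBy K X then
    if hi : (i : ℕ) < h.choose.card then h.choose.equivFin.symm ⟨i, hi⟩ else 0
  else 0

lemma IsMarkedBy.isMarked {X : Set UnitAddCircle} (h : IsMarkedBy K X) :
    ∃ F : Finset UnitAddCircle, IsMarked X F ∧ ∀ p ∈ F, ∃ i, markPoint K X i = p := by
  refine ⟨h.choose, h.choose_spec.1, fun p hp => ?_⟩
  have hlt : ((h.choose.equivFin ⟨p, hp⟩ : Fin _) : ℕ) < K :=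
    (h.choose.equivFin ⟨p, hp⟩).2.trans_le h.choose_spec.2
  refine ⟨⟨_, hlt⟩, ?_⟩
  simp [markPoint, h]

lemma IsMarkedBy.exists_markPoint {K' : ℕ} {X X' : Set UnitAddCircle} (h : IsMarkedBy K X)
    (h' : IsMarkedBy K' X') (hne : (X ∩ X').Nonempty) :
    (∃ i, markPoint K X i ∈ X') ∨ ∃ i, markPoint K' X' i ∈ X := by
  obtain ⟨F, hF, hi⟩ := h.isMarked
  obtain ⟨F', hF', hi'⟩ := h'.isMarked
  rcases hF.exists_mem_of_inter_nonempty hF' hne with ⟨p, hp, hpX⟩ | ⟨p, hp, hpX⟩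
  · obtain ⟨i, rfl⟩ := hi p hp
    exact Or.inl ⟨i, hpX⟩
  · obtain ⟨i, rfl⟩ := hi' p hp
    exact Or.inr ⟨i, hpX⟩

/-- A homeomorphism moves the attracting sets into position for few pairs of labels to be
incompatible: such a pair is determined by a marked point and one of the labels. -/
lemma sum_ind_not_disjoint_le (𝒮 : SchottkySets r K) (h : HomeoCircle) :
    ∑ e', ∑ e, ind (¬ Disjoint (h '' 𝒮.V e) (𝒮.U e')) ≤ 2 * K * r := by
  have hmV : ∀ e, IsMarkedBy K (h '' 𝒮.V e) := fun e => IsMarkedBy.image (𝒮.exists_isMarked_V e) h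
  have hmU : ∀ e, IsMarkedBy K (𝒮.U e) := 𝒮.exists_isMarked_U
  have h1 : ∀ e' e, ind (¬ Disjoint (h '' 𝒮.V e) (𝒮.U e')) ≤
      ∑ i, ind (markPoint K (h '' 𝒮.V e) i ∈ 𝒮.U e') +
        ∑ i, ind (markPoint K (𝒮.U e') i ∈ h '' 𝒮.V e) := by
    intro e' e
    refine ind_le fun hd => ?_
    rcases (hmV e).exists_markPoint (hmU e') (Set.not_disjoint_iff_nonempty_inter.1 hd) with hi | hi
    · exact (one_le_sum_ind hi).trans le_self_add
    · exact (one_le_sum_ind hi).trans le_add_self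
  have h2 : ∑ e', ∑ e, ∑ i, ind (markPoint K (h '' 𝒮.V e) i ∈ 𝒮.U e') ≤ K * r := by
    rw [Finset.sum_comm]
    calc ∑ e, ∑ e', ∑ i, ind (markPoint K (h '' 𝒮.V e) i ∈ 𝒮.U e')
        ≤ ∑ _e : Fin r, (K : ℝ≥0∞) := Finset.sum_le_sum fun e _ => by
          rw [Finset.sum_comm]
          calc ∑ i, ∑ e', ind (markPoint K (h '' 𝒮.V e) i ∈ 𝒮.U e')
              ≤ ∑ _i : Fin K, (1 : ℝ≥0∞) := Finset.sum_le_sum fun i _ => by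
                refine (sum_ind_le (q := True) (fun _ _ => trivial) fun a b ha hb => ?_).trans
                  (ind_le_one _)
                by_contra hab
                exact Set.disjoint_left.1 (𝒮.disjoint_U a b hab) ha hb
            _ = K := by simp
      _ = K * r := by simp [mul_comm]
  have h3 : ∑ e', ∑ e, ∑ i, ind (markPoint K (𝒮.U e') i ∈ h '' 𝒮.V e) ≤ K * r := by
    calc ∑ e', ∑ e, ∑ i, ind (markPoint K (𝒮.U e') i ∈ h '' 𝒮.V e)
        ≤ ∑ _e : Fin r, (K : ℝ≥0∞) := Finset.sum_le_sum fun e' _ => by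
          rw [Finset.sum_comm]
          calc ∑ i, ∑ e, ind (markPoint K (𝒮.U e') i ∈ h '' 𝒮.V e)
              ≤ ∑ _i : Fin K, (1 : ℝ≥0∞) := Finset.sum_le_sum fun i _ => by
                refine (sum_ind_le (q := True) (fun _ _ => trivial) fun a b ha hb => ?_).trans
                  (ind_le_one _)
                by_contra hab
                exact Set.disjoint_left.1 (disjoint_image_of_injective h.injective
                  (𝒮.disjoint_V a b hab)) ha hb
            _ = K := by simp
      _ = K * r := by simp [mul_comm]
  calc ∑ e', ∑ e, ind (¬ Disjoint (h '' 𝒮.V e) (𝒮.U e'))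
      ≤ ∑ e', ∑ e, (∑ i, ind (markPoint K (h '' 𝒮.V e) i ∈ 𝒮.U e') +
        ∑ i, ind (markPoint K (𝒮.U e') i ∈ h '' 𝒮.V e)) :=
        Finset.sum_le_sum fun e' _ => Finset.sum_le_sum fun e _ => h1 e' e
    _ = ∑ e', ∑ e, ∑ i, ind (markPoint K (h '' 𝒮.V e) i ∈ 𝒮.U e') +
        ∑ e', ∑ e, ∑ i, ind (markPoint K (𝒮.U e') i ∈ h '' 𝒮.V e) := by
        simp only [Finset.sum_add_distrib]
    _ ≤ K * r + K * r := add_le_add h2 h3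
    _ = 2 * K * r := by ring

end Stack

/-! ### Sums over labels -/

section RunSum

variable {ι α S S' : Type*} [Fintype ι]

/-- The expectation of `G` at the state reached from `s` after steps with independent random labels
of weights `W`, where the `i`-th step applies `step (As i)`. -/
noncomputable def runSum (W : ι → ℝ≥0∞) (step : α → S → ι → S) :
    List α → S → (S → ℝ≥0∞) → ℝ≥0∞
  | [], s, G => G s
  | A :: As, s, G => ∑ ξ, W ξ * runSum W step As (step A s ξ) G

variable {W : ι → ℝ≥0∞} {step : α → S → ι → S}

lemma runSum_add (As : List α) (s : S) (G G' : S → ℝ≥0∞) :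
    runSum W step As s (fun x => G x + G' x) = runSum W step As s G + runSum W step As s G' := by
  induction As generalizing s with
  | nil => rfl
  | cons A As ih => simp only [runSum, ih, mul_add, Finset.sum_add_distrib]

lemma runSum_const_mul (As : List α) (s : S) (c : ℝ≥0∞) (G : S → ℝ≥0∞) :
    runSum W step As s (fun x => c * G x) = c * runSum W step As s G := by
  induction As generalizing s with
  | nil => rfl
  | cons A As ih =>
    simp only [runSum, ih, Finset.mul_sum]
    exact Finset.sum_congr rfl fun _ _ => by ring

lemma runSum_zero (As : List α) (s : S) : runSum W step As s (fun _ => 0) = 0 := by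
  simpa using runSum_const_mul (W := W) (step := step) As s 0 (fun _ => 0)

lemma runSum_sum {κ : Type*} (t : Finset κ) (As : List α) (s : S) (G : κ → S → ℝ≥0∞) :
    runSum W step As s (fun x => ∑ i ∈ t, G i x) = ∑ i ∈ t, runSum W step As s (G i) := by
  classical
  induction t using Finset.induction_on with
  | empty => simp only [Finset.sum_empty, runSum_zero]
  | insert i t hi ih => simp only [Finset.sum_insert hi, runSum_add, ih]

lemma runSum_mono {P : S → Prop} {As : List α} (hstep : ∀ A ∈ As, ∀ s ξ, P s → P (step A s ξ))
    {s : S} (hs : P s) {G G' : S → ℝ≥0∞} (h : ∀ s, P s → G s ≤ G' s) :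
    runSum W step As s G ≤ runSum W step As s G' := by
  induction As generalizing s with
  | nil => exact h s hs
  | cons A As ih =>
    exact Finset.sum_le_sum fun ξ _ => mul_le_mul_right (ih
      (fun B hB => hstep B (List.mem_cons_of_mem _ hB)) (hstep A (List.mem_cons_self) s ξ hs)) _

lemma runSum_const (hW : ∑ ξ, W ξ = 1) (As : List α) (s : S) (c : ℝ≥0∞) :
    runSum W step As s (fun _ => c) = c := by
  induction As generalizing s with
  | nil => rfl
  | cons A As ih => simp only [runSum, ih, ← Finset.sum_mul, hW, one_mul]

lemma runSum_comm {ι' α' : Type*} [Fintype ι'] {W' : ι' → ℝ≥0∞} {step' : α' → S' → ι' → S'}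
    (As : List α) (As' : List α') (s : S) (s' : S') (F : S → S' → ℝ≥0∞) :
    runSum W step As s (fun x => runSum W' step' As' s' (F x)) =
      runSum W' step' As' s' (fun y => runSum W step As s (fun x => F x y)) := by
  induction As generalizing s with
  | nil => rfl
  | cons A As ih => simp only [runSum, ih, runSum_sum, runSum_const_mul]

lemma runSum_comp {step' : α → S' → ι → S'} {φ : S → S'}
    (hφ : ∀ A s ξ, φ (step A s ξ) = step' A (φ s) ξ) (As : List α) (s : S) (G : S' → ℝ≥0∞) :
    runSum W step As s (fun x => G (φ x)) = runSum W step' As (φ s) G := by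
  induction As generalizing s with
  | nil => rfl
  | cons A As ih => simp only [runSum, ih, hφ]

lemma runSum_append_singleton (As : List α) (A : α) (s : S) (G : S → ℝ≥0∞) :
    runSum W step (As ++ [A]) s G =
      runSum W step As s (fun x => ∑ ξ, W ξ * G (step A x ξ)) := by
  induction As generalizing s with
  | nil => rfl
  | cons B As ih => simp only [runSum, List.cons_append, ih]

lemma measurable_runSum {X : Type*} [MeasurableSpace X] {F : S → X → ℝ≥0∞}
    (hF : ∀ s, Measurable (F s)) (As : List α) (s : S) :
    Measurable fun x => runSum W step As s (fun s => F s x) := by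
  induction As generalizing s with
  | nil => exact hF s
  | cons A As ih =>
    exact Finset.measurable_sum _ fun ξ _ => (ih _).const_mul _

lemma runSum_lintegral {X : Type*} [MeasurableSpace X] {μ : Measure X} {F : S → X → ℝ≥0∞}
    (hF : ∀ s, Measurable (F s)) (As : List α) (s : S) :
    runSum W step As s (fun s => ∫⁻ x, F s x ∂μ) =
      ∫⁻ x, runSum W step As s (fun s => F s x) ∂μ := by
  induction As generalizing s with
  | nil => rfl
  | cons A As ih =>
    simp only [runSum, ih]
    rw [lintegral_finsetSum _ fun ξ _ => (measurable_runSum hF As _).const_mul _]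
    exact Finset.sum_congr rfl fun ξ _ => (lintegral_const_mul _ (measurable_runSum hF As _)).symm

end RunSum

section ChainSum

variable {r K : ℕ} {𝒮 : SchottkySets r K} {b : ℝ≥0∞}

/-- The sum of `G` over all compatible labellings of a list of unlabelled frames, each label having
weight `b`. An unlabelled frame consists of the value of its step for each label, and of the product
that follows the step. -/
noncomputable def chainSum (𝒮 : SchottkySets r K) (b : ℝ≥0∞) :
    List ((Fin r → HomeoCircle) × HomeoCircle) → (List (Frame r) → ℝ≥0∞) → ℝ≥0∞
  | [], G => G []
  | F :: l, G =>
      b * ∑ e, chainSum 𝒮 b l fun st => ind (Compatible 𝒮 st e) * G (⟨e, F.1 e, F.2⟩ :: st)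

variable {l lt lb : List ((Fin r → HomeoCircle) × HomeoCircle)}

lemma chainSum_add (l) (G G' : List (Frame r) → ℝ≥0∞) :
    chainSum 𝒮 b l (fun x => G x + G' x) = chainSum 𝒮 b l G + chainSum 𝒮 b l G' := by
  induction l generalizing G G' with
  | nil => rfl
  | cons F l ih => simp only [chainSum, mul_add, ih, Finset.sum_add_distrib]

lemma chainSum_const_mul (l) (c : ℝ≥0∞) (G : List (Frame r) → ℝ≥0∞) :
    chainSum 𝒮 b l (fun x => c * G x) = c * chainSum 𝒮 b l G := by
  induction l generalizing G with
  | nil => rfl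
  | cons F l ih =>
    simp only [chainSum, mul_left_comm _ c, ih]
    rw [← Finset.mul_sum, mul_left_comm]

lemma chainSum_sum {κ : Type*} (t : Finset κ) (l) (G : κ → List (Frame r) → ℝ≥0∞) :
    chainSum 𝒮 b l (fun x => ∑ i ∈ t, G i x) = ∑ i ∈ t, chainSum 𝒮 b l (G i) := by
  classical
  induction t using Finset.induction_on with
  | empty => simpa using chainSum_const_mul (𝒮 := 𝒮) (b := b) l 0 (fun _ => 0)
  | insert i t hi ih => simp only [Finset.sum_insert hi, chainSum_add, ih]

lemma chainSum_mono_of_wellFormed (hl : ∀ F ∈ l, IsLegal 𝒮 F.1) {G G' : List (Frame r) → ℝ≥0∞}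
    (h : ∀ st, WellFormed 𝒮 st → st.length = l.length → G st ≤ G' st) :
    chainSum 𝒮 b l G ≤ chainSum 𝒮 b l G' := by
  induction l generalizing G G' with
  | nil => exact h [] trivial rfl
  | cons F l ih =>
    refine mul_le_mul_right (Finset.sum_le_sum fun e _ =>
      ih (fun F' hF' => hl F' (List.mem_cons_of_mem _ hF')) fun st hst hlen => ?_) _
    by_cases hc : Compatible 𝒮 st e
    · exact mul_le_mul_right (h (⟨e, F.1 e, F.2⟩ :: st)
        ⟨hl F List.mem_cons_self e, hc, hst⟩ (by simp [hlen])) _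
    · rw [ind_of_not hc, zero_mul]; exact zero_le

lemma chainSum_mono {G G' : List (Frame r) → ℝ≥0∞} (h : ∀ st, G st ≤ G' st) :
    chainSum 𝒮 b l G ≤ chainSum 𝒮 b l G' := by
  induction l generalizing G G' with
  | nil => exact h []
  | cons F l ih =>
    exact mul_le_mul_right (Finset.sum_le_sum fun e _ => ih fun st => mul_le_mul_right (h _) _) _

lemma chainSum_append_le {G : List (Frame r) → ℝ≥0∞} {c : ℝ≥0∞}
    (h : ∀ top : List (Frame r), top.length = lt.length →
      chainSum 𝒮 b lb (fun bot => G (top ++ bot)) ≤ c) :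
    chainSum 𝒮 b (lt ++ lb) G ≤ (r * b) ^ lt.length * c := by
  induction lt generalizing G with
  | nil => simpa using h [] rfl
  | cons F lt ih =>
    calc chainSum 𝒮 b (F :: lt ++ lb) G
        ≤ b * ∑ _e : Fin r, (r * b) ^ lt.length * c := by
          refine mul_le_mul_right (Finset.sum_le_sum fun e _ => ?_) _
          refine le_trans (chainSum_mono (G' := fun st => G (⟨e, F.1 e, F.2⟩ :: st)) fun st => ?_)
            (ih fun top htop => h (_ :: top) (by simp [htop]))
          exact mul_le_of_le_one_left zero_le (ind_le_one _)
      _ = (r * b) ^ (F :: lt).length * c := by simp [pow_succ]; ring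

lemma chainSum_le {G : List (Frame r) → ℝ≥0∞} {c : ℝ≥0∞} (h : ∀ st, G st ≤ c) :
    chainSum 𝒮 b l G ≤ (r * b) ^ l.length * c := by
  simpa using chainSum_append_le (𝒮 := 𝒮) (b := b) (lt := l) (lb := []) (G := G) (c := c)
    fun top _ => h _

/-- A given point is in the repelling set with small probability, since the repelling sets for the
various labels of the top frame are disjoint subsets of the one of the frames below. -/
lemma chainSum_mem_repelSet_le (hl : ∀ F ∈ l, IsLegal 𝒮 F.1) (w : HomeoCircle) (x : UnitAddCircle) :
    chainSum 𝒮 b l (fun st => ind (x ∈ repelSet 𝒮 w st)) ≤ b ^ l.length := by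
  induction l with
  | nil => simpa [chainSum] using ind_le_one _
  | cons F l ih =>
    have hl' : ∀ F ∈ l, IsLegal 𝒮 F.1 := fun F' hF' => hl F' (List.mem_cons_of_mem _ hF')
    rw [chainSum, List.length_cons, pow_succ', ← chainSum_sum]
    refine mul_le_mul_right
      (le_trans (chainSum_mono_of_wellFormed hl' fun st hst _ => ?_) (ih hl')) _
    calc ∑ e, ind (Compatible 𝒮 st e) * ind (x ∈ repelSet 𝒮 w (⟨e, F.1 e, F.2⟩ :: st))
        ≤ ∑ e, ind (Compatible 𝒮 st e ∧ x ∈ repelSet 𝒮 w (⟨e, F.1 e, F.2⟩ :: st)) := by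
          refine Finset.sum_le_sum fun e _ => ?_
          by_cases hc : Compatible 𝒮 st e
          · simp only [hc, true_and, ind_of, one_mul, le_refl]
          · rw [ind_of_not hc, zero_mul]; exact zero_le
      _ ≤ ind (x ∈ repelSet 𝒮 w st) := by
          refine sum_ind_le (fun e he => repelSet_cons_subset hst he.1 he.2) fun e e' he he' => ?_
          by_contra hne
          exact Set.disjoint_left.1 (𝒮.disjoint_U e e' hne) he.2 he'.2

/-- A point depending on the lower frames only is in the attracting set of the upper frames with
small probability. -/
lemma chainSum_mem_attractSet_le (hl : ∀ F ∈ lt ++ lb, IsLegal 𝒮 F.1)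
    (X : List (Frame r) → UnitAddCircle) (G : List (Frame r) → ℝ≥0∞) :
    chainSum 𝒮 b (lt ++ lb) (fun st => ind (X (st.drop lt.length) ∈
      attractSet 𝒮 (st.take lt.length)) * G (st.drop lt.length)) ≤
      b ^ lt.length * chainSum 𝒮 b lb G := by
  induction lt generalizing X G with
  | nil =>
    simp only [List.nil_append, List.length_nil, pow_zero, one_mul, List.drop_zero]
    exact chainSum_mono fun st => mul_le_of_le_one_left zero_le (ind_le_one _)
  | cons F lt ih =>
    have hl' : ∀ F ∈ lt ++ lb, IsLegal 𝒮 F.1 := fun F' hF' => hl F' (List.mem_cons_of_mem _ hF')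
    rw [List.cons_append, chainSum, List.length_cons, pow_succ', mul_assoc]
    refine mul_le_mul_right ?_ _
    calc _ ≤ ∑ e, b ^ lt.length * chainSum 𝒮 b lb
          (fun st => ind (X st ∈ F.2 '' 𝒮.V e) * G st) := by
          refine Finset.sum_le_sum fun e _ => le_trans (chainSum_mono_of_wellFormed hl'
            fun st hst hlen => ?_) (ih hl' (fun st => (F.2 * F.1 e)⁻¹ (X st)) _)
          by_cases hc : Compatible 𝒮 st e
          · rw [ind_of hc, one_mul, ← mul_assoc]
            simp only [List.drop_succ_cons, List.take_succ_cons]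
            refine mul_le_mul_left (ind_le fun hX => ?_) _
            have hwf : WellFormed 𝒮 (⟨e, F.1 e, F.2⟩ :: st.take lt.length) := by
              have : WellFormed 𝒮
                  ((⟨e, F.1 e, F.2⟩ :: st.take lt.length) ++ st.drop lt.length) := by
                rw [List.cons_append, List.take_append_drop]
                exact ⟨hl F (by simp) e, hc, hst⟩
              exact this.of_append
            rw [ind_of (mem_attractSet_cons hX), ind_of (attractSet_cons_subset hwf hX), one_mul]
          · rw [ind_of_not hc, zero_mul]; exact zero_le
      _ = b ^ lt.length * chainSum 𝒮 b lb (fun st => (∑ e, ind (X st ∈ F.2 '' 𝒮.V e)) * G st) := by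
          simp only [Finset.sum_mul]
          rw [chainSum_sum, Finset.mul_sum]
      _ ≤ b ^ lt.length * chainSum 𝒮 b lb G := by
          refine mul_le_mul_right (chainSum_mono fun st => mul_le_of_le_one_left zero_le ?_) _
          refine (sum_ind_le (q := True) (fun _ _ => trivial) fun e e' he he' => ?_).trans
            (ind_le_one _)
          by_contra hne
          exact Set.disjoint_left.1 (disjoint_image_of_injective F.2.injective
            (𝒮.disjoint_V e e' hne)) he he'

/-- The repelling set of the lower half of a stack. -/
def lowerSet (𝒮 : SchottkySets r K) (w : HomeoCircle) (st : List (Frame r)) : Set UnitAddCircle :=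
  repelSet 𝒮 w (st.drop (st.length / 2))

/-- The attracting set of the upper half of a stack. -/
def upperSet (𝒮 : SchottkySets r K) (st : List (Frame r)) : Set UnitAddCircle :=
  attractSet 𝒮 (st.take (st.length / 2))

/-- With `q * q` labels of weight `b`, a frame with free label contributes `q * q * b` and one whose
label is determined contributes `b`. If a stack is cut into halves, one of each kind, then each
frame contributes the geometric mean `q * b`, up to a factor `q` that is due to parity. -/
lemma pow_mul_pow_le {q : ℕ} (hq : 1 ≤ q) {m n : ℕ} (h : m ≤ n + 1) :
    ((q * q : ℕ) * b) ^ m * b ^ n ≤ q * (q * b) ^ (m + n) := by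
  have h1 : ((q * q : ℕ) * b) ^ m * b ^ n = (q : ℝ≥0∞) ^ (2 * m) * b ^ (m + n) := by
    push_cast; ring
  have h2 : (q : ℝ≥0∞) * (q * b) ^ (m + n) = (q : ℝ≥0∞) ^ (m + n + 1) * b ^ (m + n) := by ring
  rw [h1, h2]
  exact mul_le_mul_left (pow_le_pow_right₀ (by exact_mod_cast hq) (by omega)) _

section Square

variable {q : ℕ} {𝒮 : SchottkySets (q * q) K}
  {l : List ((Fin (q * q) → HomeoCircle) × HomeoCircle)}

lemma chainSum_le_of_length_lt_two (hq : 1 ≤ q) (hlen : l.length < 2)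
    {G : List (Frame (q * q)) → ℝ≥0∞} (h : ∀ st, G st ≤ 1) :
    chainSum 𝒮 b l G ≤ q * (q * b) ^ l.length := by
  simpa using (chainSum_le h).trans (pow_mul_pow_le (b := b) (m := l.length) (n := 0) hq (by omega)
    |>.trans_eq' (by simp))

/-- A point that depends on the upper half only is in the repelling set of the lower half with small
probability. -/
lemma chainSum_mem_lowerSet_le (hq : 1 ≤ q) (hl : ∀ F ∈ l, IsLegal 𝒮 F.1) (w : HomeoCircle)
    (X : List (Frame (q * q)) → UnitAddCircle) :
    chainSum 𝒮 b l (fun st => ind (X (st.take (st.length / 2)) ∈ lowerSet 𝒮 w st)) ≤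
      q * (q * b) ^ l.length := by
  set k := l.length / 2 with hk
  have hlk : (l.take k).length = k := by rw [List.length_take]; omega
  have hmono : chainSum 𝒮 b l (fun st => ind (X (st.take (st.length / 2)) ∈ lowerSet 𝒮 w st)) ≤
      chainSum 𝒮 b l (fun st => ind (X (st.take k) ∈ repelSet 𝒮 w (st.drop k))) :=
    chainSum_mono_of_wellFormed hl fun st _ hst => by rw [lowerSet, hst]
  refine hmono.trans ?_
  rw [← List.take_append_drop k l]
  have h := chainSum_append_le (𝒮 := 𝒮) (b := b) (lt := l.take k) (lb := l.drop k)
    (G := fun st => ind (X (st.take k) ∈ repelSet 𝒮 w (st.drop k))) (c := b ^ (l.drop k).length)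
    fun top htop => by
      have h1 : ∀ bot, (top ++ bot).take k = top := fun bot => by
        rw [List.take_left' (htop.trans hlk)]
      have h2 : ∀ bot, (top ++ bot).drop k = bot := fun bot => by
        rw [List.drop_left' (htop.trans hlk)]
      simp only [h1, h2]
      exact chainSum_mem_repelSet_le (fun F hF => hl F (List.mem_of_mem_drop hF)) w _
  refine h.trans ?_
  rw [List.length_append]
  exact pow_mul_pow_le hq (by rw [hlk, List.length_drop]; omega)

/-- A point that depends on the lower half only is in the attracting set of the upper half with
small probability. -/
lemma chainSum_mem_upperSet_le (hq : 1 ≤ q) (hl : ∀ F ∈ l, IsLegal 𝒮 F.1)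
    (X : List (Frame (q * q)) → UnitAddCircle) :
    chainSum 𝒮 b l (fun st => ind (X (st.drop (st.length / 2)) ∈ upperSet 𝒮 st)) ≤
      q * (q * b) ^ l.length := by
  set k := l.length / 2 with hk
  have hlk : (l.take k).length = k := by rw [List.length_take]; omega
  have hmono : chainSum 𝒮 b l (fun st => ind (X (st.drop (st.length / 2)) ∈ upperSet 𝒮 st)) ≤
      chainSum 𝒮 b l (fun st => ind (X (st.drop k) ∈ attractSet 𝒮 (st.take k)) * 1) :=
    chainSum_mono_of_wellFormed hl fun st _ hst => by rw [upperSet, hst, mul_one]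
  refine hmono.trans ?_
  have h := chainSum_mem_attractSet_le (𝒮 := 𝒮) (b := b) (lt := l.take k) (lb := l.drop k)
    (by rwa [List.take_append_drop]) X (fun _ => 1)
  rw [List.take_append_drop, hlk] at h
  refine (h.trans (mul_le_mul_right (chainSum_le fun _ => le_rfl) _)).trans ?_
  have h3 : l.length = (l.drop k).length + k := by rw [List.length_drop]; omega
  rw [mul_one, mul_comm, h3]
  exact pow_mul_pow_le hq (by rw [List.length_drop]; omega)

/-- The stack is too short, or its lower or upper set contains `x`. -/
def IsBadAt (𝒮 : SchottkySets r K) (w : HomeoCircle) (x : UnitAddCircle) (st : List (Frame r)) :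
    Prop :=
  st.length < 2 ∨ x ∈ lowerSet 𝒮 w st ∪ upperSet 𝒮 st

/-- The stack is too short, or its lower and upper sets meet. -/
def IsBad (𝒮 : SchottkySets r K) (w : HomeoCircle) (st : List (Frame r)) : Prop :=
  st.length < 2 ∨ (lowerSet 𝒮 w st ∩ upperSet 𝒮 st).Nonempty

lemma chainSum_isBadAt_le (hq : 1 ≤ q) (hl : ∀ F ∈ l, IsLegal 𝒮 F.1) (w : HomeoCircle)
    (x : UnitAddCircle) :
    chainSum 𝒮 b l (fun st => ind (IsBadAt 𝒮 w x st)) ≤ 2 * q * (q * b) ^ l.length := by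
  by_cases hlen : l.length < 2
  · refine (chainSum_le_of_length_lt_two hq hlen fun _ => ind_le_one _).trans ?_
    rw [mul_assoc]
    exact le_mul_of_one_le_left zero_le (by norm_num)
  · have : chainSum 𝒮 b l (fun st => ind (IsBadAt 𝒮 w x st)) ≤
        chainSum 𝒮 b l (fun st => ind (x ∈ lowerSet 𝒮 w st) + ind (x ∈ upperSet 𝒮 st)) := by
      refine chainSum_mono_of_wellFormed hl fun st _ hst => ind_le ?_
      rintro (h | h | h)
      · omega
      · rw [ind_of h]; exact le_self_add
      · rw [ind_of h]; exact le_add_self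
    refine this.trans ?_
    rw [chainSum_add, mul_assoc, two_mul]
    exact add_le_add (chainSum_mem_lowerSet_le hq hl w fun _ => x)
      (chainSum_mem_upperSet_le hq hl fun _ => x)

lemma isMarkedBy_lowerSet {𝒮 : SchottkySets r K} (w : HomeoCircle) {st : List (Frame r)}
    (h : 2 ≤ st.length) : IsMarkedBy K (lowerSet 𝒮 w st) :=
  isMarkedBy_repelSet w (by rw [ne_eq, List.drop_eq_nil_iff]; omega)

lemma isMarkedBy_upperSet {𝒮 : SchottkySets r K} {st : List (Frame r)}
    (h : 2 ≤ st.length) : IsMarkedBy K (upperSet 𝒮 st) :=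
  isMarkedBy_attractSet (by
    rw [ne_eq, List.take_eq_nil_iff]; rintro (h | rfl)
    · omega
    · simp at h)

lemma chainSum_isBad_le (hq : 1 ≤ q) (hl : ∀ F ∈ l, IsLegal 𝒮 F.1) (w : HomeoCircle) :
    chainSum 𝒮 b l (fun st => ind (IsBad 𝒮 w st)) ≤ (2 * K + 1) * q * (q * b) ^ l.length := by
  by_cases hlen : l.length < 2
  · refine (chainSum_le_of_length_lt_two hq hlen fun _ => ind_le_one _).trans ?_
    rw [mul_assoc]
    exact le_mul_of_one_le_left zero_le le_add_self
  · have : chainSum 𝒮 b l (fun st => ind (IsBad 𝒮 w st)) ≤ chainSum 𝒮 b l (fun st =>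
        ∑ i, ind (markPoint K (repelSet 𝒮 w (st.drop (st.length / 2))) i ∈ upperSet 𝒮 st) +
        ∑ i, ind (markPoint K (attractSet 𝒮 (st.take (st.length / 2))) i ∈ lowerSet 𝒮 w st)) := by
      refine chainSum_mono_of_wellFormed hl fun st _ hst => ind_le ?_
      rintro (h | h)
      · omega
      · rcases (isMarkedBy_lowerSet w (by omega)).exists_markPoint
          (isMarkedBy_upperSet (by omega)) h with hi | hi
        · exact (one_le_sum_ind hi).trans le_self_add
        · exact (one_le_sum_ind hi).trans le_add_self
    refine this.trans ?_
    rw [chainSum_add, chainSum_sum, chainSum_sum]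
    calc _ ≤ ∑ _i : Fin K, (q : ℝ≥0∞) * (q * b) ^ l.length +
          ∑ _i : Fin K, (q : ℝ≥0∞) * (q * b) ^ l.length :=
          add_le_add
            (Finset.sum_le_sum fun i _ => chainSum_mem_upperSet_le hq hl
              fun bot => markPoint K (repelSet 𝒮 w bot) i)
            (Finset.sum_le_sum fun i _ => chainSum_mem_lowerSet_le hq hl w
              fun top => markPoint K (attractSet 𝒮 top) i)
      _ = 2 * K * q * (q * b) ^ l.length := by simp; ring
      _ ≤ _ := by gcongr; exact le_self_add

end Square

end ChainSum

/-! ### The pivot argument -/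

section Pivot

/-- The weights of the labels of a step: `b` for each label, and `w₀` for the absence of a label. -/
def labelWeight {r : ℕ} (w₀ b : ℝ≥0∞) (ξ : Option (Fin r)) : ℝ≥0∞ := ξ.elim w₀ fun _ => b

variable {q K : ℕ} {𝒮 : SchottkySets (q * q) K} {w₀ b : ℝ≥0∞}

/-- The expectation of `G` at the stack obtained from `st` by steps with random labels. -/
noncomputable abbrev stackSum (𝒮 : SchottkySets (q * q) K) (w₀ b : ℝ≥0∞) :
    List (Option (Fin (q * q)) → HomeoCircle) → HomeoCircle × List (Frame (q * q)) →
      (HomeoCircle × List (Frame (q * q)) → ℝ≥0∞) → ℝ≥0∞ :=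
  runSum (labelWeight w₀ b) (stackStep 𝒮)

/-- A bound that improves by the factor `q * b` with each frame of the stack improves by the factor
`w₀ + q * b + 2 * K * (q * b)` with each step of the walk: a step without label leaves the height of
the stack as it is, a compatible one increases it by `1`, and the step and the top frame together,
whose labels are a pair of weight `b * b`, are incompatible for at most `2 * K * (q * q)` pairs. -/
lemma chainSum_stackSum_le {G : HomeoCircle × List (Frame (q * q)) → ℝ≥0∞} {C : ℝ≥0∞}
    (hG : ∀ w l, (∀ F ∈ l, IsLegal 𝒮 F.1) →
      chainSum 𝒮 b l (fun st => G (w, st)) ≤ C * (q * b) ^ l.length)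
    {As : List (Option (Fin (q * q)) → HomeoCircle)}
    (hAs : ∀ A ∈ As, IsLegal 𝒮 fun e => A (some e)) (w : HomeoCircle)
    {l : List ((Fin (q * q) → HomeoCircle) × HomeoCircle)} (hl : ∀ F ∈ l, IsLegal 𝒮 F.1) :
    chainSum 𝒮 b l (fun st => stackSum 𝒮 w₀ b As (w, st) G) ≤
      C * (w₀ + q * b + 2 * K * (q * b)) ^ As.length * (q * b) ^ l.length := by
  induction As generalizing w l with
  | nil => simpa [runSum] using hG w l hl
  | cons A As ih =>
    set ρ : ℝ≥0∞ := w₀ + q * b + 2 * K * (q * b) with hρ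
    have hA : IsLegal 𝒮 fun e => A (some e) := hAs A List.mem_cons_self
    replace ih := fun w l hl => ih (fun B hB => hAs B (List.mem_cons_of_mem _ hB)) w (l := l) hl
    -- The sum over the stacks in which a given element is absorbed has the same bound.
    have habs : ∀ (y w : HomeoCircle) (l : List ((Fin (q * q) → HomeoCircle) × HomeoCircle)),
        (∀ F ∈ l, IsLegal 𝒮 F.1) →
        chainSum 𝒮 b l (fun st => stackSum 𝒮 w₀ b As (absorb y (w, st)) G) ≤
          C * ρ ^ As.length * (q * b) ^ l.length := by
      intro y w l hl
      cases l with
      | nil => exact ih (y * w) [] hl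
      | cons F l =>
        refine ih w ((F.1, y * F.2) :: l) ?_
        intro F' hF'
        rcases List.mem_cons.1 hF' with rfl | hF'
        · exact hl F List.mem_cons_self
        · exact hl F' (List.mem_cons_of_mem _ hF')
    have hpush : ∀ F ∈ ((fun e => A (some e), (1 : HomeoCircle)) :: l), IsLegal 𝒮 F.1 := by
      intro F hF
      rcases List.mem_cons.1 hF with rfl | hF
      · exact hA
      · exact hl F hF
    have hsplit : chainSum 𝒮 b l (fun st => stackSum 𝒮 w₀ b (A :: As) (w, st) G) =
        w₀ * chainSum 𝒮 b l (fun st => stackSum 𝒮 w₀ b As (absorb (A none) (w, st)) G) +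
        b * ∑ e', chainSum 𝒮 b l
          (fun st => stackSum 𝒮 w₀ b As (stackStep 𝒮 A (w, st) (some e')) G) := by
      have : ∀ st, stackSum 𝒮 w₀ b (A :: As) (w, st) G =
          w₀ * stackSum 𝒮 w₀ b As (absorb (A none) (w, st)) G +
          b * ∑ e', stackSum 𝒮 w₀ b As (stackStep 𝒮 A (w, st) (some e')) G := by
        intro st
        have hnone : stackStep 𝒮 A (w, st) none = absorb (A none) (w, st) := by
          cases st <;> rfl
        simp only [runSum, Fintype.sum_option, labelWeight, Option.elim, hnone, Finset.mul_sum]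
      simp only [this]
      rw [chainSum_add, chainSum_const_mul, chainSum_const_mul, chainSum_sum]
    rw [hsplit]
    cases l with
    | nil =>
      have hone := ih w _ hpush
      simp only [chainSum, Compatible, ind_of, one_mul, List.length_cons, List.length_nil] at hone
      have habs' := habs (A none) w [] hl
      simp only [List.length_nil, pow_zero, mul_one, List.length_cons] at habs' ⊢
      calc _ ≤ w₀ * (C * ρ ^ As.length) + C * ρ ^ As.length * (q * b) ^ (0 + 1) :=
            add_le_add (mul_le_mul_right habs' _) hone
        _ = C * ρ ^ As.length * (w₀ + q * b) := by ring
        _ ≤ C * ρ ^ As.length * ρ := mul_le_mul_right le_self_add _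
        _ = _ := by ring
    | cons F l =>
      have hl' : ∀ F ∈ l, IsLegal 𝒮 F.1 := fun F' hF' => hl F' (List.mem_cons_of_mem _ hF')
      have hone := ih w _ hpush
      have hstep : ∀ e' e st, stackSum 𝒮 w₀ b As
          (stackStep 𝒮 A (w, ⟨e, F.1 e, F.2⟩ :: st) (some e')) G ≤
          ind (Compatible 𝒮 (⟨e, F.1 e, F.2⟩ :: st) e') *
            stackSum 𝒮 w₀ b As (w, ⟨e', A (some e'), 1⟩ :: ⟨e, F.1 e, F.2⟩ :: st) G +
          ind (¬ Disjoint (F.2 '' 𝒮.V e) (𝒮.U e')) *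
            stackSum 𝒮 w₀ b As (absorb (A (some e') * F.2 * F.1 e) (w, st)) G := by
        intro e' e st
        by_cases hc : Compatible 𝒮 (⟨e, F.1 e, F.2⟩ :: st) e'
        · rw [ind_of hc, one_mul, stackStep, if_pos hc]
          exact le_self_add
        · rw [ind_of (show ¬ Disjoint (F.2 '' 𝒮.V e) (𝒮.U e') from hc), one_mul, stackStep,
            if_neg hc]
          exact le_add_self
      have hcons : b * ∑ e', chainSum 𝒮 b (F :: l)
          (fun st => stackSum 𝒮 w₀ b As (stackStep 𝒮 A (w, st) (some e')) G) ≤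
          chainSum 𝒮 b ((fun e => A (some e), 1) :: F :: l)
            (fun st => stackSum 𝒮 w₀ b As (w, st) G) +
          b * ∑ e', b * ∑ e, ind (¬ Disjoint (F.2 '' 𝒮.V e) (𝒮.U e')) *
            (C * ρ ^ As.length * (q * b) ^ l.length) := by
        rw [chainSum, ← mul_add, ← Finset.sum_add_distrib]
        refine mul_le_mul_right (Finset.sum_le_sum fun e' _ => ?_) _
        rw [chainSum, chainSum, ← mul_add, ← Finset.sum_add_distrib]
        refine mul_le_mul_right (Finset.sum_le_sum fun e _ => ?_) _
        refine (chainSum_mono fun st => mul_le_mul_right (hstep e' e st) _).trans ?_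
        simp only [mul_add]
        rw [chainSum_add]
        refine add_le_add le_rfl ?_
        refine le_trans (chainSum_mono fun st => mul_le_of_le_one_left zero_le (ind_le_one _)) ?_
        rw [chainSum_const_mul]
        exact mul_le_mul_right (habs _ w l hl') _
      have hcount : b * ∑ e', b * ∑ e, ind (¬ Disjoint (F.2 '' 𝒮.V e) (𝒮.U e')) *
            (C * ρ ^ As.length * (q * b) ^ l.length) ≤
          2 * K * (q * b) * (C * ρ ^ As.length * (q * b) ^ (l.length + 1)) := by
        simp only [← Finset.sum_mul, ← Finset.mul_sum]
        have h := sum_ind_not_disjoint_le 𝒮 F.2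
        calc _ = b * b * (C * ρ ^ As.length * (q * b) ^ l.length) *
              ∑ e', ∑ e, ind (¬ Disjoint (F.2 '' 𝒮.V e) (𝒮.U e')) := by ring
          _ ≤ b * b * (C * ρ ^ As.length * (q * b) ^ l.length) * (2 * K * (q * q : ℕ)) :=
            mul_le_mul_right h _
          _ = _ := by push_cast; ring
      have habs' := habs (A none) w (F :: l) hl
      simp only [List.length_cons] at hone habs' ⊢
      calc _ ≤ w₀ * (C * ρ ^ As.length * (q * b) ^ (l.length + 1)) +
            (C * ρ ^ As.length * (q * b) ^ (l.length + 1 + 1) +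
              2 * K * (q * b) * (C * ρ ^ As.length * (q * b) ^ (l.length + 1))) :=
            add_le_add (mul_le_mul_right habs' _) (hcons.trans (add_le_add hone hcount))
        _ = C * ρ ^ As.length * (q * b) ^ (l.length + 1) * ρ := by rw [hρ]; ring
        _ = _ := by ring

/-- The factor by which the probability of a bad stack decreases with each step. -/
noncomputable def pivotRate (q K : ℕ) (w₀ b : ℝ≥0∞) : ℝ≥0∞ := w₀ + q * b + 2 * K * (q * b)

lemma stackSum_isBadAt_le (hq : 1 ≤ q) {As : List (Option (Fin (q * q)) → HomeoCircle)}
    (hAs : ∀ A ∈ As, IsLegal 𝒮 fun e => A (some e)) (w : HomeoCircle) (x : UnitAddCircle) :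
    stackSum 𝒮 w₀ b As (w, []) (fun st => ind (IsBadAt 𝒮 st.1 x st.2)) ≤
      2 * q * pivotRate q K w₀ b ^ As.length := by
  simpa [chainSum, pivotRate] using chainSum_stackSum_le (w₀ := w₀) (b := b)
    (G := fun st => ind (IsBadAt 𝒮 st.1 x st.2))
    (fun w l hl => chainSum_isBadAt_le hq hl w x) hAs w (l := []) (by simp)

lemma stackSum_isBad_le (hq : 1 ≤ q) {As : List (Option (Fin (q * q)) → HomeoCircle)}
    (hAs : ∀ A ∈ As, IsLegal 𝒮 fun e => A (some e)) (w : HomeoCircle) :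
    stackSum 𝒮 w₀ b As (w, []) (fun st => ind (IsBad 𝒮 st.1 st.2)) ≤
      (2 * K + 1) * q * pivotRate q K w₀ b ^ As.length := by
  simpa [chainSum, pivotRate] using chainSum_stackSum_le (w₀ := w₀) (b := b)
    (G := fun st => ind (IsBad 𝒮 st.1 st.2))
    (fun w l hl => chainSum_isBad_le hq hl w) hAs w (l := []) (by simp)

lemma sum_labelWeight {r : ℕ} (h : w₀ + r * b = 1) :
    ∑ ξ : Option (Fin r), labelWeight w₀ b ξ = 1 := by
  simpa [Fintype.sum_option, labelWeight] using h

lemma isOpen_lowerSet (w : HomeoCircle) (st : List (Frame (q * q))) : IsOpen (lowerSet 𝒮 w st) :=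
  isOpen_repelSet _ _

lemma isOpen_upperSet (st : List (Frame (q * q))) : IsOpen (upperSet 𝒮 st) :=
  isOpen_attractSet _

lemma mapsTo_upperSet {w : HomeoCircle} {st : List (Frame (q * q))} (h : WellFormed 𝒮 st)
    (hlen : 2 ≤ st.length) :
    MapsTo (evalStack w st) (lowerSet 𝒮 w st)ᶜ (upperSet 𝒮 st) := by
  have := mapsTo_attractSet (𝒮 := 𝒮) (w := w) (l := st.take (st.length / 2))
    (l' := st.drop (st.length / 2))
    (by rw [ne_eq, List.take_eq_nil_iff]; rintro (h | rfl)
        · omega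
        · simp at hlen)
    (by rw [ne_eq, List.drop_eq_nil_iff]; omega) (by rwa [List.take_append_drop])
  rwa [List.take_append_drop] at this

lemma image_symm_compl_subset {f : HomeoCircle} {U V : Set UnitAddCircle} (h : MapsTo f Uᶜ V) :
    f.symm '' Vᶜ ⊆ U := by
  rintro _ ⟨y, hy, rfl⟩
  by_contra hx
  exact hy (by simpa using h hx)

variable {q' K' : ℕ} {𝒮' : SchottkySets (q' * q') K'} {w₀' b' : ℝ≥0∞}

/-- Two stacks that are not bad produce a ping-pong pair, unless their repelling and attracting sets
meet, in which case one of finitely many marked points is contained in one of these sets. -/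
lemma ind_not_isPingPongPair_le {w w' : HomeoCircle} {st : List (Frame (q * q))}
    {st' : List (Frame (q' * q'))} (h : WellFormed 𝒮 st) (h' : WellFormed 𝒮' st') :
    ind (¬ IsPingPongPair (evalStack w st) (evalStack w' st')) ≤
      ind (IsBad 𝒮 w st) + ind (IsBad 𝒮' w' st') +
      ∑ i, ind (IsBadAt 𝒮 w (markPoint (2 * K') (lowerSet 𝒮' w' st' ∪ upperSet 𝒮' st') i) st) +
      ∑ i, ind (IsBadAt 𝒮' w' (markPoint (2 * K) (lowerSet 𝒮 w st ∪ upperSet 𝒮 st) i) st') := by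
  by_cases hb : IsBad 𝒮 w st
  · rw [ind_of hb, add_assoc, add_assoc]
    exact (ind_le_one _).trans le_self_add
  by_cases hb' : IsBad 𝒮' w' st'
  · rw [ind_of hb', add_comm (ind _) 1, add_assoc, add_assoc]
    exact (ind_le_one _).trans le_self_add
  refine ind_le fun hpp => ?_
  simp only [IsBad, not_or, not_lt, Set.not_nonempty_iff_eq_empty,
    ← Set.disjoint_iff_inter_eq_empty] at hb hb'
  have hne : ((lowerSet 𝒮 w st ∪ upperSet 𝒮 st) ∩
      (lowerSet 𝒮' w' st' ∪ upperSet 𝒮' st')).Nonempty := by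
    by_contra hempty
    rw [Set.not_nonempty_iff_eq_empty, ← Set.disjoint_iff_inter_eq_empty, Set.disjoint_union_left,
      Set.disjoint_union_right, Set.disjoint_union_right] at hempty
    obtain ⟨⟨h1, h2⟩, h3, h4⟩ := hempty
    exact hpp ⟨lowerSet 𝒮 w st, lowerSet 𝒮' w' st', upperSet 𝒮 st, upperSet 𝒮' st',
      isOpen_lowerSet _ _, isOpen_lowerSet _ _, isOpen_upperSet _, isOpen_upperSet _,
      h1, hb.2, h2, h3.symm, hb'.2, h4,
      (mapsTo_upperSet h hb.1).image_subset, image_symm_compl_subset (mapsTo_upperSet h hb.1),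
      (mapsTo_upperSet h' hb'.1).image_subset, image_symm_compl_subset (mapsTo_upperSet h' hb'.1)⟩
  have hm : IsMarkedBy (2 * K) (lowerSet 𝒮 w st ∪ upperSet 𝒮 st) :=
    (isMarkedBy_lowerSet w hb.1).union (isMarkedBy_upperSet hb.1)
  have hm' : IsMarkedBy (2 * K') (lowerSet 𝒮' w' st' ∪ upperSet 𝒮' st') :=
    (isMarkedBy_lowerSet w' hb'.1).union (isMarkedBy_upperSet hb'.1)
  rcases hm.exists_markPoint hm' hne with ⟨i, hi⟩ | ⟨i, hi⟩
  · exact (one_le_sum_ind ⟨i, Or.inr hi⟩).trans le_add_self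
  · exact ((one_le_sum_ind ⟨i, Or.inr hi⟩).trans le_add_self).trans le_self_add

lemma stackSum_mono {As : List (Option (Fin (q * q)) → HomeoCircle)}
    (hAs : ∀ A ∈ As, IsLegal 𝒮 fun e => A (some e)) (w : HomeoCircle)
    {G G' : HomeoCircle × List (Frame (q * q)) → ℝ≥0∞}
    (h : ∀ st, WellFormed 𝒮 st.2 → G st ≤ G' st) :
    stackSum 𝒮 w₀ b As (w, []) G ≤ stackSum 𝒮 w₀ b As (w, []) G' :=
  runSum_mono (P := fun st : HomeoCircle × List (Frame (q * q)) => WellFormed 𝒮 st.2)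
    (fun A hA _ ξ hst => WellFormed.stackStep (hAs A hA) hst ξ) (s := (w, [])) trivial h

/-- The expectation of `F` at the product of a walk with random labels, started at `g`. -/
noncomputable abbrev walkSum {r : ℕ} (w₀ b : ℝ≥0∞) :
    List (Option (Fin r) → HomeoCircle) → HomeoCircle → (HomeoCircle → ℝ≥0∞) → ℝ≥0∞ :=
  runSum (labelWeight w₀ b) fun A g ξ => A ξ * g

lemma walkSum_eq_stackSum (𝒮 : SchottkySets (q * q) K)
    (As : List (Option (Fin (q * q)) → HomeoCircle)) (g : HomeoCircle) (F : HomeoCircle → ℝ≥0∞) :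
    walkSum w₀ b As g F = stackSum 𝒮 w₀ b As (g, []) fun st => F (evalStack st.1 st.2) :=
  (runSum_comp (φ := fun st : HomeoCircle × List (Frame (q * q)) => evalStack st.1 st.2)
    (fun A st ξ => evalStack_stackStep 𝒮 A st ξ) As (g, []) F).symm

/-- The constant in the estimate for the probability of not being a ping-pong pair. -/
noncomputable def pivotConst (q K K' : ℕ) : ℝ≥0∞ := (2 * K + 1) * q + 2 * K' * (2 * q)

/-- For walks whose steps have given values for each label, the probability that they do not produce a
ping-pong pair is exponentially small in the numbers of steps, whatever these values are. -/
lemma walkSum_not_isPingPongPair_le (hq : 1 ≤ q) (hq' : 1 ≤ q')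
    (hw : w₀ + (q * q : ℕ) * b = 1) (hw' : w₀' + (q' * q' : ℕ) * b' = 1)
    {As : List (Option (Fin (q * q)) → HomeoCircle)}
    (hAs : ∀ A ∈ As, IsLegal 𝒮 fun e => A (some e))
    {As' : List (Option (Fin (q' * q')) → HomeoCircle)}
    (hAs' : ∀ A ∈ As', IsLegal 𝒮' fun e => A (some e)) (g g' : HomeoCircle) :
    walkSum w₀ b As g (fun f => walkSum w₀' b' As' g' fun f' => ind (¬ IsPingPongPair f f')) ≤
      pivotConst q K K' * pivotRate q K w₀ b ^ As.length +
        pivotConst q' K' K * pivotRate q' K' w₀' b' ^ As'.length := by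
  set ρ := pivotRate q K w₀ b
  set ρ' := pivotRate q' K' w₀' b'
  rw [walkSum_eq_stackSum 𝒮]
  simp only [walkSum_eq_stackSum 𝒮']
  refine (stackSum_mono hAs g fun st hst => stackSum_mono hAs' g' fun st' hst' =>
    ind_not_isPingPongPair_le hst hst').trans ?_
  simp only [runSum_add, runSum_sum, runSum_const (sum_labelWeight hw),
    runSum_const (sum_labelWeight hw')]
  calc _ ≤ (2 * K + 1) * q * ρ ^ As.length + (2 * K' + 1) * q' * ρ' ^ As'.length +
        ∑ _i : Fin (2 * K'), 2 * q * ρ ^ As.length +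
        ∑ _i : Fin (2 * K), 2 * q' * ρ' ^ As'.length := by
        refine add_le_add (add_le_add (add_le_add ?_ ?_) (Finset.sum_le_sum fun i _ => ?_))
          (Finset.sum_le_sum fun i _ => ?_)
        · exact stackSum_isBad_le hq hAs g
        · exact stackSum_isBad_le hq' hAs' g'
        · rw [runSum_comm]
          refine (stackSum_mono (G' := fun _ => 2 * q * ρ ^ As.length) hAs' g' fun st' _ =>
            stackSum_isBadAt_le hq hAs g _).trans ?_
          exact (runSum_const (sum_labelWeight hw') _ _ _).le
        · refine (stackSum_mono (G' := fun _ => 2 * q' * ρ' ^ As'.length) hAs g fun st _ =>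
            stackSum_isBadAt_le hq' hAs' g' _).trans ?_
          exact (runSum_const (sum_labelWeight hw) _ _ _).le
    _ = _ := by simp [pivotConst]; ring

end Pivot

/-! ### Convolution powers and mixtures -/

section ConvPow

variable {M : Type*} [Monoid M] [MeasurableSpace M] [MeasurableMul₂ M]

/-- The convolution powers of a measure on a monoid. -/
noncomputable def convPow (ν : Measure M) : ℕ → Measure M
  | 0 => Measure.dirac 1
  | n + 1 => (convPow ν n).mconv ν

instance (ν : Measure M) [IsProbabilityMeasure ν] (n : ℕ) : IsProbabilityMeasure (convPow ν n) := by
  induction n with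
  | zero => exact Measure.dirac.isProbabilityMeasure
  | succ n ih => rw [convPow]; infer_instance

lemma convPow_add (ν : Measure M) [IsProbabilityMeasure ν] (m n : ℕ) :
    convPow ν (m + n) = (convPow ν m).mconv (convPow ν n) := by
  induction n with
  | zero => rw [convPow, Measure.mconv_dirac_one]; rfl
  | succ n ih => rw [← add_assoc, convPow, ih, convPow, Measure.mconv_assoc]

lemma convPow_one (ν : Measure M) [IsProbabilityMeasure ν] : convPow ν 1 = ν := by
  rw [convPow, convPow, Measure.dirac_one_mconv]

lemma convPow_succ' (ν : Measure M) [IsProbabilityMeasure ν] (n : ℕ) :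
    convPow ν (n + 1) = ν.mconv (convPow ν n) := by
  rw [add_comm, convPow_add, convPow_one]

lemma convPow_mul (ν : Measure M) [IsProbabilityMeasure ν] (m n : ℕ) :
    convPow ν (m * n) = convPow (convPow ν m) n := by
  induction n with
  | zero => rfl
  | succ n ih => rw [Nat.mul_succ, convPow_add, ih, convPow]

end ConvPow

section RandomWalk

variable {Ω : Type*} [MeasurableSpace Ω] {P : Measure Ω} {μ : ProbabilityMeasure HomeoCircle}
  {Z : ℕ → Ω → HomeoCircle}

lemma IsRandomWalk.measurable (h : IsRandomWalk P μ Z) (n : ℕ) : Measurable (Z n) := by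
  obtain ⟨g, hg, -, -, h0, hZ⟩ := h
  induction n with
  | zero => rw [show Z 0 = fun _ => 1 from funext h0]; exact measurable_const
  | succ n ih =>
    rcases hZ with hZ | hZ
    · rw [show Z (n + 1) = Z n * g n from funext (hZ n)]; exact ih.mul (hg n)
    · rw [show Z (n + 1) = g n * Z n from funext (hZ n)]; exact (hg n).mul ih

/-- The law of the `n`-th position of a random walk is a convolution power, whichever the side on
which the steps are multiplied. -/
lemma IsRandomWalk.map_eq [IsProbabilityMeasure P] (h : IsRandomWalk P μ Z) (n : ℕ) :
    P.map (Z n) = convPow (μ : Measure HomeoCircle) n := by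
  have hmeas := h.measurable
  obtain ⟨g, hg, hlaw, hind, h0, hZ⟩ := h
  -- Each position is a function of the previous steps, hence independent of the next one.
  have hfac : ∀ n, ∃ φ : (Finset.range n → HomeoCircle) → HomeoCircle, Measurable φ ∧
      ∀ ω, Z n ω = φ fun i => g i ω := by
    intro n
    induction n with
    | zero => exact ⟨fun _ => 1, measurable_const, h0⟩
    | succ n ih =>
      obtain ⟨φ, hφ, hφZ⟩ := ih
      have hres : Measurable fun (x : Finset.range (n + 1) → HomeoCircle) (i : Finset.range n) =>
          x ⟨i, Finset.mem_range.2 ((Finset.mem_range.1 i.2).trans n.lt_succ_self)⟩ :=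
        measurable_pi_lambda _ fun i => measurable_pi_apply _
      have hlast : Measurable fun x : Finset.range (n + 1) → HomeoCircle =>
          x ⟨n, Finset.self_mem_range_succ n⟩ := measurable_pi_apply _
      rcases hZ with hZ | hZ
      · exact ⟨_, (hφ.comp hres).mul hlast, fun ω => by rw [hZ, hφZ]; rfl⟩
      · exact ⟨_, hlast.mul (hφ.comp hres), fun ω => by rw [hZ, hφZ]; rfl⟩
  have hindep : ∀ n, IndepFun (Z n) (g n) P := by
    intro n
    obtain ⟨φ, hφ, hφZ⟩ := hfac n
    have := (hind.indepFun_finset (Finset.range n) {n} (by simp) hg).comp hφ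
      (measurable_pi_apply (⟨n, Finset.mem_singleton_self n⟩ : ({n} : Finset ℕ)))
    have hZn : Z n = φ ∘ fun ω (i : Finset.range n) => g i ω := funext hφZ
    rw [hZn]
    exact this
  induction n with
  | zero =>
    have : Z 0 = fun _ => 1 := funext h0
    rw [this, Measure.map_const, measure_univ, one_smul]
    rfl
  | succ n ih =>
    rcases hZ with hZ | hZ
    · have : Z (n + 1) = Z n * g n := funext (hZ n)
      rw [this, (hindep n).map_mul_eq_map_mconv_map (hmeas n) (hg n), ih, hlaw, convPow]
    · have : Z (n + 1) = g n * Z n := funext (hZ n)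
      rw [this, (hindep n).symm.map_mul_eq_map_mconv_map (hg n) (hmeas n), ih, hlaw, convPow_succ']

end RandomWalk

section Mixture

/-- A measure that gives mass at least `r * b` to each of `r` sets is a mixture of its conditional
measures on these sets, with weights `b`, and a remainder. -/
lemma exists_mixture {X : Type*} [MeasurableSpace X] {κ : Measure X} [IsProbabilityMeasure κ]
    {r : ℕ} {w₀ b : ℝ≥0∞} (hw : w₀ + r * b = 1) (hw₀ : w₀ ≠ 0) (hr : r ≠ 0) (hb : b ≠ 0)
    {O : Fin r → Set X} (hO : ∀ e, MeasurableSet (O e)) (hκ : ∀ e, r * b ≤ κ (O e)) :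
    ∃ κs : Option (Fin r) → Measure X, (∀ ξ, IsProbabilityMeasure (κs ξ)) ∧
      (∀ e, κs (some e) (O e)ᶜ = 0) ∧ κ = ∑ ξ, labelWeight w₀ b ξ • κs ξ := by
  have hr0 : (r : ℝ≥0∞) ≠ 0 := by exact_mod_cast hr
  have hpos : ∀ e, κ (O e) ≠ 0 := fun e h => by
    have := hκ e
    rw [h, nonpos_iff_eq_zero, mul_eq_zero] at this
    exact this.elim hr0 hb
  have hw₀top : w₀ ≠ ∞ := ne_top_of_le_ne_top ENNReal.one_ne_top (hw ▸ le_self_add)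
  have hrbtop : (r : ℝ≥0∞) * b ≠ ∞ := ne_top_of_le_ne_top ENNReal.one_ne_top (hw ▸ le_add_self)
  have hprob : ∀ e, IsProbabilityMeasure (cond κ (O e)) := fun e =>
    cond_isProbabilityMeasure (hpos e)
  set σ : Measure X := ∑ e, b • cond κ (O e) with hσ
  have hσuniv : σ univ = r * b := by
    simp [hσ]
  have : IsFiniteMeasure σ := ⟨by rw [hσuniv]; exact hrbtop.lt_top⟩
  have hle : σ ≤ κ := by
    refine Measure.le_iff.2 fun s hs => ?_
    have h1 : ∀ e, b * cond κ (O e) s ≤ (r : ℝ≥0∞)⁻¹ * κ s := by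
      intro e
      rw [cond_apply (hO e), ← mul_assoc]
      refine mul_le_mul' ?_ (measure_mono inter_subset_right)
      rw [← div_eq_mul_inv, ENNReal.div_le_iff (hpos e) (measure_ne_top _ _), mul_comm,
        ← div_eq_mul_inv, ENNReal.le_div_iff_mul_le (Or.inl hr0) (Or.inl (by simp)), mul_comm]
      exact hκ e
    calc σ s = ∑ e, b * cond κ (O e) s := by simp [hσ]
      _ ≤ ∑ _e : Fin r, (r : ℝ≥0∞)⁻¹ * κ s := Finset.sum_le_sum fun e _ => h1 e
      _ = κ s := by
        rw [Finset.sum_const, Finset.card_univ, Fintype.card_fin, nsmul_eq_mul, ← mul_assoc,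
          ENNReal.mul_inv_cancel hr0 (by simp), one_mul]
  have hadd : κ - σ + σ = κ := Measure.sub_add_cancel_of_le hle
  have hsub : (κ - σ) univ = w₀ := by
    have h1 : (κ - σ) univ + r * b = w₀ + r * b := by
      rw [hw, ← hσuniv, ← Measure.add_apply, hadd, measure_univ]
    exact (ENNReal.add_left_inj hrbtop).1 h1
  refine ⟨fun ξ => ξ.elim (w₀⁻¹ • (κ - σ)) fun e => cond κ (O e), ?_, ?_, ?_⟩
  · rintro (_ | e)
    · exact ⟨by simp [hsub, ENNReal.inv_mul_cancel hw₀ hw₀top]⟩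
    · exact hprob e
  · intro e
    simp only [Option.elim]
    rw [cond_apply (hO e), inter_compl_self, measure_empty, mul_zero]
  · rw [Fintype.sum_option]
    simp only [labelWeight, Option.elim, smul_smul, ENNReal.mul_inv_cancel hw₀ hw₀top, one_smul]
    exact hadd.symm

variable {r : ℕ} {w₀ b : ℝ≥0∞} {κ : Measure HomeoCircle} [IsProbabilityMeasure κ]
  {κs : Option (Fin r) → Measure HomeoCircle} {L : Fin r → Set HomeoCircle}

/-- If the law of the steps is a mixture, the labels of the steps being the components they are
drawn from, then a bound that holds for all values of the steps with each label holds for the walk: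
replacing the random values one step at a time, by values that do not decrease the expectation,
leaves only the labels random. -/
lemma walkSum_lintegral_convPow_le [∀ ξ, IsProbabilityMeasure (κs ξ)] (hw : w₀ + r * b = 1)
    (hκ : κ = ∑ ξ, labelWeight w₀ b ξ • κs ξ) (hL : ∀ e, κs (some e) (L e)ᶜ = 0)
    {F : HomeoCircle → ℝ≥0∞} (hF : Measurable F) (hF1 : ∀ x, F x ≤ 1) {c : ℝ≥0∞} {g : HomeoCircle}
    {T : ℕ} {As₀ : List (Option (Fin r) → HomeoCircle)}
    (h : ∀ As : List (Option (Fin r) → HomeoCircle), As.length = T →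
      (∀ A ∈ As, ∀ e, A (some e) ∈ L e) → walkSum w₀ b (As₀ ++ As) g F ≤ c) :
    walkSum w₀ b As₀ g (fun x => ∫⁻ y, F (y * x) ∂convPow κ T) ≤ c := by
  have hmul : ∀ F : HomeoCircle → ℝ≥0∞, Measurable F → ∀ x, Measurable fun y => F (y * x) :=
    fun F hF x => hF.comp (measurable_id.mul_const x)
  induction T generalizing As₀ with
  | zero =>
    have h0 := h [] rfl (by simp)
    rw [List.append_nil] at h0
    refine le_trans (le_of_eq ?_) h0
    congr 1
    ext x
    rw [convPow, lintegral_dirac' _ (hmul F hF x), one_mul]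
  | succ T ih =>
    set Φ : HomeoCircle → ℝ≥0∞ := fun x => ∫⁻ y, F (y * x) ∂convPow κ T with hΦ
    have hΦm : Measurable Φ :=
      (hF.comp (measurable_snd.mul measurable_fst)).lintegral_prod_right'
        (f := fun p : HomeoCircle × HomeoCircle => F (p.2 * p.1))
    have hΦ1 : ∀ x, Φ x ≤ 1 := fun x => by
      calc Φ x ≤ ∫⁻ _, 1 ∂convPow κ T := lintegral_mono fun y => hF1 _
        _ = 1 := by simp
    have hsucc : ∀ x, ∫⁻ y, F (y * x) ∂convPow κ (T + 1) =
        ∑ ξ, labelWeight w₀ b ξ * ∫⁻ y, Φ (y * x) ∂κs ξ := by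
      intro x
      rw [convPow, Measure.lintegral_mconv (hmul F hF x),
        lintegral_lintegral_swap]
      · simp only [mul_assoc]
        change ∫⁻ y, Φ (y * x) ∂κ = _
        conv_lhs => rw [hκ]
        rw [lintegral_finsetSum_measure]
        simp only [lintegral_smul_measure, smul_eq_mul]
      · exact (hF.comp ((measurable_fst.mul measurable_snd).mul_const x)).aemeasurable
    simp only [hsucc]
    have hm := hmul Φ hΦm
    have hchoose : ∀ ξ, ∃ y, (∀ e, ξ = some e → y ∈ L e) ∧
        walkSum w₀ b As₀ g (fun x => ∫⁻ y, Φ (y * x) ∂κs ξ) ≤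
          walkSum w₀ b As₀ g fun x => Φ (y * x) := by
      intro ξ
      rw [walkSum, runSum_lintegral hm]
      set ψ : HomeoCircle → ℝ≥0∞ := fun y => walkSum w₀ b As₀ g fun x => Φ (y * x)
      have hψ : ∫⁻ y, ψ y ∂κs ξ ≠ ∞ := by
        refine ne_top_of_le_ne_top ENNReal.one_ne_top ?_
        calc ∫⁻ y, ψ y ∂κs ξ ≤ ∫⁻ _, 1 ∂κs ξ := lintegral_mono fun y => by
              refine (runSum_mono (P := fun _ => True) (fun _ _ _ _ _ => trivial) trivial
                fun x _ => hΦ1 _).trans ?_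
              exact (runSum_const (sum_labelWeight hw) _ _ _).le
          _ = 1 := by simp
      have hnull : κs ξ {y | ¬ ∀ e, ξ = some e → y ∈ L e} = 0 := by
        cases ξ with
        | none => simp
        | some e =>
          rw [← hL e]
          congr 1
          ext y
          simp
      obtain ⟨y, hy, hyψ⟩ := exists_notMem_null_lintegral_le hψ hnull
      exact ⟨y, by simpa using hy, hyψ⟩
    choose A hA hAle using hchoose
    calc walkSum w₀ b As₀ g (fun x => ∑ ξ, labelWeight w₀ b ξ * ∫⁻ y, Φ (y * x) ∂κs ξ)
        = ∑ ξ, walkSum w₀ b As₀ g (fun x => labelWeight w₀ b ξ * ∫⁻ y, Φ (y * x) ∂κs ξ) :=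
          runSum_sum _ _ _ _
      _ ≤ ∑ ξ, walkSum w₀ b As₀ g (fun x => labelWeight w₀ b ξ * Φ (A ξ * x)) := by
          refine Finset.sum_le_sum fun ξ _ => ?_
          unfold walkSum
          rw [runSum_const_mul, runSum_const_mul]
          exact mul_le_mul_right (hAle ξ) _
      _ = walkSum w₀ b (As₀ ++ [A]) g Φ := by
          rw [walkSum, runSum_append_singleton, runSum_sum]
      _ ≤ c := ih fun As hlen hAs => by
          rw [List.append_assoc]
          refine h _ (by simp [hlen]) fun B hB => ?_
          rcases List.mem_append.1 hB with hB | hB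
          · rw [List.mem_singleton.1 hB]
            exact fun e => hA _ e rfl
          · exact hAs B hB

variable {r' : ℕ} {w₀' b' : ℝ≥0∞} {κ' : Measure HomeoCircle} [IsProbabilityMeasure κ']
  {κs' : Option (Fin r') → Measure HomeoCircle} {L' : Fin r' → Set HomeoCircle}

lemma lintegral_lintegral_convPow_le [∀ ξ, IsProbabilityMeasure (κs ξ)]
    [∀ ξ, IsProbabilityMeasure (κs' ξ)] (hw : w₀ + r * b = 1) (hw' : w₀' + r' * b' = 1)
    (hκ : κ = ∑ ξ, labelWeight w₀ b ξ • κs ξ) (hκ' : κ' = ∑ ξ, labelWeight w₀' b' ξ • κs' ξ)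
    (hL : ∀ e, κs (some e) (L e)ᶜ = 0) (hL' : ∀ e, κs' (some e) (L' e)ᶜ = 0)
    {F : HomeoCircle → HomeoCircle → ℝ≥0∞} (hF : Measurable F.uncurry) (hF1 : ∀ x y, F x y ≤ 1)
    {c : ℝ≥0∞} {g g' : HomeoCircle} {T T' : ℕ}
    (h : ∀ (As : List (Option (Fin r) → HomeoCircle)) (As' : List (Option (Fin r') → HomeoCircle)),
      As.length = T → As'.length = T' → (∀ A ∈ As, ∀ e, A (some e) ∈ L e) →
      (∀ A ∈ As', ∀ e, A (some e) ∈ L' e) →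
      walkSum w₀ b As g (fun f => walkSum w₀' b' As' g' (F f)) ≤ c) :
    ∫⁻ x, ∫⁻ y, F (x * g) (y * g') ∂convPow κ' T' ∂convPow κ T ≤ c := by
  have hFx : ∀ x, Measurable fun y => F x y := fun x => hF.comp measurable_prodMk_left
  refine walkSum_lintegral_convPow_le (As₀ := []) (g := g) hw hκ hL
    (F := fun x => ∫⁻ y, F x (y * g') ∂convPow κ' T') ?_ (fun x => ?_) fun As hlen hAs => ?_
  · exact (hF.comp (measurable_fst.prodMk (measurable_snd.mul_const g'))).lintegral_prod_right'
      (f := fun p : HomeoCircle × HomeoCircle => F p.1 (p.2 * g'))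
  · calc ∫⁻ y, F x (y * g') ∂convPow κ' T'
        ≤ ∫⁻ _, 1 ∂convPow κ' T' := lintegral_mono fun y => hF1 _ _
      _ = 1 := by simp
  · have hm : ∀ x, Measurable fun y => F x (y * g') := fun x =>
      (hFx x).comp (measurable_id.mul_const g')
    rw [List.nil_append, walkSum, runSum_lintegral hm]
    refine walkSum_lintegral_convPow_le (As₀ := []) (g := g') hw' hκ' hL'
      (F := fun y => walkSum w₀ b As g fun x => F x y) ?_ (fun y => ?_) fun As' hlen' hAs' => ?_
    · exact measurable_runSum hFx As g
    · refine (runSum_mono (P := fun _ => True) (fun _ _ _ _ _ => trivial) trivial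
        fun x _ => hF1 x y).trans ?_
      exact (runSum_const (sum_labelWeight hw) _ _ _).le
    · exact (runSum_comm As As' g g' F).symm.le.trans (h As As' hlen hlen' hAs hAs')

end Mixture

/-! ### The exponential estimate -/

section Estimate

lemma isOpen_setOf_isPingPongPair :
    IsOpen {p : HomeoCircle × HomeoCircle | IsPingPongPair p.1 p.2} := by
  rw [isOpen_iff_mem_nhds]
  rintro ⟨f₁, f₂⟩ ⟨U₁, U₂, V₁, V₂, hU₁, hU₂, hV₁, hV₂, d1, d2, d3, d4, d5, d6, h₁, -, h₂, -⟩
  have o₁ := HomeoCircle.isOpen_setOf_mapsTo hU₁.isClosed_compl.isCompact hV₁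
  have o₂ := HomeoCircle.isOpen_setOf_mapsTo hU₂.isClosed_compl.isCompact hV₂
  refine Filter.mem_of_superset ((o₁.prod o₂).mem_nhds
    ⟨mapsTo_iff_image_subset.2 h₁, mapsTo_iff_image_subset.2 h₂⟩) ?_
  rintro ⟨g₁, g₂⟩ ⟨hg₁, hg₂⟩
  exact ⟨U₁, U₂, V₁, V₂, hU₁, hU₂, hV₁, hV₂, d1, d2, d3, d4, d5, d6, MapsTo.image_subset hg₁,
    image_symm_compl_subset hg₁, MapsTo.image_subset hg₂, image_symm_compl_subset hg₂⟩

lemma measurable_ind_not_isPingPongPair :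
    Measurable (Function.uncurry fun f f' : HomeoCircle => ind (¬ IsPingPongPair f f')) := by
  classical
  have : (Function.uncurry fun f f' : HomeoCircle => ind (¬ IsPingPongPair f f')) =
      {p : HomeoCircle × HomeoCircle | IsPingPongPair p.1 p.2}ᶜ.indicator 1 := by
    ext ⟨f, f'⟩
    by_cases h : IsPingPongPair f f'
    · simp [Function.uncurry, h, ind_of_not]
    · simp [Function.uncurry, h, ind_of]
  rw [this]
  exact measurable_one.indicator isOpen_setOf_isPingPongPair.measurableSet.compl

/-- Products of elements of the support of `μ` are charged by the convolution powers, uniformly near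
`μ`. -/
lemma exists_eventually_le_convPow {μ : ProbabilityMeasure HomeoCircle} (l : List HomeoCircle)
    (hl : ∀ x ∈ l, x ∈ (μ : Measure HomeoCircle).support) {O : Set HomeoCircle} (hO : IsOpen O)
    (hlO : l.prod ∈ O) :
    ∃ a > 0, ∀ᶠ ν : ProbabilityMeasure HomeoCircle in 𝓝 μ,
      a ≤ convPow (ν : Measure HomeoCircle) l.length O := by
  induction l generalizing O with
  | nil =>
    refine ⟨1, one_pos, Eventually.of_forall fun ν => ?_⟩
    rw [List.length_nil, convPow, Measure.dirac_apply' _ hO.measurableSet,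
      indicator_of_mem (by simpa using hlO)]
    rfl
  | cons x l ih =>
    rw [List.prod_cons] at hlO
    obtain ⟨A, B, hA, hB, hxA, hlB, hAB⟩ := isOpen_prod_iff.1 (hO.preimage continuous_mul) _ _ hlO
    obtain ⟨a, ha, hea⟩ := ih (fun y hy => hl y (List.mem_cons_of_mem _ hy)) hB hlB
    have hμA : 0 < (μ : Measure HomeoCircle) A :=
      (Measure.mem_support_iff_forall x).1 (hl x List.mem_cons_self) A (hA.mem_nhds hxA)
    obtain ⟨c, hc, hcA⟩ := exists_between hμA
    refine ⟨c * a, ENNReal.mul_pos hc.ne' ha.ne', ?_⟩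
    filter_upwards [hea, lowerSemicontinuous_measure_of_isOpen hA μ c hcA] with ν hν hνA
    rw [List.length_cons, convPow_succ', Measure.mconv,
      Measure.map_apply measurable_mul hO.measurableSet]
    calc c * a ≤ (ν : Measure HomeoCircle) A * convPow (ν : Measure HomeoCircle) l.length B :=
          mul_le_mul' hνA.le hν
      _ = ((ν : Measure HomeoCircle).prod (convPow (ν : Measure HomeoCircle) l.length)) (A ×ˢ B) :=
          (Measure.prod_prod _ _).symm
      _ ≤ _ := measure_mono hAB

/-- Weights for which the contractions of `q * q` Schottky sets with `q = 2 * K + 2` make the rate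
of the pivot argument less than `1`, uniformly near `μ`. -/
lemma exists_pivot {μ : ProbabilityMeasure HomeoCircle}
    (h : ¬ AdmitsInvariantProbability (suppSemigroup μ)) :
    ∃ (q K N : ℕ) (w₀ b : ℝ≥0∞) (𝒮 : SchottkySets (q * q) K), 1 ≤ q ∧ 0 < N ∧ w₀ ≠ 0 ∧ b ≠ 0 ∧
      w₀ + (q * q : ℕ) * b = 1 ∧ pivotRate q K w₀ b < 1 ∧
      ∀ᶠ ν : ProbabilityMeasure HomeoCircle in 𝓝 μ, ∀ e, (q * q : ℕ) * b ≤
        convPow (ν : Measure HomeoCircle) N {f : HomeoCircle | MapsTo f (𝒮.U e)ᶜ (𝒮.V e)} := by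
  obtain ⟨K, hK⟩ := exists_schottkySets_words h
  set q := 2 * K + 2 with hq
  obtain ⟨N, hN, 𝒮, h𝒮⟩ := hK (q * q)
  have hO : ∀ e, IsOpen {f : HomeoCircle | MapsTo f (𝒮.U e)ᶜ (𝒮.V e)} := fun e =>
    HomeoCircle.isOpen_setOf_mapsTo (𝒮.isOpen_U e).isClosed_compl.isCompact (𝒮.isOpen_V e)
  have hev : ∀ e, ∃ a > 0, ∀ᶠ ν : ProbabilityMeasure HomeoCircle in 𝓝 μ, a ≤
      convPow (ν : Measure HomeoCircle) N {f : HomeoCircle | MapsTo f (𝒮.U e)ᶜ (𝒮.V e)} := by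
    intro e
    obtain ⟨l, rfl, hl, hle⟩ := h𝒮 e
    exact exists_eventually_le_convPow l hl (hO e) hle
  choose a ha hea using hev
  obtain ⟨e₀, he₀⟩ := Finite.exists_min (α := Option (Fin (q * q)))
    (fun ξ => ξ.elim (2⁻¹ : ℝ≥0∞) a)
  -- The total weight of the labels; it stays away from `1` to leave room for the remainder.
  set m : ℝ≥0∞ := e₀.elim 2⁻¹ a
  have hm0 : m ≠ 0 := by
    cases he : e₀ with
    | none => simp [m, he]
    | some e => simpa [m, he] using (ha e).ne'
  have hm2 : m ≤ 2⁻¹ := he₀ none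
  have hm1 : m < 1 := hm2.trans_lt (by simp)
  have hr0 : ((q * q : ℕ) : ℝ≥0∞) ≠ 0 := by simp [hq]
  have hrb : ((q * q : ℕ) : ℝ≥0∞) * (m / (q * q : ℕ)) = m :=
    ENNReal.mul_div_cancel hr0 (ENNReal.natCast_ne_top _)
  have hb0 : m / (q * q : ℕ) ≠ 0 := ENNReal.div_ne_zero.2 ⟨hm0, ENNReal.natCast_ne_top _⟩
  have hw : (1 - m) + (q * q : ℕ) * (m / (q * q : ℕ)) = 1 := by
    rw [hrb, tsub_add_cancel_of_le hm1.le]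
  refine ⟨q, K, N, 1 - m, m / (q * q : ℕ), 𝒮, by omega, hN, (tsub_pos_of_lt hm1).ne', hb0, hw,
    ?_, ?_⟩
  · set b := m / (q * q : ℕ)
    have hsum : pivotRate q K (1 - m) b + q * b = 1 := by
      refine Eq.trans ?_ hw
      rw [pivotRate, hq]
      push_cast
      ring
    have hqb : (q : ℝ≥0∞) * b ≠ 0 := mul_ne_zero (by simp [hq]) hb0
    have hle : pivotRate q K (1 - m) b ≤ 1 := le_self_add.trans hsum.le
    exact (ENNReal.lt_add_right (ne_top_of_le_ne_top ENNReal.one_ne_top hle) hqb).trans_eq hsum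
  · filter_upwards [eventually_all.2 hea] with ν hν e
    rw [hrb]
    exact (he₀ (some e)).trans (hν e)

lemma lintegral_mconv_le {A B : Measure HomeoCircle} [IsProbabilityMeasure A]
    [IsProbabilityMeasure B] {f : HomeoCircle → ℝ≥0∞} (hf : Measurable f) {c : ℝ≥0∞}
    (h : ∀ g, ∫⁻ x, f (x * g) ∂A ≤ c) : ∫⁻ z, f z ∂(A.mconv B) ≤ c := by
  have hm : Measurable (Function.uncurry fun x y : HomeoCircle => f (x * y)) :=
    hf.comp (measurable_fst.mul measurable_snd)
  rw [Measure.lintegral_mconv hf, lintegral_lintegral_swap hm.aemeasurable]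
  calc ∫⁻ g, ∫⁻ x, f (x * g) ∂A ∂B ≤ ∫⁻ _, c ∂B := lintegral_mono h
    _ = c := by simp

lemma lintegral_lintegral_mconv_le {A B A' B' : Measure HomeoCircle} [IsProbabilityMeasure A]
    [IsProbabilityMeasure B] [IsProbabilityMeasure A'] [IsProbabilityMeasure B']
    {F : HomeoCircle → HomeoCircle → ℝ≥0∞} (hF : Measurable F.uncurry) {c : ℝ≥0∞}
    (h : ∀ g g', ∫⁻ x, ∫⁻ y, F (x * g) (y * g') ∂A' ∂A ≤ c) :
    ∫⁻ x, ∫⁻ y, F x y ∂(A'.mconv B') ∂(A.mconv B) ≤ c := by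
  refine lintegral_mconv_le hF.lintegral_prod_right' fun g => ?_
  have hFg : Measurable fun p : HomeoCircle × HomeoCircle => F (p.1 * g) p.2 :=
    hF.comp ((measurable_fst.mul_const g).prodMk measurable_snd)
  rw [lintegral_lintegral_swap hFg.aemeasurable]
  refine lintegral_mconv_le hFg.lintegral_prod_left' fun g' => ?_
  rw [← lintegral_lintegral_swap]
  · exact h g g'
  · exact (hFg.comp (measurable_fst.prodMk (measurable_snd.mul_const g'))).aemeasurable

/-- Exponential decay in the number of blocks of length `N` is exponential decay in the number of
steps. The small number `κ` is both the rate and the inverse of the constant; the factor `2` makes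
room for the sum of two such terms. -/
lemma exists_mul_pow_div_le {D ρ : ℝ≥0∞} (hD : D ≠ ∞) (hρ : ρ < 1) {N : ℕ} (hN : 0 < N) :
    ∃ κ₀ : ℝ, 0 < κ₀ ∧ ∀ κ, 0 < κ → κ ≤ κ₀ → ∀ n : ℕ,
      D * ρ ^ (n / N) ≤ ENNReal.ofReal (1 / (2 * κ) * Real.exp (-κ * n)) := by
  set s : ℝ := max ρ.toReal (1 / 2) with hs
  have hs0 : 0 < s := lt_of_lt_of_le (by norm_num) (le_max_right _ _)
  have hs1 : s < 1 := max_lt ((ENNReal.toReal_lt_toReal hρ.ne_top ENNReal.one_ne_top).2 hρ)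
    (by norm_num)
  have hlog : Real.log s < 0 := Real.log_neg hs0 hs1
  have hN' : (0 : ℝ) < N := by exact_mod_cast hN
  set d := D.toReal
  have hd : 0 ≤ d := ENNReal.toReal_nonneg
  refine ⟨min (-Real.log s / N) (s / (2 * (d + 1))), lt_min (div_pos (neg_pos.2 hlog) hN')
    (by positivity), fun κ hκ hκle n => ?_⟩
  have h1 : κ * N ≤ -Real.log s := (le_div_iff₀ hN').1 (hκle.trans (min_le_left _ _))
  have h2 : κ * (2 * (d + 1)) ≤ s := (le_div_iff₀ (by positivity)).1 (hκle.trans (min_le_right _ _))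
  have hpow : ρ.toReal ^ (n / N) ≤ Real.exp (-κ * n) / s := by
    calc ρ.toReal ^ (n / N) ≤ s ^ (n / N) :=
          pow_le_pow_left₀ ENNReal.toReal_nonneg (le_max_left _ _) _
      _ = Real.exp ((n / N : ℕ) * Real.log s) := by
          rw [← Real.log_pow, Real.exp_log (pow_pos hs0 _)]
      _ ≤ Real.exp (-κ * n - Real.log s) := by
          refine Real.exp_le_exp.2 ?_
          have hlt : (n : ℝ) ≤ N * ((n / N : ℕ) + 1) := by
            exact_mod_cast (Nat.lt_mul_div_succ n hN).le
          have h3 : κ * n ≤ κ * N * ((n / N : ℕ) + 1) := by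
            rw [mul_assoc]; exact mul_le_mul_of_nonneg_left hlt hκ.le
          have h4 : κ * N * (((n / N : ℕ) : ℝ) + 1) ≤ -Real.log s * (((n / N : ℕ) : ℝ) + 1) :=
            mul_le_mul_of_nonneg_right h1 (by positivity)
          linarith
      _ = Real.exp (-κ * n) / s := by rw [Real.exp_sub, Real.exp_log hs0]
  have hds : d / s ≤ 1 / (2 * κ) := by
    rw [div_le_div_iff₀ hs0 (by positivity)]
    nlinarith
  rw [← ENNReal.ofReal_toReal hD, ← ENNReal.ofReal_toReal hρ.ne_top,
    ← ENNReal.ofReal_pow ENNReal.toReal_nonneg, ← ENNReal.ofReal_mul hd]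
  refine ENNReal.ofReal_le_ofReal ?_
  calc d * ρ.toReal ^ (n / N) ≤ d * (Real.exp (-κ * n) / s) := mul_le_mul_of_nonneg_left hpow hd
    _ = d / s * Real.exp (-κ * n) := by ring
    _ ≤ _ := mul_le_mul_of_nonneg_right hds (Real.exp_pos _).le

lemma pivotConst_ne_top (q K K' : ℕ) : pivotConst q K K' ≠ ∞ := by
  rw [pivotConst]
  exact_mod_cast ENNReal.natCast_ne_top ((2 * K + 1) * q + 2 * K' * (2 * q))

lemma measure_not_isPingPongPair {Ω : Type u} [MeasurableSpace Ω] {P : Measure Ω}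
    [IsProbabilityMeasure P] {μ μ' : ProbabilityMeasure HomeoCircle} {Z Z' : ℕ → Ω → HomeoCircle}
    (hZ : IsRandomWalk P μ Z) (hZ' : IsRandomWalk P μ' Z')
    (hind : IndepFun (fun ω n => Z n ω) (fun ω n => Z' n ω) P) (n : ℕ) :
    P {ω | IsPingPongPair (Z n ω) (Z' n ω)}ᶜ =
      ∫⁻ x, ∫⁻ y, ind (¬ IsPingPongPair x y) ∂convPow (μ' : Measure HomeoCircle) n
        ∂convPow (μ : Measure HomeoCircle) n := by
  have hm := hZ.measurable n
  have hm' := hZ'.measurable n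
  have hindn : IndepFun (Z n) (Z' n) P :=
    hind.comp (measurable_pi_apply n) (measurable_pi_apply n)
  have hset := isOpen_setOf_isPingPongPair.measurableSet.compl
  have hmap := hindn.map_prod_eq_prod_map_map hm.aemeasurable hm'.aemeasurable
  rw [hZ.map_eq, hZ'.map_eq] at hmap
  have h1 : P {ω | IsPingPongPair (Z n ω) (Z' n ω)}ᶜ = (P.map fun ω => (Z n ω, Z' n ω))
      {p : HomeoCircle × HomeoCircle | IsPingPongPair p.1 p.2}ᶜ :=
    (Measure.map_apply (hm.prodMk hm') hset).symm
  rw [h1, hmap, ← lintegral_indicator_one hset]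
  have h2 := lintegral_prod (μ := convPow (μ : Measure HomeoCircle) n)
    (ν := convPow (μ' : Measure HomeoCircle) n) _ measurable_ind_not_isPingPongPair.aemeasurable
  refine Eq.trans (lintegral_congr fun p => ?_) h2
  by_cases h : IsPingPongPair p.1 p.2
  · simp [Function.uncurry, h, ind_of_not]
  · simp [Function.uncurry, h, ind_of]

/-- The exponential estimate holds uniformly near two measures without invariant probability. -/
lemma exists_nhds_pingPongEstimate {μ₁ μ₂ : ProbabilityMeasure HomeoCircle}
    (h₁ : ¬ AdmitsInvariantProbability (suppSemigroup μ₁))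
    (h₂ : ¬ AdmitsInvariantProbability (suppSemigroup μ₂)) :
    ∃ 𝒰₁ ∈ 𝓝 μ₁, ∃ 𝒰₂ ∈ 𝓝 μ₂, ∃ κ : ℝ, 0 < κ ∧
      ∀ ν₁ ∈ 𝒰₁, ∀ ν₂ ∈ 𝒰₂, PingPongEstimate.{u} κ ν₁ ν₂ := by
  obtain ⟨q, K, N, w₀, b, 𝒮, hq, hN, hw₀, hb, hw, hρ, hν⟩ := exists_pivot h₁
  obtain ⟨q', K', N', w₀', b', 𝒮', hq', hN', hw₀', hb', hw', hρ', hν'⟩ := exists_pivot h₂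
  obtain ⟨κ₁, hκ₁, hle₁⟩ := exists_mul_pow_div_le (pivotConst_ne_top q K K') hρ hN
  obtain ⟨κ₂, hκ₂, hle₂⟩ := exists_mul_pow_div_le (pivotConst_ne_top q' K' K) hρ' hN'
  refine ⟨_, hν, _, hν', min κ₁ κ₂, lt_min hκ₁ hκ₂, ?_⟩
  intro ν₁ hν₁ ν₂ hν₂ Ω _ P _ Z Z' hZ hZ' hind n _
  set κ := min κ₁ κ₂
  have hκ : 0 < κ := lt_min hκ₁ hκ₂
  have hmeas : ∀ {r K : ℕ} (𝒮 : SchottkySets r K) (e),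
      MeasurableSet {f : HomeoCircle | MapsTo f (𝒮.U e)ᶜ (𝒮.V e)} := fun 𝒮 e =>
    (HomeoCircle.isOpen_setOf_mapsTo (𝒮.isOpen_U e).isClosed_compl.isCompact
      (𝒮.isOpen_V e)).measurableSet
  obtain ⟨κs, hprob, hnull, hmix⟩ := exists_mixture hw hw₀ (by positivity) hb (hmeas 𝒮) hν₁
  obtain ⟨κs', hprob', hnull', hmix'⟩ := exists_mixture hw' hw₀' (by positivity) hb' (hmeas 𝒮') hν₂
  have hbound : P {ω | IsPingPongPair (Z n ω) (Z' n ω)}ᶜ ≤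
      pivotConst q K K' * pivotRate q K w₀ b ^ (n / N) +
        pivotConst q' K' K * pivotRate q' K' w₀' b' ^ (n / N') := by
    rw [measure_not_isPingPongPair hZ hZ' hind]
    -- The walks consist of blocks of `N` and `N'` steps, followed by the remaining steps.
    rw [show convPow (ν₁ : Measure HomeoCircle) n = (convPow (convPow (ν₁ : Measure HomeoCircle) N)
        (n / N)).mconv (convPow (ν₁ : Measure HomeoCircle) (n % N)) by
      rw [← convPow_mul, ← convPow_add, Nat.div_add_mod],
      show convPow (ν₂ : Measure HomeoCircle) n = (convPow (convPow (ν₂ : Measure HomeoCircle) N')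
        (n / N')).mconv (convPow (ν₂ : Measure HomeoCircle) (n % N')) by
      rw [← convPow_mul, ← convPow_add, Nat.div_add_mod]]
    refine lintegral_lintegral_mconv_le measurable_ind_not_isPingPongPair fun g g' => ?_
    refine lintegral_lintegral_convPow_le (F := fun f f' => ind (¬ IsPingPongPair f f')) hw hw' hmix
      hmix' hnull hnull' measurable_ind_not_isPingPongPair (fun _ _ => ind_le_one _)
      fun As As' hlen hlen' hAs hAs' => ?_
    have h := walkSum_not_isPingPongPair_le (𝒮 := 𝒮) (𝒮' := 𝒮') hq hq' hw hw' hAs hAs' g g'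
    rwa [hlen, hlen'] at h
  have hexp : P {ω | IsPingPongPair (Z n ω) (Z' n ω)}ᶜ ≤
      ENNReal.ofReal (1 / κ * Real.exp (-κ * n)) := by
    refine hbound.trans ((add_le_add (hle₁ κ hκ (min_le_left _ _) n)
      (hle₂ κ hκ (min_le_right _ _) n)).trans (le_of_eq ?_))
    rw [← ENNReal.ofReal_add (by positivity) (by positivity)]
    congr 1
    field_simp
    ring
  have hmeasPP : MeasurableSet {ω | IsPingPongPair (Z n ω) (Z' n ω)} :=
    ((hZ.measurable n).prodMk (hZ'.measurable n)) isOpen_setOf_isPingPongPair.measurableSet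
  have hcompl : P.real {ω | IsPingPongPair (Z n ω) (Z' n ω)}ᶜ ≤ 1 / κ * Real.exp (-κ * n) :=
    ENNReal.toReal_le_of_le_ofReal (by positivity) hexp
  rw [probReal_compl_eq_one_sub hmeasPP] at hcompl
  linarith

end Estimate

end

theorem theorem1p2 (μ₁ μ₂ : ProbabilityMeasure HomeoCircle)
    (h₁ : ¬ AdmitsInvariantProbability (suppSemigroup μ₁))
    (h₂ : ¬ AdmitsInvariantProbability (suppSemigroup μ₂)) :
    (∃ κ : ℝ, 0 < κ ∧ PingPongEstimate.{u} κ μ₁ μ₂) ∧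
    ∃ 𝒰₁ ∈ 𝓝 μ₁, ∃ 𝒰₂ ∈ 𝓝 μ₂, ∃ κ : ℝ, 0 < κ ∧
      ∀ ν₁ ∈ 𝒰₁, ∀ ν₂ ∈ 𝒰₂, PingPongEstimate.{u} κ ν₁ ν₂ := by
  obtain ⟨𝒰₁, h𝒰₁, 𝒰₂, h𝒰₂, κ, hκ, h⟩ := exists_nhds_pingPongEstimate.{u} h₁ h₂
  exact ⟨⟨κ, hκ, h μ₁ (mem_of_mem_nhds h𝒰₁) μ₂ (mem_of_mem_nhds h𝒰₂)⟩,
    𝒰₁, h𝒰₁, 𝒰₂, h𝒰₂, κ, hκ, h⟩
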